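/- Let $N\ge 1$, let $D\subset\mathbb{R}^N$ be a bounded open set and $\Omega\subseteq D$ an open subset (in particular, $\Omega\subset\subset D$ is allowed). Let $2\le p<\infty$ and $1/p+1/q=1$. $W_0^{1,p}(\Omega)$ is the closure of $C_c^\infty(\Omega)$ for the norm $(\int|y|^p+\sum_i\int|\partial_i y|^p)^{1/p}$, and $W^{-1,q}(D)$ is the dual of $W_0^{1,p}(D)$; functions in $W_0^{1,p}(\Omega)$ are extended by zero to $D$. For $\eta\in\mathbb{R}^N$ put $[\eta^{p-2}]=\mathrm{diag}(|\eta_1|^{p-2},\dots,|\eta_N|^{p-2})$. **Controls.** Let $0<\alpha\le\beta$. $M_p^{\alpha,\beta}(D)$ is the set of symmetric matrices $\mathcal U=[a_{ij}]\in L^\infty(D;\mathbb{R}^{N\times N})$ such that, for a.e. $x\in D$, $|a_{ij}(x)|\le\beta$ for all $i,j$, and for all $\zeta,\eta\in\mathbb{R}^N$ $$\big(\mathcal U(x)([\zeta^{p-2}]\zeta-[\eta^{p-2}]\eta),\zeta-\eta\big)\ge 0,\qquad \big(\mathcal U(x)[\zeta^{p-2}]\zeta,\zeta\big)\ge\alpha\sum_k|\zeta_k|^p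 .$$ Let $\xi_1,\xi_2\in L^\infty(D)$ with $0\le\xi_1\le\xi_2$ a.e., and let $Q_1,\dots,Q_N$ be nonempty compact convex subsets of $W^{-1,q}(D)$. $U_{ad}$ is the set of $\mathcal U=[a_{ij}]=[u_1,\dots,u_N]\in M_p^{\alpha,\beta}(D)$ with $\xi_1\le a_{ij}\le\xi_2$ a.e. in $D$ for all $i,j$ and $\mathrm{div}\,u_i\in Q_i$ for all $i$, where $\langle\mathrm{div}\,u,\varphi\rangle=-\int_D(u,\nabla\varphi)\,dx$ for $\varphi\in W_0^{1,p}(D)$. **Equations.** Let $f\in W^{-1,q}(D)$, $g\in L^p(D)$, let $B:L^q(\Omega)\to L^p(\Omega)$ and $F:W_0^{1,p}(\Omega)\times L^p(\Omega)\to L^q(\Omega)$ be given, and write $\langle\nu,z\rangle=\int_\Omega\nu z\,dx$. For $\mathcal U\in U_{ad}$, $y\in W_0^{1,p}(\Omega)$ is a weak solution of the state equation if $$\int_\Omega(\mathcal U[(\nabla y)^{p-2}]\nabla y,\nabla v)\,dx+\int_\Omega|y|^{p-2}y\,v\,dx=\langle f,v\rangle\quad\forall v\in W_0^{1,p}(\Omega).$$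 For $y\in W_0^{1,p}(\Omega)$ let $\mathcal H(y)$ be the set of $z\in L^p(\Omega)$ with $z+BF(y,z)=g$ in the sense of distributions in $\Omega$. Let $\Xi_{sol}$ be the set of triplets $(\mathcal U,y,z)\in L^\infty(D;\mathbb{R}^{N\times N})\times W_0^{1,p}(\Omega)\times L^p(\Omega)$ such that $\mathcal U\in U_{ad}$, $y$ is a weak solution of the state equation for $\mathcal U$, and $z\in\mathcal H(y)$. Let $\tau$ be the product of the weak-$*$ topology of $L^\infty(D;\mathbb{R}^{N\times N})$ and the weak topologies of $W_0^{1,p}(\Omega)$ and $L^p(\Omega)$. **Hypotheses.** 1. $B$ is linear, continuous and positive: $\langle\nu,B\nu\rangle>0$ for all $\nu\ne 0$. $B_r^{-1}$ is a right inverse of $B$ on the range of $B$, that is, $BB_r^{-1}h=h$ for all $h$ in the range, and $g|_\Omega$ belongs to the range of $B$ (which is automatic if $B$ has a right inverse on all of $L^p(\Omega)$). 2. $F$ has uniformly semi-bounded variation: for every bounded $Y_0\subset W_0^{1,p}(\Omega)$ there are a seminorm $|||\cdot|||$ on $L^p(\Omega)$ that is compact with respect to the norm (the unit ball of $L^p(\Omega)$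 is totally bounded for it) and functions $C_y:[0,\infty)^2\to\mathbb{R}$, $y\in Y_0$, continuous and with $C_y(r,t)/t\to0$ as $t\to0^+$ for every $r>0$, such that $\langle F(y,z_1)-F(y,z_2),z_1-z_2\rangle\ge-\inf_{y'\in Y_0}C_{y'}(R,|||z_1-z_2|||)$ for all $R>0$, $y\in Y_0$ and $\|z_1\|,\|z_2\|\le R$. 3. For every $y\in W_0^{1,p}(\Omega)$, $F(y,\cdot)$ is radially continuous: for all $z_1,z_2\in L^p(\Omega)$ there is $\varepsilon>0$ such that $t\mapsto\langle F(y,z_1+tz_2),z_2\rangle$ is continuous on $[0,\varepsilon]$. 4. For every bounded $Y_0\subset W_0^{1,p}(\Omega)$ there is $\lambda>0$ such that $\langle F(y,z)-B_r^{-1}(g|_\Omega),z\rangle\ge0$ for all $y\in Y_0$ and all $z\in L^p(\Omega)$ with $\|z\|>\lambda$. 5. For every $z\in L^p(\Omega)$: if $y_k\to y_0$ weakly in $W_0^{1,p}(\Omega)$, then $F(y_k,z)\to F(y_0,z)$ strongly in $L^q(\Omega)$. **Conclusion.** If a sequence $(\mathcal U_k,y_k,z_k)\in\Xi_{sol}$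 $\tau$-converges to $(\mathcal U_0,y_0,z_0)\in L^\infty(D;\mathbb{R}^{N\times N})\times W_0^{1,p}(\Omega)\times L^p(\Omega)$, then $\mathcal U_0\in U_{ad}$, $y_0$ is the unique weak solution $y(\mathcal U_0)$ of the state equation for $\mathcal U_0$, $z_0\in\mathcal H(y_0)$, and therefore $(\mathcal U_0,y_0,z_0)\in\Xi_{sol}$. That is, $\Xi_{sol}$ is sequentially $\tau$-closed. Moreover, $\Xi_{sol}$ is sequentially $\tau$-compact: every sequence in $\Xi_{sol}$ has a subsequence that $\tau$-converges to an element of $\Xi_{sol}$. -/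

import Mathlib

open MeasureTheory Set Filter Topology TopologicalSpace
open scoped ENNReal Distributions

noncomputable section

namespace HammersteinControl

/-- The Euclidean space `ℝ^N`. -/
abbrev Eucl (N : ℕ) : Type := EuclideanSpace ℝ (Fin N)

/-- `L^r(Ω)` for an open set `Ω ⊆ ℝ^N`, with Lebesgue measure. -/
abbrev LSp {N : ℕ} (r : ℝ≥0∞) (Ω : Opens (Eucl N)) : Type :=
  Lp ℝ r (volume.restrict (Ω : Set (Eucl N)))

/-- The duality pairing `⟨ν, z⟩ = ∫_Ω ν z dx` between `L^q(Ω)` and `L^p(Ω)`. -/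
def pairing {N : ℕ} {p q : ℝ≥0∞} {Ω : Opens (Eucl N)} (ν : LSp q Ω) (z : LSp p Ω) : ℝ :=
  ∫ x in (Ω : Set (Eucl N)), ν x * z x

/-- The restriction map `L^p(D) → L^p(Ω)` for `Ω ⊆ D`. -/
def restrictL {N : ℕ} {p : ℝ≥0∞} {Ω D : Opens (Eucl N)} (h : Ω ≤ D) (g : LSp p D) : LSp p Ω :=
  ((Lp.memLp g).mono_measure (Measure.restrict_mono_set volume h)).toLp g

/-! ### The space `W₀^{1,p}(Ω)` -/

/-- Tuples `(y, ∂₁y, …, ∂_N y)` of functions in `L^p(ℝ^N)`: the entry `none` is the function and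
the entry `some i` its `i`-th partial derivative. The `ℓ^p` norm on tuples is
`(∫ |y|^p + ∑ᵢ ∫ |∂ᵢy|^p)^{1/p}`. -/
abbrev Jet (N : ℕ) (p : ℝ≥0∞) : Type :=
  PiLp p (fun _ : Option (Fin N) => Lp ℝ p (volume : Measure (Eucl N)))

/-- `C_c^∞(Ω)`, each test function `φ` being identified with `(φ, ∂₁φ, …, ∂_Nφ)`. -/
def testJets {N : ℕ} (p : ℝ≥0∞) [Fact (1 ≤ p)] (Ω : Opens (Eucl N)) :
    Submodule ℝ (Jet N p) where
  carrier := {w | ∃ φ : 𝓓(Ω, ℝ), (w none =ᵐ[volume] fun x => φ x) ∧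
    ∀ i : Fin N, w (some i) =ᵐ[volume] fun x => fderiv ℝ φ x (EuclideanSpace.single i 1)}
  zero_mem' := by
    refine ⟨0, ?_, fun i => ?_⟩
    · exact Lp.coeFn_zero ℝ p volume
    · filter_upwards [Lp.coeFn_zero ℝ p (volume : Measure (Eucl N))] with x hx
      have h0 : (⇑(0 : 𝓓(Ω, ℝ)) : Eucl N → ℝ) = 0 := rfl
      rw [h0]
      simp
  add_mem' := by
    rintro v w ⟨φ, hφ, hφ'⟩ ⟨ψ, hψ, hψ'⟩
    refine ⟨φ + ψ, ?_, fun i => ?_⟩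
    · filter_upwards [Lp.coeFn_add (v none) (w none), hφ, hψ] with x h1 h2 h3
      change (v none + w none : Lp ℝ p volume) x = φ x + ψ x
      rw [h1, Pi.add_apply, h2, h3]
    · filter_upwards [Lp.coeFn_add (v (some i)) (w (some i)), hφ' i, hψ' i] with x h1 h2 h3
      change (v (some i) + w (some i) : Lp ℝ p volume) x =
        fderiv ℝ ((φ : Eucl N → ℝ) + (ψ : Eucl N → ℝ)) x (EuclideanSpace.single i 1)
      rw [h1, Pi.add_apply, h2, h3, fderiv_add
        (φ.contDiff.contDiffAt.differentiableAt (by simp))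
        (ψ.contDiff.contDiffAt.differentiableAt (by simp))]
      rfl
  smul_mem' := by
    rintro c v ⟨φ, hφ, hφ'⟩
    refine ⟨c • φ, ?_, fun i => ?_⟩
    · filter_upwards [Lp.coeFn_smul c (v none), hφ] with x h1 h2
      change (c • v none : Lp ℝ p volume) x = c • φ x
      rw [h1, Pi.smul_apply, h2]
    · filter_upwards [Lp.coeFn_smul c (v (some i)), hφ' i] with x h1 h2
      change (c • v (some i) : Lp ℝ p volume) x =
        fderiv ℝ (c • (φ : Eucl N → ℝ)) x (EuclideanSpace.single i 1)
      rw [h1, Pi.smul_apply, h2, fderiv_const_smul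
        (φ.contDiff.contDiffAt.differentiableAt (by simp))]
      rfl

/-- `W₀^{1,p}(Ω)`: the closure of `C_c^∞(Ω)` in the Sobolev norm. Elements are carried as functions
on `ℝ^N` (zero outside `Ω`) together with their weak gradients, so that `Ω ⊆ D` gives the
inclusion `W₀^{1,p}(Ω) ⊆ W₀^{1,p}(D)` by extension by zero. -/
def sobolevZero {N : ℕ} (p : ℝ≥0∞) [Fact (1 ≤ p)] (Ω : Opens (Eucl N)) : Submodule ℝ (Jet N p) :=
  (testJets p Ω).topologicalClosure

/-- `W₀^{1,p}(Ω)` as a normed space. -/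
abbrev W0 {N : ℕ} (p : ℝ≥0∞) [Fact (1 ≤ p)] (Ω : Opens (Eucl N)) : Type := sobolevZero p Ω

theorem sobolevZero_mono {N : ℕ} (p : ℝ≥0∞) [Fact (1 ≤ p)] {Ω D : Opens (Eucl N)} (h : Ω ≤ D) :
    sobolevZero p Ω ≤ sobolevZero p D := by
  refine Submodule.topologicalClosure_mono ?_
  rintro w ⟨φ, h0, h1⟩
  exact ⟨⟨φ, φ.contDiff, φ.hasCompactSupport, φ.tsupport_subset.trans h⟩, h0, h1⟩

/-- Extension by zero `W₀^{1,p}(Ω) → W₀^{1,p}(D)`. -/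
def extendZero {N : ℕ} {p : ℝ≥0∞} [Fact (1 ≤ p)] {Ω D : Opens (Eucl N)} (h : Ω ≤ D) :
    W0 p Ω →ₗ[ℝ] W0 p D :=
  Submodule.inclusion (sobolevZero_mono p h)

/-- The function underlying an element of `W₀^{1,p}(Ω)`. -/
def W0.fn {N : ℕ} {p : ℝ≥0∞} [Fact (1 ≤ p)] {Ω : Opens (Eucl N)} (y : W0 p Ω) : Eucl N → ℝ :=
  (y : Jet N p) none

/-- The weak partial derivative `∂ᵢ y`. -/
def W0.grad {N : ℕ} {p : ℝ≥0∞} [Fact (1 ≤ p)] {Ω : Opens (Eucl N)} (y : W0 p Ω) (i : Fin N) :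
    Eucl N → ℝ :=
  (y : Jet N p) (some i)

/-- `W^{-1,q}(D)`, the dual space of `W₀^{1,p}(D)`, where `1/p + 1/q = 1`. -/
abbrev WNeg {N : ℕ} (p : ℝ≥0∞) [Fact (1 ≤ p)] (D : Opens (Eucl N)) : Type :=
  StrongDual ℝ (W0 p D)

/-! ### Controls -/

/-- `L^∞(D; ℝ^{N×N})`, a matrix being given by its entries. -/
abbrev Control {N : ℕ} (D : Opens (Eucl N)) : Type := Fin N → Fin N → LSp ∞ D

/-- `t ↦ |t|^{p-2} t`. -/
def powMap (p : ℝ≥0∞) (t : ℝ) : ℝ := |t| ^ (p.toReal - 2) * t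

/-- `(A [ζ^{p-2}]ζ, η) = ∑_{i,j} a_{ij} |ζ_j|^{p-2} ζ_j η_i`, for `A = (a_{ij})`. -/
def flux {N : ℕ} (p : ℝ≥0∞) (A : Fin N → Fin N → ℝ) (ζ η : Fin N → ℝ) : ℝ :=
  ∑ i, ∑ j, A i j * powMap p (ζ j) * η i

/-- The class `M_p^{α,β}(D)`. -/
structure IsMClass {N : ℕ} (p : ℝ≥0∞) (α β : ℝ) {D : Opens (Eucl N)} (U : Control D) : Prop where
  symm : ∀ i j, U i j = U j i
  growth : ∀ i j, ∀ᵐ x ∂(volume.restrict (D : Set (Eucl N))), |U i j x| ≤ β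
  monotone : ∀ᵐ x ∂(volume.restrict (D : Set (Eucl N))), ∀ ζ η : Fin N → ℝ,
    0 ≤ flux p (fun i j => U i j x) ζ (ζ - η) - flux p (fun i j => U i j x) η (ζ - η)
  coercive : ∀ᵐ x ∂(volume.restrict (D : Set (Eucl N))), ∀ ζ : Fin N → ℝ,
    α * ∑ k, |ζ k| ^ p.toReal ≤ flux p (fun i j => U i j x) ζ ζ

/-- `ℓ ∈ W^{-1,q}(D)` is the divergence of the bounded vector field `u`. -/
def IsDivergence {N : ℕ} {p : ℝ≥0∞} [Fact (1 ≤ p)] {D : Opens (Eucl N)} (u : Fin N → LSp ∞ D)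
    (ℓ : WNeg p D) : Prop :=
  ∀ φ : W0 p D, ℓ φ = -∫ x in (D : Set (Eucl N)), ∑ j, u j x * W0.grad φ j x

/-- The set `U_b`. -/
def boundedControls {N : ℕ} (p : ℝ≥0∞) (α β : ℝ) {D : Opens (Eucl N)} (ξ₁ ξ₂ : LSp ∞ D) :
    Set (Control D) :=
  {U | IsMClass p α β U ∧ ∀ i j, ∀ᵐ x ∂(volume.restrict (D : Set (Eucl N))),
    ξ₁ x ≤ U i j x ∧ U i j x ≤ ξ₂ x}

/-- The set `U_sol`: the `i`-th column `u_i` of the matrix has divergence in `Q_i`. -/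
def solenoidalControls {N : ℕ} (p : ℝ≥0∞) [Fact (1 ≤ p)] (α β : ℝ) {D : Opens (Eucl N)}
    (Q : Fin N → Set (WNeg p D)) : Set (Control D) :=
  {U | IsMClass p α β U ∧ ∀ i, ∃ ℓ ∈ Q i, IsDivergence (fun j => U j i) ℓ}

/-- The set `U_ad = U_b ∩ U_sol` of admissible controls of solenoidal type. -/
def admissibleControls {N : ℕ} (p : ℝ≥0∞) [Fact (1 ≤ p)] (α β : ℝ) {D : Opens (Eucl N)}
    (ξ₁ ξ₂ : LSp ∞ D) (Q : Fin N → Set (WNeg p D)) : Set (Control D) :=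
  boundedControls p α β ξ₁ ξ₂ ∩ solenoidalControls p α β Q

/-! ### The state equations -/

/-- `y ∈ W₀^{1,p}(Ω)` is a weak solution of
`-div (U [(∇y)^{p-2}] ∇y) + |y|^{p-2} y = f` in `Ω`. -/
def IsWeakSolution {N : ℕ} {p : ℝ≥0∞} [Fact (1 ≤ p)] {Ω D : Opens (Eucl N)} (h : Ω ≤ D)
    (f : WNeg p D) (U : Control D) (y : W0 p Ω) : Prop :=
  ∀ v : W0 p Ω,
    (∫ x in (Ω : Set (Eucl N)), flux p (fun i j => U i j x) (fun j => W0.grad y j x)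
        (fun i => W0.grad v i x)) +
      (∫ x in (Ω : Set (Eucl N)), powMap p (W0.fn y x) * W0.fn v x) =
    f (extendZero h v)

/-- The set `H(y)` of all `z ∈ L^p(Ω)` such that `z + B F(y, z) = g` in the sense of distributions
in `Ω`. -/
def hammersteinSet {N : ℕ} {p q : ℝ≥0∞} [Fact (1 ≤ p)] [Fact (1 ≤ q)] {Ω D : Opens (Eucl N)}
    (B : LSp q Ω →L[ℝ] LSp p Ω) (F : W0 p Ω → LSp p Ω → LSp q Ω) (g : LSp p D) (y : W0 p Ω) :
    Set (LSp p Ω) :=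
  {z | ∀ φ : 𝓓(Ω, ℝ), (∫ x in (Ω : Set (Eucl N)), z x * φ x) +
      (∫ x in (Ω : Set (Eucl N)), B (F y z) x * φ x) = ∫ x in (Ω : Set (Eucl N)), g x * φ x}

/-- The set `Ξ_sol` of admissible triplets. -/
def admissibleTriplets {N : ℕ} {p q : ℝ≥0∞} [Fact (1 ≤ p)] [Fact (1 ≤ q)] {Ω D : Opens (Eucl N)}
    (h : Ω ≤ D) (α β : ℝ) (ξ₁ ξ₂ : LSp ∞ D) (Q : Fin N → Set (WNeg p D))
    (B : LSp q Ω →L[ℝ] LSp p Ω) (F : W0 p Ω → LSp p Ω → LSp q Ω) (f : WNeg p D) (g : LSp p D) :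
    Set (Control D × W0 p Ω × LSp p Ω) :=
  {t | t.1 ∈ admissibleControls p α β ξ₁ ξ₂ Q ∧ IsWeakSolution h f t.1 t.2.1 ∧
    t.2.2 ∈ hammersteinSet B F g t.2.1}

/-! ### The topology `τ` -/

/-- The duality pairings `∫_D a_{ij} φ dx` of `U = (a_{ij}) ∈ L^∞(D; ℝ^{N×N})` with all
`φ ∈ L^1(D)`. The weak-* topology of `L^∞(D; ℝ^{N×N}) = L^1(D; ℝ^{N×N})*` is the topology of
pointwise convergence of these pairings. -/
def weakStarEval {N : ℕ} {D : Opens (Eucl N)} (U : Control D) : Fin N → Fin N → LSp 1 D → ℝ :=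
  fun i j φ => ∫ x in (D : Set (Eucl N)), U i j x * φ x

/-- The product `τ` of the weak-* topology of `L^∞(D; ℝ^{N×N})`, the weak topology of
`W₀^{1,p}(Ω)` and the weak topology of `L^p(Ω)`. -/
@[reducible] def tau {N : ℕ} (p : ℝ≥0∞) [Fact (1 ≤ p)] (Ω D : Opens (Eucl N)) :
    TopologicalSpace (Control D × W0 p Ω × LSp p Ω) :=
  TopologicalSpace.induced
    (fun t : Control D × W0 p Ω × LSp p Ω =>
      (weakStarEval t.1, toWeakSpace ℝ (W0 p Ω) t.2.1, toWeakSpace ℝ (LSp p Ω) t.2.2))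
    inferInstance

/-! ### Conditions on the Hammerstein operators -/

/-- Radial continuity of `G : L^p(Ω) → L^q(Ω) = L^p(Ω)*`. -/
def IsRadiallyContinuous {N : ℕ} {p q : ℝ≥0∞} [Fact (1 ≤ p)] {Ω : Opens (Eucl N)}
    (G : LSp p Ω → LSp q Ω) : Prop :=
  ∀ z₁ z₂ : LSp p Ω, ∃ ε > 0,
    ContinuousOn (fun t : ℝ => pairing (G (z₁ + t • z₂)) z₂) (Icc 0 ε)

/-- A seminorm is compact with respect to the norm if the unit ball of the norm is totally bounded
for the seminorm. -/
def IsCompactSeminorm {Z : Type*} [NormedAddCommGroup Z] [NormedSpace ℝ Z]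
    (S : Seminorm ℝ Z) : Prop :=
  ∀ ε > 0, ∃ T : Set Z, T.Finite ∧ ∀ z : Z, ‖z‖ ≤ 1 → ∃ c ∈ T, S (z - c) < ε

/-- Uniformly semi-bounded variation of `G : Y × L^p(Ω) → L^q(Ω)`. A lower bound by
`-inf_{y' ∈ Y₀} C_{y'}` is a lower bound by `-C_{y'}` for every `y' ∈ Y₀`. -/
def HasUSBV {N : ℕ} {p q : ℝ≥0∞} [Fact (1 ≤ p)] {Ω : Opens (Eucl N)} {Y : Type*}
    [NormedAddCommGroup Y] (G : Y → LSp p Ω → LSp q Ω) : Prop :=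
  ∀ Y₀ : Set Y, Bornology.IsBounded Y₀ →
    ∃ (S : Seminorm ℝ (LSp p Ω)) (C : Y → ℝ → ℝ → ℝ), IsCompactSeminorm S ∧
      (∀ y ∈ Y₀, ContinuousOn (fun s : ℝ × ℝ => C y s.1 s.2) (Ici 0 ×ˢ Ici 0) ∧
        ∀ r > 0, Tendsto (fun t => C y r t / t) (𝓝[>] 0) (𝓝 0)) ∧
      ∀ R > 0, ∀ y ∈ Y₀, ∀ z₁ z₂ : LSp p Ω, ‖z₁‖ ≤ R → ‖z₂‖ ≤ R →
        ∀ y' ∈ Y₀, -C y' R (S (z₁ - z₂)) ≤ pairing (G y z₁ - G y z₂) (z₁ - z₂)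

/-- Compactness of `F(·, z)`: weakly convergent sequences in `W₀^{1,p}(Ω)` are mapped to strongly
convergent sequences in `L^q(Ω)`. -/
def IsCompactInState {N : ℕ} {p q : ℝ≥0∞} [Fact (1 ≤ p)] [Fact (1 ≤ q)] {Ω : Opens (Eucl N)}
    (F : W0 p Ω → LSp p Ω → LSp q Ω) : Prop :=
  ∀ (z : LSp p Ω) (y : ℕ → W0 p Ω) (y₀ : W0 p Ω),
    Tendsto (fun k => toWeakSpace ℝ (W0 p Ω) (y k)) atTop (𝓝 (toWeakSpace ℝ (W0 p Ω) y₀)) →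
      Tendsto (fun k => F (y k) z) atTop (𝓝 (F y₀ z))

end HammersteinControl

end

open HammersteinControl

namespace HammersteinControl

section Scalar

variable {p : ℝ≥0∞}

theorem two_le_toReal (hp : 2 ≤ p) (hp' : p ≠ ∞) : 2 ≤ p.toReal := by
  have := (ENNReal.toReal_le_toReal (by simp) hp').2 hp
  simpa using this

theorem abs_powMap (hp : 2 ≤ p.toReal) (t : ℝ) : |powMap p t| = |t| ^ (p.toReal - 1) := by
  rw [powMap, abs_mul, abs_of_nonneg (Real.rpow_nonneg (abs_nonneg t) _)]
  rcases eq_or_ne t 0 with rfl | ht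
  · rw [abs_zero, mul_zero, Real.zero_rpow (by linarith)]
  · rw [← Real.rpow_add_one (abs_ne_zero.2 ht)]
    congr 1
    ring

theorem powMap_mul_self (hp : 2 ≤ p.toReal) (t : ℝ) : powMap p t * t = |t| ^ p.toReal := by
  rw [powMap, mul_assoc, ← abs_mul_abs_self t, ← mul_assoc]
  rcases eq_or_ne t 0 with rfl | ht
  · rw [abs_zero, mul_zero, Real.zero_rpow (by linarith)]
  · rw [← Real.rpow_add_one (abs_ne_zero.2 ht), ← Real.rpow_add_one (abs_ne_zero.2 ht)]
    congr 1
    ring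

theorem continuous_powMap (hp : 2 ≤ p.toReal) : Continuous (powMap p) := by
  unfold powMap
  exact (continuous_abs.rpow_const fun x => Or.inr (by linarith)).mul continuous_id

theorem powMap_of_nonneg (hp : 2 ≤ p.toReal) {t : ℝ} (ht : 0 ≤ t) :
    powMap p t = t ^ (p.toReal - 1) := by
  have h : 0 ≤ powMap p t := mul_nonneg (Real.rpow_nonneg (abs_nonneg t) _) ht
  rw [← abs_of_nonneg h, abs_powMap hp, abs_of_nonneg ht]

theorem powMap_neg (t : ℝ) : powMap p (-t) = -powMap p t := by
  simp [powMap]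

theorem powMap_strictMono (hp : 2 ≤ p.toReal) : StrictMono (powMap p) := by
  have key : StrictMonoOn (powMap p) (Ici 0) := by
    intro a ha b hb hab
    rw [powMap_of_nonneg hp ha, powMap_of_nonneg hp hb]
    exact Real.rpow_lt_rpow ha hab (by linarith)
  refine StrictMonoOn.Iic_union_Ici (a := 0) ?_ key
  intro a ha b hb hab
  have := key (show (0 : ℝ) ≤ -b from neg_nonneg.2 hb) (show (0 : ℝ) ≤ -a from neg_nonneg.2 ha)
    (neg_lt_neg hab)
  rw [powMap_neg, powMap_neg] at this
  linarith

theorem powMap_sub_mul_sub_pos (hp : 2 ≤ p.toReal) {a b : ℝ} (h : a ≠ b) :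
    0 < (powMap p a - powMap p b) * (a - b) := by
  rcases lt_or_gt_of_ne h with h | h
  · exact mul_pos_of_neg_of_neg (sub_neg.2 (powMap_strictMono hp h)) (sub_neg.2 h)
  · exact mul_pos (sub_pos.2 (powMap_strictMono hp h)) (sub_pos.2 h)

theorem powMap_sub_mul_sub_nonneg (hp : 2 ≤ p.toReal) (a b : ℝ) :
    0 ≤ (powMap p a - powMap p b) * (a - b) := by
  rcases eq_or_ne a b with rfl | h
  · simp
  · exact (powMap_sub_mul_sub_pos hp h).le

/-- The tangent line inequality for the convex function `t ↦ |t|^p`. -/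
theorem abs_rpow_sub_le (hp : 2 ≤ p.toReal) (a b : ℝ) :
    |b| ^ p.toReal - |a| ^ p.toReal ≤ p.toReal * (powMap p b * (b - a)) := by
  have h1 : powMap p b * a ≤ |a| * |powMap p b| := by
    rw [mul_comm, ← abs_mul]
    exact le_abs_self _
  have hc : p.toReal.HolderConjugate (p.toReal / (p.toReal - 1)) :=
    Real.HolderConjugate.conjExponent (by linarith)
  have h2 := Real.young_inequality_of_nonneg (abs_nonneg a) (abs_nonneg (powMap p b)) hc
  have h3 : |powMap p b| ^ (p.toReal / (p.toReal - 1)) = |b| ^ p.toReal := by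
    rw [abs_powMap hp, ← Real.rpow_mul (abs_nonneg b)]
    congr 1
    have : p.toReal - 1 ≠ 0 := by linarith
    field_simp
  rw [h3] at h2
  have h4 := powMap_mul_self hp b
  have h5 : p.toReal * (|a| ^ p.toReal / p.toReal + |b| ^ p.toReal / (p.toReal / (p.toReal - 1))) =
      |a| ^ p.toReal + (p.toReal - 1) * |b| ^ p.toReal := by
    have h0 : p.toReal ≠ 0 := by linarith
    have h1 : p.toReal - 1 ≠ 0 := by linarith
    field_simp
  have h6 := mul_le_mul_of_nonneg_left (h1.trans h2) (show 0 ≤ p.toReal by linarith)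
  rw [h5] at h6
  rw [mul_sub, h4]
  linarith

/-- Clarkson's inequality for real numbers, `r ≥ 2`. -/
theorem clarkson_real {r : ℝ} (hr : 2 ≤ r) (a b : ℝ) :
    |(a + b) / 2| ^ r + |(a - b) / 2| ^ r ≤ (|a| ^ r + |b| ^ r) / 2 := by
  have key : ∀ t : ℝ, |t| ^ r = (t ^ 2) ^ (r / 2) := by
    intro t
    rw [← sq_abs, ← Real.rpow_natCast, ← Real.rpow_mul (abs_nonneg t)]
    congr 1
    push_cast
    ring
  rw [key, key, key, key]
  have h1 : 1 ≤ r / 2 := by linarith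
  have hsup : ((((a + b) / 2) ^ 2) ^ (r / 2) + (((a - b) / 2) ^ 2) ^ (r / 2)) ≤
      (((a + b) / 2) ^ 2 + ((a - b) / 2) ^ 2) ^ (r / 2) := by
    have := NNReal.add_rpow_le_rpow_add ⟨((a + b) / 2) ^ 2, sq_nonneg _⟩
      ⟨((a - b) / 2) ^ 2, sq_nonneg _⟩ h1
    exact_mod_cast this
  have hconv := (convexOn_rpow h1).2 (mem_Ici.2 (sq_nonneg a)) (mem_Ici.2 (sq_nonneg b))
    (show (0 : ℝ) ≤ 1 / 2 by norm_num) (show (0 : ℝ) ≤ 1 / 2 by norm_num) (by norm_num)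
  have he : ((a + b) / 2) ^ 2 + ((a - b) / 2) ^ 2 = (1 / 2 : ℝ) • a ^ 2 + (1 / 2 : ℝ) • b ^ 2 := by
    simp only [smul_eq_mul]
    ring
  rw [he] at hsup
  refine (hsup.trans hconv).trans (le_of_eq ?_)
  simp only [smul_eq_mul]
  ring

end Scalar

section LpDuality

variable {α : Type*} [MeasurableSpace α] {μ : Measure α} {p q : ℝ≥0∞}

theorem memLp_powMap [hpq : p.HolderConjugate q] (hp : 2 ≤ p) (hp' : p ≠ ∞) {u : α → ℝ}
    (hu : MemLp u p μ) : MemLp (fun x => powMap p (u x)) q μ := by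
  have h2 := two_le_toReal hp hp'
  have h1 : 1 ≤ p := le_trans (by norm_num) hp
  have hq : q = p / (p - 1) := by
    have hne : p - 1 ≠ 0 := by
      have : 1 < p := lt_of_lt_of_le (by norm_num) hp
      exact (tsub_pos_of_lt this).ne'
    have hne' : p - 1 ≠ ∞ := ENNReal.sub_ne_top hp'
    rw [(ENNReal.isConjExponent_iff_eq_conjExponent h1).1 hpq]
    nth_rewrite 2 [← tsub_add_cancel_of_le h1]
    rw [ENNReal.add_div, ENNReal.div_self hne hne', one_div]
  have hsub : (p - 1).toReal = p.toReal - 1 := by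
    rw [ENNReal.toReal_sub_of_le h1 hp', ENNReal.toReal_one]
  have h := hu.norm_rpow_div (p - 1)
  rw [← hq, hsub] at h
  refine h.of_le ((continuous_powMap h2).comp_aestronglyMeasurable hu.1) (ae_of_all _ fun x => ?_)
  rw [Real.norm_eq_abs, Real.norm_eq_abs, abs_powMap h2, Real.norm_eq_abs]
  exact le_abs_self _

theorem integrable_mul_of_memLp [p.HolderConjugate q] {u v : α → ℝ} (hu : MemLp u q μ)
    (hv : MemLp v p μ) : Integrable (fun x => u x * v x) μ :=
  memLp_one_iff_integrable.1 (hv.mul' hu)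

theorem integrable_mul_mul_of_memLp [p.HolderConjugate q] {a u v : α → ℝ} (ha : MemLp a ∞ μ)
    (hu : MemLp u q μ) (hv : MemLp v p μ) : Integrable (fun x => a x * u x * v x) μ := by
  have : MemLp (fun x => a x * u x) q μ := hu.mul' ha
  exact integrable_mul_of_memLp this hv

/-- Hemicontinuity of the superposition operator `u ↦ |u|^{p-2} u`. -/
theorem tendsto_integral_powMap [p.HolderConjugate q] (hp : 2 ≤ p) (hp' : p ≠ ∞)
    {a u w h : α → ℝ} (ha : MemLp a ∞ μ) (hu : MemLp u p μ) (hw : MemLp w p μ)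
    (hh : MemLp h p μ) :
    Tendsto (fun t : ℝ => ∫ x, a x * powMap p (u x + t * w x) * h x ∂μ) (𝓝 0)
      (𝓝 (∫ x, a x * powMap p (u x) * h x ∂μ)) := by
  have h2 := two_le_toReal hp hp'
  have hb : MemLp (fun x => powMap p (|u x| + |w x|)) q μ := memLp_powMap hp hp' (hu.abs.add hw.abs)
  refine tendsto_integral_filter_of_dominated_convergence
    (fun x => |a x| * powMap p (|u x| + |w x|) * |h x|) ?_ ?_
    (integrable_mul_mul_of_memLp ha.abs hb hh.abs) ?_
  · refine Eventually.of_forall fun t => (ha.1.mul ?_).mul hh.1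
    exact (continuous_powMap h2).comp_aestronglyMeasurable (hu.1.add (hw.1.const_mul t))
  · have : ∀ᶠ t : ℝ in 𝓝 0, |t| < 1 := by
      have := (continuous_abs (G := ℝ)).tendsto 0
      rw [abs_zero] at this
      exact this.eventually_lt_const one_pos
    filter_upwards [this] with t ht
    refine ae_of_all _ fun x => ?_
    rw [norm_mul, norm_mul]
    simp only [Real.norm_eq_abs]
    gcongr
    have hpos : 0 ≤ |u x| + |w x| := by positivity
    rw [abs_powMap h2, powMap_of_nonneg h2 hpos]
    refine Real.rpow_le_rpow (abs_nonneg _) ?_ (by linarith)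
    calc |u x + t * w x| ≤ |u x| + |t| * |w x| := by
          rw [← abs_mul]
          exact abs_add_le _ _
      _ ≤ |u x| + 1 * |w x| := by gcongr
      _ = _ := by ring
  · refine ae_of_all _ fun x => ?_
    have hc : Continuous fun t : ℝ => a x * powMap p (u x + t * w x) * h x := by
      have := continuous_powMap h2
      fun_prop
    simpa using hc.tendsto 0

theorem Lp_norm_rpow_eq_integral [Fact (1 ≤ p)] (hp' : p ≠ ∞) (v : Lp ℝ p μ) :
    ‖v‖ ^ p.toReal = ∫ x, |v x| ^ p.toReal ∂μ := by
  have h0 : p ≠ 0 := (zero_lt_one.trans_le (Fact.out : (1 : ℝ≥0∞) ≤ p)).ne'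
  have hpos : 0 < p.toReal := ENNReal.toReal_pos h0 hp'
  have hint : 0 ≤ ∫ x, ‖v x‖ ^ p.toReal ∂μ :=
    integral_nonneg fun x => Real.rpow_nonneg (norm_nonneg _) _
  rw [Lp.norm_def, (Lp.memLp v).eLpNorm_eq_integral_rpow_norm h0 hp',
    ENNReal.toReal_ofReal (Real.rpow_nonneg hint _), ← Real.rpow_mul hint,
    inv_mul_cancel₀ hpos.ne', Real.rpow_one]
  rfl

theorem integrable_abs_rpow [Fact (1 ≤ p)] (hp' : p ≠ ∞) {v : α → ℝ} (hv : MemLp v p μ) :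
    Integrable (fun x => |v x| ^ p.toReal) μ :=
  hv.integrable_norm_rpow (zero_lt_one.trans_le (Fact.out : (1 : ℝ≥0∞) ≤ p)).ne' hp'

/-- Clarkson's inequality in `L^p`, `p ≥ 2`. -/
theorem clarkson_Lp [Fact (1 ≤ p)] (hp : 2 ≤ p) (hp' : p ≠ ∞) (u v : Lp ℝ p μ) :
    ‖(1 / 2 : ℝ) • (u + v)‖ ^ p.toReal + ‖(1 / 2 : ℝ) • (u - v)‖ ^ p.toReal ≤
      (‖u‖ ^ p.toReal + ‖v‖ ^ p.toReal) / 2 := by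
  simp only [Lp_norm_rpow_eq_integral hp']
  rw [← integral_add (integrable_abs_rpow hp' (Lp.memLp _)) (integrable_abs_rpow hp' (Lp.memLp _)),
    ← integral_add (integrable_abs_rpow hp' (Lp.memLp _)) (integrable_abs_rpow hp' (Lp.memLp _)),
    ← integral_div]
  refine integral_mono_ae
    ((integrable_abs_rpow hp' (Lp.memLp _)).add (integrable_abs_rpow hp' (Lp.memLp _)))
    (((integrable_abs_rpow hp' (Lp.memLp _)).add
      (integrable_abs_rpow hp' (Lp.memLp _))).div_const 2) ?_
  filter_upwards [Lp.coeFn_smul (1 / 2 : ℝ) (u + v), Lp.coeFn_smul (1 / 2 : ℝ) (u - v),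
    Lp.coeFn_add u v, Lp.coeFn_sub u v] with x h1 h2 h3 h4
  have h := clarkson_real (two_le_toReal hp hp') (u x) (v x)
  simp only [h1, h2, Pi.smul_apply, h3, h4, Pi.add_apply, Pi.sub_apply, smul_eq_mul]
  rwa [div_eq_inv_mul, div_eq_inv_mul (u x - v x), ← one_div] at h

theorem exists_isMinOn_norm_rpow_sub [Fact (1 ≤ p)] (hp : 2 ≤ p) (hp' : p ≠ ∞)
    (ℓ : StrongDual ℝ (Lp ℝ p μ)) :
    ∃ u : Lp ℝ p μ, ∀ v, ‖u‖ ^ p.toReal - p.toReal * ℓ u ≤ ‖v‖ ^ p.toReal - p.toReal * ℓ v := by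
  have h2 := two_le_toReal hp hp'
  set P := p.toReal with hP
  set I : Lp ℝ p μ → ℝ := fun v => ‖v‖ ^ P - P * ℓ v with hI
  have hc : P.HolderConjugate (P / (P - 1)) := Real.HolderConjugate.conjExponent (by linarith)
  have hbdd : BddBelow (range I) := by
    refine ⟨-(P * (‖ℓ‖ ^ (P / (P - 1)) / (P / (P - 1)))), ?_⟩
    rintro _ ⟨v, rfl⟩
    have h1 := Real.young_inequality_of_nonneg (norm_nonneg v) (norm_nonneg ℓ) hc
    have h3 : ℓ v ≤ ‖v‖ * ‖ℓ‖ := by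
      rw [mul_comm]
      exact (le_abs_self _).trans (ℓ.le_opNorm v)
    have h4 := mul_le_mul_of_nonneg_left (h3.trans h1) (show 0 ≤ P by linarith)
    have h5 : P * (‖v‖ ^ P / P) = ‖v‖ ^ P := by
      field_simp
    rw [mul_add, h5] at h4
    simp only [hI]
    linarith
  have hm : ∀ v, iInf I ≤ I v := fun v => ciInf_le hbdd v
  have hex : ∀ n : ℕ, ∃ v, I v < iInf I + 1 / ((n : ℝ) + 1) := fun n =>
    exists_lt_of_ciInf_lt (lt_add_of_pos_right _ (by positivity))
  choose v hv using hex
  have hb : Tendsto (fun n : ℕ => 2 * (1 / ((n : ℝ) + 1)) ^ (1 / P)) atTop (𝓝 0) := by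
    have h0 : Tendsto (fun n : ℕ => 1 / ((n : ℝ) + 1)) atTop (𝓝 0) :=
      tendsto_one_div_add_atTop_nhds_zero_nat
    have := (h0.rpow_const (p := 1 / P) (Or.inr (by positivity))).const_mul 2
    rwa [Real.zero_rpow (by positivity), mul_zero] at this
  have hcau : CauchySeq v := by
    refine cauchySeq_of_le_tendsto_0' _ (fun n k hnk => ?_) hb
    have hcl := clarkson_Lp hp hp' (v n) (v k)
    have hmid := hm ((1 / 2 : ℝ) • (v n + v k))
    have hn := hv n
    have hk := hv k
    have hnk' : 1 / ((k : ℝ) + 1) ≤ 1 / ((n : ℝ) + 1) := by gcongr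
    simp only [hI, map_smul, map_add, smul_eq_mul] at hmid hn hk hcl
    have hle : ‖(1 / 2 : ℝ) • (v n - v k)‖ ^ P ≤ 1 / ((n : ℝ) + 1) := by
      have : P * (1 / 2 * (ℓ (v n) + ℓ (v k))) = (P * ℓ (v n) + P * ℓ (v k)) / 2 := by ring
      rw [this] at hmid
      linarith
    have hle' : ‖(1 / 2 : ℝ) • (v n - v k)‖ ≤ (1 / ((n : ℝ) + 1)) ^ (1 / P) := by
      have := Real.rpow_le_rpow (Real.rpow_nonneg (norm_nonneg _) _) hle
        (show 0 ≤ 1 / P by positivity)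
      rwa [← Real.rpow_mul (norm_nonneg _), mul_one_div_cancel (by linarith), Real.rpow_one] at this
    rw [norm_smul, Real.norm_of_nonneg (by norm_num : (0 : ℝ) ≤ 1 / 2)] at hle'
    rw [dist_eq_norm]
    linarith
  obtain ⟨u, hu⟩ := cauchySeq_tendsto_of_complete hcau
  refine ⟨u, fun w => le_trans ?_ (hm w)⟩
  have hcont : Continuous I :=
    (continuous_norm.rpow_const fun x => Or.inr (by linarith)).sub
      (continuous_const.mul ℓ.continuous)
  have hlim : Tendsto (fun n : ℕ => iInf I + 1 / ((n : ℝ) + 1)) atTop (𝓝 (iInf I)) := by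
    simpa using tendsto_one_div_add_atTop_nhds_zero_nat.const_add (iInf I)
  exact le_of_tendsto_of_tendsto' ((hcont.tendsto u).comp hu) hlim fun n => (hv n).le

/-- Every continuous functional on `L^p`, `2 ≤ p < ∞`, is of the form `v ↦ ∫ |u|^{p-2} u v`. -/
theorem exists_dual_eq_integral_powMap [Fact (1 ≤ p)] [hpq : p.HolderConjugate q] (hp : 2 ≤ p)
    (hp' : p ≠ ∞) (ℓ : StrongDual ℝ (Lp ℝ p μ)) :
    ∃ u : Lp ℝ p μ, ∀ v : Lp ℝ p μ, ℓ v = ∫ x, powMap p (u x) * v x ∂μ := by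
  have h2 := two_le_toReal hp hp'
  obtain ⟨u, hu⟩ := exists_isMinOn_norm_rpow_sub hp hp' ℓ
  have hle : ∀ v : Lp ℝ p μ, ℓ v ≤ ∫ x, powMap p (u x) * v x ∂μ := by
    intro v
    have hstep : ∀ t : ℝ, 0 < t → ℓ v ≤ ∫ x, 1 * powMap p (u x + t * v x) * v x ∂μ := by
      intro t ht
      have h1 := hu (u + t • v)
      rw [map_add, map_smul, smul_eq_mul] at h1
      have h3 : ‖u + t • v‖ ^ p.toReal - ‖u‖ ^ p.toReal ≤
          p.toReal * t * ∫ x, 1 * powMap p (u x + t * v x) * v x ∂μ := by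
        rw [Lp_norm_rpow_eq_integral hp', Lp_norm_rpow_eq_integral hp',
          ← integral_sub (integrable_abs_rpow hp' (Lp.memLp _))
            (integrable_abs_rpow hp' (Lp.memLp _)), ← integral_const_mul]
        have hmem : MemLp (fun x => u x + t * v x) p μ :=
          (Lp.memLp u).add ((Lp.memLp v).const_mul t)
        refine integral_mono_ae ((integrable_abs_rpow hp' (Lp.memLp _)).sub
            (integrable_abs_rpow hp' (Lp.memLp _)))
          (Integrable.const_mul (integrable_mul_mul_of_memLp (q := q) (memLp_top_const 1)
            (memLp_powMap hp hp' hmem) (Lp.memLp v)) _) ?_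
        filter_upwards [Lp.coeFn_add u (t • v), Lp.coeFn_smul t v] with x hx hx'
        have := abs_rpow_sub_le h2 (u x) (u x + t * v x)
        simp only [hx, Pi.add_apply, hx', Pi.smul_apply, smul_eq_mul]
        refine this.trans (le_of_eq ?_)
        ring
      have h4 : p.toReal * t * ℓ v ≤
          p.toReal * t * ∫ x, 1 * powMap p (u x + t * v x) * v x ∂μ := by
        linarith
      exact le_of_mul_le_mul_left h4 (by positivity)
    have hlim := (tendsto_integral_powMap (q := q) hp hp' (memLp_top_const (1 : ℝ)) (Lp.memLp u)
      (Lp.memLp v) (Lp.memLp v)).mono_left (nhdsWithin_le_nhds (s := Ioi 0))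
    simp only [one_mul] at hlim hstep
    exact ge_of_tendsto hlim (eventually_mem_nhdsWithin.mono fun t ht => hstep t ht)
  refine ⟨u, fun v => le_antisymm (hle v) ?_⟩
  have h := hle (-v)
  have he : ∫ x, powMap p (u x) * (-v : Lp ℝ p μ) x ∂μ = -∫ x, powMap p (u x) * v x ∂μ := by
    rw [← integral_neg]
    refine integral_congr_ae ?_
    filter_upwards [Lp.coeFn_neg v] with x hx
    rw [hx, Pi.neg_apply, mul_neg]
  rw [he, map_neg] at h
  linarith

end LpDuality

section WeakConvergence

theorem tendsto_toWeakSpace_iff {E : Type*} [NormedAddCommGroup E] [NormedSpace ℝ E] {x : ℕ → E}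
    {x₀ : E} : Tendsto (fun k => toWeakSpace ℝ E (x k)) atTop (𝓝 (toWeakSpace ℝ E x₀)) ↔
      ∀ ℓ : StrongDual ℝ E, Tendsto (fun k => ℓ (x k)) atTop (𝓝 (ℓ x₀)) := by
  refine WeakBilin.tendsto_iff_forall_eval_tendsto _ (fun a b hab => ?_)
  by_contra hne
  obtain ⟨f, hf⟩ := SeparatingDual.exists_separating_of_ne (R := ℝ) (V := E) hne
  exact hf (LinearMap.congr_fun hab f)

/-- Bounded sequences of functionals on a separable space have pointwise convergent
subsequences. -/
theorem exists_subseq_tendsto_apply {E : Type*} [NormedAddCommGroup E] [NormedSpace ℝ E]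
    [SeparableSpace E] {ℓ : ℕ → StrongDual ℝ E} {M : ℝ} (h : ∀ k, ‖ℓ k‖ ≤ M) :
    ∃ (φ : ℕ → ℕ) (ℓ₀ : StrongDual ℝ E), StrictMono φ ∧
      ∀ v, Tendsto (fun k => ℓ (φ k) v) atTop (𝓝 (ℓ₀ v)) := by
  obtain ⟨a, -, φ, hφ, ha⟩ := WeakDual.isSeqCompact_closedBall ℝ E 0 M
    (x := fun k => StrongDual.toWeakDual (ℓ k)) (fun k => by simpa using h k)
  refine ⟨φ, WeakDual.toStrongDual a, hφ, fun v => ?_⟩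
  exact ((WeakDual.eval_continuous v).tendsto a).comp ha

/-- Finitely many subsequence extractions can be made simultaneously. -/
theorem exists_common_subseq {ι : Type*} [Finite ι] {P : ι → (ℕ → ℕ) → Prop}
    (hmono : ∀ i (φ ψ : ℕ → ℕ), StrictMono ψ → P i φ → P i (φ ∘ ψ))
    (hex : ∀ i φ, StrictMono φ → ∃ ψ : ℕ → ℕ, StrictMono ψ ∧ P i (φ ∘ ψ)) :
    ∃ φ : ℕ → ℕ, StrictMono φ ∧ ∀ i, P i φ := by
  classical
  have := Fintype.ofFinite ι
  have key : ∀ s : Finset ι, ∃ φ : ℕ → ℕ, StrictMono φ ∧ ∀ i ∈ s, P i φ := by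
    intro s
    induction s using Finset.induction_on with
    | empty => exact ⟨id, strictMono_id, by simp⟩
    | insert i s _ ih =>
      obtain ⟨φ, hφ, hP⟩ := ih
      obtain ⟨ψ, hψ, hi⟩ := hex i φ hφ
      refine ⟨φ ∘ ψ, hφ.comp hψ, fun j hj => ?_⟩
      rcases Finset.mem_insert.1 hj with rfl | hj
      · exact hi
      · exact hmono j φ ψ hψ (hP j hj)
  obtain ⟨φ, hφ, h⟩ := key Finset.univ
  exact ⟨φ, hφ, fun i => h i (Finset.mem_univ i)⟩

end WeakConvergence

section LpRepresentation

variable {α : Type*} [MeasurableSpace α] {μ : Measure α} {p q : ℝ≥0∞}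

variable (μ p q) in
/-- The pairing `(f, g) ↦ ∫ f g` of `L^p` with `L^q`. -/
noncomputable def lpDual [Fact (1 ≤ p)] [Fact (1 ≤ q)] [p.HolderConjugate q] :
    Lp ℝ p μ →L[ℝ] Lp ℝ q μ →L[ℝ] ℝ :=
  (ContinuousLinearMap.mul ℝ ℝ).lpPairing μ p q

theorem lpDual_apply [Fact (1 ≤ p)] [Fact (1 ≤ q)] [p.HolderConjugate q] (f : Lp ℝ p μ)
    (g : Lp ℝ q μ) : lpDual μ p q f g = ∫ x, f x * g x ∂μ := by
  simp [lpDual, ContinuousLinearMap.lpPairing_eq_integral]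

theorem norm_lpDual_le [Fact (1 ≤ p)] [Fact (1 ≤ q)] [p.HolderConjugate q] (f : Lp ℝ p μ) :
    ‖lpDual μ p q f‖ ≤ ‖f‖ := by
  refine ContinuousLinearMap.opNorm_le_bound _ (norm_nonneg f) fun g => ?_
  have h1 : lpDual μ p q f g = L1.integral ((ContinuousLinearMap.mul ℝ ℝ).holder 1 f g) := by
    rw [lpDual_apply, L1.integral_eq_integral]
    refine integral_congr_ae ?_
    filter_upwards [(ContinuousLinearMap.mul ℝ ℝ).coeFn_holder (r := 1) f g] with x hx
    rw [hx]
    rfl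
  rw [h1]
  refine (L1.norm_integral_le _).trans
    (((ContinuousLinearMap.mul ℝ ℝ).norm_holder_apply_apply_le f g).trans ?_)
  have := ContinuousLinearMap.opNorm_mul_le ℝ ℝ
  have h0 : 0 ≤ ‖f‖ * ‖g‖ := by positivity
  rw [mul_assoc]
  nlinarith

theorem abs_integral_mul_le [Fact (1 ≤ p)] [Fact (1 ≤ q)] [p.HolderConjugate q] (f : Lp ℝ p μ)
    (g : Lp ℝ q μ) : |∫ x, f x * g x ∂μ| ≤ ‖f‖ * ‖g‖ := by
  rw [← lpDual_apply]
  exact ((lpDual μ p q f).le_opNorm g).trans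
    (mul_le_mul_of_nonneg_right (norm_lpDual_le f) (norm_nonneg g))

theorem conjExponent_le_two [hpq : p.HolderConjugate q] (hp : 2 ≤ p) : q ≤ 2 := by
  have h := ENNReal.HolderConjugate.inv_add_inv_eq_one p q
  have hp2 : p⁻¹ ≤ 2⁻¹ := ENNReal.inv_le_inv.2 hp
  have h2 : (2 : ℝ≥0∞)⁻¹ ≤ q⁻¹ := by
    by_contra hlt
    rw [not_le] at hlt
    have : p⁻¹ + q⁻¹ < 2⁻¹ + 2⁻¹ := ENNReal.add_lt_add_of_le_of_lt (by
      exact ne_top_of_le_ne_top (by simp) hp2) hp2 hlt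
    rw [h, ENNReal.inv_two_add_inv_two] at this
    exact lt_irrefl _ this
  exact ENNReal.inv_le_inv.1 h2

/-- On a finite measure space a functional on `L^q`, `q ≤ 2`, is represented on `L^2` by an
`L^2` function. -/
theorem exists_memLp_two_representation [IsFiniteMeasure μ] [Fact (1 ≤ q)] (hq : q ≤ 2)
    (Λ : StrongDual ℝ (Lp ℝ q μ)) :
    ∃ z : α → ℝ, MemLp z 2 μ ∧ ∀ (v : α → ℝ) (_ : MemLp v 2 μ) (hv : MemLp v q μ),
      Λ (hv.toLp v) = ∫ x, z x * v x ∂μ := by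
  let ι₀ : Lp ℝ 2 μ →ₗ[ℝ] Lp ℝ q μ :=
    { toFun := fun v => ((Lp.memLp v).mono_exponent hq).toLp v
      map_add' := fun u v => by
        rw [← MemLp.toLp_add]
        exact MemLp.toLp_congr _ _ (Lp.coeFn_add u v)
      map_smul' := fun c v => by
        rw [RingHom.id_apply, ← MemLp.toLp_const_smul]
        exact MemLp.toLp_congr _ _ (Lp.coeFn_smul c v) }
  let ι : Lp ℝ 2 μ →L[ℝ] Lp ℝ q μ := ι₀.mkContinuous
    (μ univ ^ (1 / q.toReal - 1 / (2 : ℝ≥0∞).toReal)).toReal (fun v => by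
      have h := eLpNorm_le_eLpNorm_mul_rpow_measure_univ hq (Lp.memLp v).1
      have hfin : μ univ ^ (1 / q.toReal - 1 / (2 : ℝ≥0∞).toReal) ≠ ∞ := by
        refine ENNReal.rpow_ne_top_of_nonneg ?_ (measure_ne_top μ univ)
        have hq1 : (1 : ℝ≥0∞) ≤ q := Fact.out
        have hqt : q ≠ ∞ := ne_top_of_le_ne_top (by simp) hq
        have hq0 : 0 < q.toReal := ENNReal.toReal_pos (zero_lt_one.trans_le hq1).ne' hqt
        rw [sub_nonneg]
        exact one_div_le_one_div_of_le hq0 (ENNReal.toReal_mono (by simp) hq)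
      change ‖((Lp.memLp v).mono_exponent hq).toLp v‖ ≤ _
      rw [Lp.norm_toLp, Lp.norm_def, mul_comm, ← ENNReal.toReal_mul]
      exact ENNReal.toReal_mono (ENNReal.mul_ne_top (Lp.eLpNorm_ne_top v) hfin) h)
  let z : Lp ℝ 2 μ := (InnerProductSpace.toDual ℝ (Lp ℝ 2 μ)).symm (Λ.comp ι)
  refine ⟨z, Lp.memLp z, fun v hv2 hv => ?_⟩
  have h1 : inner ℝ z (hv2.toLp v) = Λ (ι (hv2.toLp v)) := by
    rw [InnerProductSpace.toDual_symm_apply]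
    rfl
  have h2 : ι (hv2.toLp v) = hv.toLp v := 
    MemLp.toLp_congr ((Lp.memLp (hv2.toLp v)).mono_exponent hq) hv hv2.coeFn_toLp
  rw [← h2, ← h1, L2.inner_def]
  refine integral_congr_ae ?_
  filter_upwards [hv2.coeFn_toLp] with x hx
  rw [hx]
  simp [mul_comm]

theorem eq_lpDual_of_representation [IsFiniteMeasure μ] [Fact (1 ≤ p)] [Fact (1 ≤ q)]
    [p.HolderConjugate q] (hq : q ≠ ∞) {Λ : StrongDual ℝ (Lp ℝ q μ)} {z : α → ℝ}
    (hz : MemLp z p μ) (h : ∀ (v : α → ℝ) (_ : MemLp v 2 μ) (hv : MemLp v q μ),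
      Λ (hv.toLp v) = ∫ x, z x * v x ∂μ) : Λ = lpDual μ p q (hz.toLp z) := by
  ext v
  induction v using Lp.induction hq with
  | indicatorConst c hs hμs =>
    rw [Lp.simpleFunc.coe_indicatorConst, lpDual_apply, indicatorConstLp,
      h _ (memLp_indicator_const 2 hs c (Or.inr hμs.ne))]
    refine integral_congr_ae ?_
    filter_upwards [hz.coeFn_toLp, (memLp_indicator_const q hs c (Or.inr hμs.ne)).coeFn_toLp]
      with x h1 h2
    rw [h1, h2]
  | add hf hg _ h1 h2 => rw [map_add, map_add, h1, h2]
  | isClosed => exact isClosed_eq Λ.continuous (lpDual μ p q (hz.toLp z)).continuous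

/-- On a finite measure space, the dual of `L^q`, `1 < q ≤ 2`, is `L^p`. -/
theorem exists_dual_eq_lpDual [IsFiniteMeasure μ] [Fact (1 ≤ p)] [Fact (1 ≤ q)]
    [hpq : p.HolderConjugate q] (hp : 2 ≤ p) (hp' : p ≠ ∞) (Λ : StrongDual ℝ (Lp ℝ q μ)) :
    ∃ z : Lp ℝ p μ, Λ = lpDual μ p q z := by
  have h2 := two_le_toReal hp hp'
  have hq2 : q ≤ 2 := conjExponent_le_two hp
  have hq' : q ≠ ∞ := ne_top_of_le_ne_top (by simp) hq2
  obtain ⟨z, hz2, hz⟩ := exists_memLp_two_representation hq2 Λ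
  have hr : p.toReal.HolderConjugate q.toReal :=
    ENNReal.HolderConjugate.toReal (p := p) (q := q) (by linarith)
  suffices hzp : MemLp z p μ from ⟨hzp.toLp z, eq_lpDual_of_representation hq' hzp hz⟩
  obtain ⟨z', hz'm, hzz'⟩ := hz2.1
  let w : ℕ → α → ℝ := fun n => {x | |z' x| ≤ n}.indicator z'
  have hwm : ∀ n, StronglyMeasurable (w n) := fun n =>
    hz'm.indicator (measurableSet_le hz'm.measurable.abs measurable_const)
  have hwb : ∀ n x, |w n x| ≤ n := by
    intro n x
    by_cases hx : |z' x| ≤ n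
    · simp [w, hx]
    · simp [w, hx]
  have hw : ∀ n r, MemLp (w n) r μ := fun n r =>
    MemLp.of_bound (hwm n).aestronglyMeasurable n (ae_of_all _ (hwb n))
  have hwlim : ∀ x, Tendsto (fun n => w n x) atTop (𝓝 (z' x)) := by
    intro x
    refine tendsto_const_nhds.congr' ?_
    obtain ⟨m, hm⟩ := exists_nat_ge |z' x|
    filter_upwards [eventually_ge_atTop m] with n hn
    have : |z' x| ≤ n := hm.trans (by exact_mod_cast hn)
    simp [w, this]
  have hbound : ∀ n, eLpNorm (w n) p μ ≤ ENNReal.ofReal ‖Λ‖ := by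
    intro n
    have hT : MemLp (fun x => powMap p (w n x)) q μ := memLp_powMap hp hp' (hw n p)
    have hT2 : MemLp (fun x => powMap p (w n x)) 2 μ := by
      refine MemLp.of_bound ((continuous_powMap h2).comp_stronglyMeasurable
        (hwm n)).aestronglyMeasurable ((n : ℝ) ^ (p.toReal - 1)) (ae_of_all _ fun x => ?_)
      rw [Real.norm_eq_abs, abs_powMap h2]
      exact Real.rpow_le_rpow (abs_nonneg _) (hwb n x) (by linarith)
    have h3 : Λ (hT.toLp _) = ∫ x, |w n x| ^ p.toReal ∂μ := by
      rw [hz _ hT2 hT]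
      refine integral_congr_ae ?_
      filter_upwards [hzz'] with x hx
      rw [← powMap_mul_self h2, hx, mul_comm]
      by_cases hx : |z' x| ≤ n
      · simp [w, hx]
      · simp [w, hx, powMap]
    have h4 : ‖hT.toLp _‖ ^ q.toReal = ∫ x, |w n x| ^ p.toReal ∂μ := by
      rw [Lp_norm_rpow_eq_integral hq']
      refine integral_congr_ae ?_
      filter_upwards [hT.coeFn_toLp] with x hx
      rw [hx, abs_powMap h2, ← Real.rpow_mul (abs_nonneg _)]
      congr 1
      have := hr.sub_one_mul_conj
      linarith
    have h5 : ‖(hw n p).toLp _‖ ^ p.toReal = ∫ x, |w n x| ^ p.toReal ∂μ := by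
      rw [Lp_norm_rpow_eq_integral hp']
      refine integral_congr_ae ?_
      filter_upwards [(hw n p).coeFn_toLp] with x hx
      rw [hx]
    have h6 := Real.young_inequality_of_nonneg (norm_nonneg Λ) (norm_nonneg (hT.toLp _)) hr
    have h7 := (le_abs_self _).trans (Λ.le_opNorm (hT.toLp _))
    rw [h3] at h7
    rw [h4] at h6
    have h8 : ‖(hw n p).toLp _‖ ^ p.toReal ≤ ‖Λ‖ ^ p.toReal := by
      rw [h5]
      have h9 := h7.trans h6
      have h10 := hr.inv_add_inv_eq_one
      rw [div_eq_mul_inv, div_eq_mul_inv] at h9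
      have h11 : q.toReal⁻¹ = 1 - p.toReal⁻¹ := by linarith
      rw [h11] at h9
      have h12 : (∫ x, |w n x| ^ p.toReal ∂μ) * p.toReal⁻¹ ≤ ‖Λ‖ ^ p.toReal * p.toReal⁻¹ := by
        linarith
      exact le_of_mul_le_mul_right h12 (inv_pos.2 (by linarith))
    have h13 : ‖(hw n p).toLp _‖ ≤ ‖Λ‖ :=
      (Real.rpow_le_rpow_iff (norm_nonneg _) (norm_nonneg _) (by linarith)).1 h8
    rw [Lp.norm_toLp] at h13
    exact (ENNReal.le_ofReal_iff_toReal_le (hw n p).2.ne (norm_nonneg _)).2 h13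
  refine ⟨hz2.1, lt_of_le_of_lt ?_ (ENNReal.ofReal_lt_top (r := ‖Λ‖))⟩
  rw [eLpNorm_congr_ae hzz']
  refine (Lp.eLpNorm_lim_le_liminf_eLpNorm (fun n => (hwm n).aestronglyMeasurable) z'
    (ae_of_all _ hwlim)).trans ?_
  exact (liminf_le_liminf (Eventually.of_forall hbound)).trans (by simp)

/-- On a finite measure space, the dual of `L^1` is `L^∞`. -/
theorem exists_dual_eq_lpDual_one [IsFiniteMeasure μ] (Λ : StrongDual ℝ (Lp ℝ 1 μ)) :
    ∃ z : Lp ℝ ∞ μ, Λ = lpDual μ ∞ 1 z := by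
  obtain ⟨z, hz2, hz⟩ := exists_memLp_two_representation (by norm_num) Λ
  suffices hzp : MemLp z ∞ μ from
    ⟨hzp.toLp z, eq_lpDual_of_representation ENNReal.one_ne_top hzp hz⟩
  have hzi : Integrable z μ := hz2.integrable (by norm_num)
  have key : ∀ s, MeasurableSet s → |∫ x in s, z x ∂μ| ≤ ∫ x in s, ‖Λ‖ ∂μ := by
    intro s hs
    have h1 := Λ.le_opNorm (indicatorConstLp 1 hs (measure_ne_top μ s) (1 : ℝ))
    rw [norm_indicatorConstLp (by simp) (by simp), indicatorConstLp,
      hz _ (memLp_indicator_const 2 hs 1 (Or.inr (measure_ne_top μ s)))] at h1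
    have h2 : ∫ x, z x * s.indicator (fun _ => (1 : ℝ)) x ∂μ = ∫ x in s, z x ∂μ := by
      rw [← integral_indicator hs]
      congr 1
      ext x
      by_cases hx : x ∈ s <;> simp [hx]
    rw [h2] at h1
    rw [setIntegral_const, smul_eq_mul, mul_comm]
    simpa using h1
  refine memLp_top_of_bound hz2.1 ‖Λ‖ ?_
  have h1 : z ≤ᵐ[μ] fun _ => ‖Λ‖ := ae_le_of_forall_setIntegral_le hzi (integrable_const _)
    fun s hs _ => (le_abs_self _).trans (key s hs)
  have h2 : (fun x => -z x) ≤ᵐ[μ] fun _ => ‖Λ‖ :=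
    ae_le_of_forall_setIntegral_le hzi.neg (integrable_const _) fun s hs _ => by
      rw [integral_neg]
      exact (neg_le_abs _).trans (key s hs)
  filter_upwards [h1, h2] with x hx hx'
  exact abs_le.2 ⟨by linarith, hx⟩

theorem exists_dual_eq_lpDual_left [Fact (1 ≤ p)] [Fact (1 ≤ q)] [hpq : p.HolderConjugate q]
    (hp : 2 ≤ p) (hp' : p ≠ ∞) (ℓ : StrongDual ℝ (Lp ℝ p μ)) :
    ∃ ν : Lp ℝ q μ, ℓ = lpDual μ q p ν := by
  obtain ⟨u, hu⟩ := exists_dual_eq_integral_powMap (q := q) hp hp' ℓ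
  have hm : MemLp (fun x => powMap p (u x)) q μ := memLp_powMap hp hp' (Lp.memLp u)
  refine ⟨hm.toLp _, ?_⟩
  ext v
  rw [hu v, lpDual_apply]
  refine integral_congr_ae ?_
  filter_upwards [hm.coeFn_toLp] with x hx
  rw [hx]

/-- Bounded sequences in `L^p`, `2 ≤ p < ∞`, over a finite measure space have weakly convergent
subsequences. -/
theorem exists_subseq_tendsto_weak_Lp [IsFiniteMeasure μ] [IsSeparable μ] [Fact (1 ≤ p)]
    [Fact (1 ≤ q)] [hpq : p.HolderConjugate q] (hp : 2 ≤ p) (hp' : p ≠ ∞) {z : ℕ → Lp ℝ p μ}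
    {M : ℝ} (h : ∀ k, ‖z k‖ ≤ M) :
    ∃ (φ : ℕ → ℕ) (z₀ : Lp ℝ p μ), StrictMono φ ∧
      ∀ ℓ : StrongDual ℝ (Lp ℝ p μ), Tendsto (fun k => ℓ (z (φ k))) atTop (𝓝 (ℓ z₀)) := by
  have : Fact (q ≠ ∞) := ⟨ne_top_of_le_ne_top (by simp) (conjExponent_le_two (p := p) hp)⟩
  obtain ⟨φ, Λ, hφ, hΛ⟩ := exists_subseq_tendsto_apply
    (ℓ := fun k => lpDual μ p q (z k)) (fun k => (norm_lpDual_le _).trans (h k))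
  obtain ⟨z₀, rfl⟩ := exists_dual_eq_lpDual hp hp' Λ
  refine ⟨φ, z₀, hφ, fun ℓ => ?_⟩
  obtain ⟨ν, rfl⟩ := exists_dual_eq_lpDual_left (q := q) hp hp' ℓ
  have := hΛ ν
  simp only [lpDual_apply] at this ⊢
  simpa only [mul_comm] using this

/-- Bounded sequences in `L^q`, `1 < q ≤ 2`, over a finite measure space have weakly convergent
subsequences. -/
theorem exists_subseq_tendsto_weak_Lq [IsFiniteMeasure μ] [IsSeparable μ] [Fact (1 ≤ p)]
    [Fact (1 ≤ q)] [hpq : p.HolderConjugate q] (hp : 2 ≤ p) (hp' : p ≠ ∞) {ν : ℕ → Lp ℝ q μ}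
    {M : ℝ} (h : ∀ k, ‖lpDual μ q p (ν k)‖ ≤ M) :
    ∃ (φ : ℕ → ℕ) (ν₀ : Lp ℝ q μ), StrictMono φ ∧
      ∀ ℓ : StrongDual ℝ (Lp ℝ q μ), Tendsto (fun k => ℓ (ν (φ k))) atTop (𝓝 (ℓ ν₀)) := by
  have : Fact (p ≠ ∞) := ⟨hp'⟩
  obtain ⟨φ, Λ, hφ, hΛ⟩ := exists_subseq_tendsto_apply (ℓ := fun k => lpDual μ q p (ν k)) h
  obtain ⟨ν₀, rfl⟩ := exists_dual_eq_lpDual_left (q := q) hp hp' Λ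
  refine ⟨φ, ν₀, hφ, fun ℓ => ?_⟩
  obtain ⟨z, rfl⟩ := exists_dual_eq_lpDual hp hp' ℓ
  have := hΛ z
  simp only [lpDual_apply] at this ⊢
  simpa only [mul_comm] using this

/-- Bounded sequences in `L^∞` over a finite measure space have weak-* convergent
subsequences. -/
theorem exists_subseq_tendsto_weakStar [IsFiniteMeasure μ] [IsSeparable μ] {a : ℕ → Lp ℝ ∞ μ}
    {M : ℝ} (h : ∀ k, ‖a k‖ ≤ M) :
    ∃ (φ : ℕ → ℕ) (a₀ : Lp ℝ ∞ μ), StrictMono φ ∧ ∀ v : Lp ℝ 1 μ,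
      Tendsto (fun k => ∫ x, a (φ k) x * v x ∂μ) atTop (𝓝 (∫ x, a₀ x * v x ∂μ)) := by
  have : Fact ((1 : ℝ≥0∞) ≠ ∞) := ⟨ENNReal.one_ne_top⟩
  obtain ⟨φ, Λ, hφ, hΛ⟩ := exists_subseq_tendsto_apply
    (ℓ := fun k => lpDual μ ∞ 1 (a k)) (fun k => (norm_lpDual_le _).trans (h k))
  obtain ⟨a₀, rfl⟩ := exists_dual_eq_lpDual_one Λ
  refine ⟨φ, a₀, hφ, fun v => ?_⟩
  simpa only [lpDual_apply] using hΛ v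

end LpRepresentation

section LpOperators

variable {α : Type*} [MeasurableSpace α] {μ : Measure α} {p : ℝ≥0∞} [Fact (1 ≤ p)]

/-- Multiplication by an essentially bounded function on `L^p`. -/
noncomputable def lpMul (a : Lp ℝ ∞ μ) : Lp ℝ p μ →L[ℝ] Lp ℝ p μ :=
  (ContinuousLinearMap.mul ℝ ℝ).holderL μ ∞ p p a

theorem coeFn_lpMul (a : Lp ℝ ∞ μ) (f : Lp ℝ p μ) :
    lpMul a f =ᵐ[μ] fun x => a x * f x :=
  (ContinuousLinearMap.mul ℝ ℝ).coeFn_holder a f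

theorem coeFn_lpMul_toLp {a : α → ℝ} (ha : MemLp a ∞ μ) (f : Lp ℝ p μ) :
    lpMul (ha.toLp a) f =ᵐ[μ] fun x => a x * f x := by
  filter_upwards [coeFn_lpMul (ha.toLp a) f, ha.coeFn_toLp] with x h1 h2
  rw [h1, h2]

/-- Extension by zero from a measurable set on `L^p`. -/
noncomputable def lpExtend {s : Set α} (hs : MeasurableSet s) :
    Lp ℝ p (μ.restrict s) →L[ℝ] Lp ℝ p μ :=
  LinearMap.mkContinuous
    { toFun := fun f => ((memLp_indicator_iff_restrict hs).2 (Lp.memLp f)).toLp (s.indicator f)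
      map_add' := fun f g => by
        rw [← MemLp.toLp_add]
        refine MemLp.toLp_congr _ _ ?_
        filter_upwards [(ae_restrict_iff' hs).1 (Lp.coeFn_add f g)] with x hx
        by_cases hxs : x ∈ s
        · rw [indicator_of_mem hxs, hx hxs, Pi.add_apply, Pi.add_apply, indicator_of_mem hxs,
            indicator_of_mem hxs]
        · simp [hxs]
      map_smul' := fun c f => by
        rw [RingHom.id_apply, ← MemLp.toLp_const_smul]
        refine MemLp.toLp_congr _ _ ?_
        filter_upwards [(ae_restrict_iff' hs).1 (Lp.coeFn_smul c f)] with x hx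
        by_cases hxs : x ∈ s
        · simp [hxs, hx hxs]
        · simp [hxs] } 1 (fun f => by
      change ‖((memLp_indicator_iff_restrict hs).2 (Lp.memLp f)).toLp (s.indicator f)‖ ≤ _
      rw [Lp.norm_toLp, eLpNorm_indicator_eq_eLpNorm_restrict hs, one_mul, Lp.norm_def])

theorem coeFn_lpExtend {s : Set α} (hs : MeasurableSet s) (f : Lp ℝ p (μ.restrict s)) :
    lpExtend hs f =ᵐ[μ] s.indicator f := by
  have h : lpExtend hs f =
      ((memLp_indicator_iff_restrict hs).2 (Lp.memLp f)).toLp (s.indicator f) := rfl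
  rw [h]
  exact MemLp.coeFn_toLp _

end LpOperators

section Sobolev

open scoped ContDiff

theorem jet_eq_sum_single {N : ℕ} {p : ℝ≥0∞} (w : Jet N p) :
    w = ∑ o, PiLp.single p o (w o) := by
  ext o : 1
  simp only [WithLp.ofLp_sum, PiLp.ofLp_single, Finset.sum_apply, Pi.single_apply]
  rw [Finset.sum_ite_eq]
  simp

variable {N : ℕ} {p : ℝ≥0∞} [Fact (1 ≤ p)] {Ω : Opens (Eucl N)}

theorem fderiv_apply_contDiff {φ : Eucl N → ℝ} (h : ContDiff ℝ ∞ φ) (v : Eucl N) :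
    ContDiff ℝ ∞ fun x => fderiv ℝ φ x v :=
  (h.fderiv_right (m := ∞) (by simp)).clm_apply contDiff_const

theorem fderiv_apply_hasCompactSupport {φ : Eucl N → ℝ} (h : HasCompactSupport φ) (v : Eucl N) :
    HasCompactSupport fun x => fderiv ℝ φ x v :=
  h.fderiv_apply (𝕜 := ℝ) v

theorem memLp_of_test {φ : Eucl N → ℝ} (h : ContDiff ℝ ∞ φ) (hc : HasCompactSupport φ)
    (r : ℝ≥0∞) : MemLp φ r (volume : Measure (Eucl N)) :=
  h.continuous.memLp_of_hasCompactSupport hc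

theorem memLp_fderiv_of_test {φ : Eucl N → ℝ} (h : ContDiff ℝ ∞ φ) (hc : HasCompactSupport φ)
    (v : Eucl N) (r : ℝ≥0∞) : MemLp (fun x => fderiv ℝ φ x v) r (volume : Measure (Eucl N)) :=
  memLp_of_test (fderiv_apply_contDiff h v) (fderiv_apply_hasCompactSupport hc v) r

theorem map_eq_zero_of_testJets {F : Type*} [NormedAddCommGroup F] [NormedSpace ℝ F]
    (T : Jet N p →L[ℝ] F) (h : ∀ w ∈ testJets p Ω, T w = 0) (y : W0 p Ω) :
    T (y : Jet N p) = 0 := by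
  have hcl : IsClosed {w : Jet N p | T w = 0} := isClosed_eq T.continuous continuous_const
  exact closure_minimal (s := (testJets p Ω : Set (Jet N p))) h hcl y.2

theorem jet_ae_eq_zero (y : W0 p Ω) (o : Option (Fin N)) :
    ∀ᵐ x, x ∉ (Ω : Set (Eucl N)) → (y : Jet N p) o x = 0 := by
  have hm : MeasurableSet (Ω : Set (Eucl N))ᶜ := Ω.isOpen.measurableSet.compl
  have hχ : MemLp ((Ω : Set (Eucl N))ᶜ.indicator fun _ => (1 : ℝ)) ∞ volume :=
    (memLp_top_const (1 : ℝ)).indicator hm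
  have h := map_eq_zero_of_testJets (Ω := Ω)
    ((lpMul (hχ.toLp _)).comp (PiLp.proj p (𝕜 := ℝ) (fun _ : Option (Fin N) =>
      Lp ℝ p (volume : Measure (Eucl N))) o)) (fun w hw => ?_) y
  · have h' : lpMul (hχ.toLp _) ((y : Jet N p) o) = 0 := h
    filter_upwards [coeFn_lpMul_toLp hχ ((y : Jet N p) o), Lp.coeFn_zero ℝ p volume]
      with x h1 h2 hx
    rw [h', h2] at h1
    simpa [hx] using h1.symm
  · obtain ⟨φ, h0, h1⟩ := hw
    change lpMul (hχ.toLp _) (w o) = 0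
    rw [Lp.eq_zero_iff_ae_eq_zero]
    have hz : ∀ x, x ∉ (Ω : Set (Eucl N)) → x ∉ tsupport (φ : Eucl N → ℝ) :=
      fun x hx hx' => hx (φ.tsupport_subset hx')
    cases o with
    | none =>
      filter_upwards [coeFn_lpMul_toLp hχ (w none), h0] with x h2 h3
      rw [h2, h3]
      by_cases hx : x ∈ (Ω : Set (Eucl N))
      · simp [hx]
      · simp [image_eq_zero_of_notMem_tsupport (hz x hx)]
    | some i =>
      filter_upwards [coeFn_lpMul_toLp hχ (w (some i)), h1 i] with x h2 h3
      rw [h2, h3]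
      by_cases hx : x ∈ (Ω : Set (Eucl N))
      · simp [hx]
      · have : fderiv ℝ (φ : Eucl N → ℝ) x = 0 :=
          image_eq_zero_of_notMem_tsupport fun h => hz x hx (tsupport_fderiv_subset ℝ h)
        simp [this]

theorem setIntegral_eq_integral_of_jet {y : W0 p Ω} (o : Option (Fin N)) {G : Eucl N → ℝ}
    (hG : ∀ x, (y : Jet N p) o x = 0 → G x = 0) :
    ∫ x in (Ω : Set (Eucl N)), G x = ∫ x, G x := by
  refine setIntegral_eq_integral_of_ae_compl_eq_zero ?_
  filter_upwards [jet_ae_eq_zero y o] with x hx hx'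
  exact hG x (hx hx')

/-- Integration by parts for functions in `W₀^{1,p}(Ω)`. -/
theorem integral_grad_mul (q : ℝ≥0∞) [Fact (1 ≤ q)] [p.HolderConjugate q] (y : W0 p Ω)
    (i : Fin N) {ψ : Eucl N → ℝ} (hψ : ContDiff ℝ ∞ ψ) (hψc : HasCompactSupport ψ) :
    ∫ x, ψ x * W0.grad y i x = -∫ x, fderiv ℝ ψ x (EuclideanSpace.single i 1) * W0.fn y x := by
  have hm := memLp_of_test hψ hψc q
  have hm' := memLp_fderiv_of_test hψ hψc (EuclideanSpace.single i 1) q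
  have key : ∀ w : Jet N p, lpDual volume q p (hm.toLp ψ) (w (some i)) +
      lpDual volume q p (hm'.toLp _) (w none) = (∫ x, ψ x * w (some i) x) +
        ∫ x, fderiv ℝ ψ x (EuclideanSpace.single i 1) * w none x := by
    intro w
    rw [lpDual_apply, lpDual_apply]
    congr 1
    · refine integral_congr_ae ?_
      filter_upwards [hm.coeFn_toLp] with x hx
      rw [hx]
    · refine integral_congr_ae ?_
      filter_upwards [hm'.coeFn_toLp] with x hx
      rw [hx]
  have h := map_eq_zero_of_testJets (Ω := Ω)
    ((lpDual volume q p (hm.toLp ψ)).comp (PiLp.proj p (𝕜 := ℝ) (fun _ : Option (Fin N) =>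
      Lp ℝ p (volume : Measure (Eucl N))) (some i)) +
      (lpDual volume q p (hm'.toLp _)).comp (PiLp.proj p (𝕜 := ℝ) (fun _ : Option (Fin N) =>
      Lp ℝ p (volume : Measure (Eucl N))) none)) (fun w hw => ?_) y
  · have h' := (key (y : Jet N p)).symm.trans h
    exact eq_neg_of_add_eq_zero_left h'
  · refine (key w).trans ?_
    obtain ⟨φ, h0, h1⟩ := hw
    rw [integral_congr_ae (g := fun x => ψ x * fderiv ℝ φ x (EuclideanSpace.single i 1))
      ((h1 i).mono fun x hx => by simp only [hx]),
      integral_congr_ae (f := fun x => fderiv ℝ ψ x (EuclideanSpace.single i 1) * w none x)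
      (g := fun x => fderiv ℝ ψ x (EuclideanSpace.single i 1) * φ x)
      (h0.mono fun x hx => by simp only [hx])]
    have hφ := memLp_of_test φ.contDiff φ.hasCompactSupport p
    have hφ' := memLp_fderiv_of_test φ.contDiff φ.hasCompactSupport (EuclideanSpace.single i 1) p
    rw [integral_mul_fderiv_eq_neg_fderiv_mul_of_integrable (integrable_mul_of_memLp hm' hφ)
      (integrable_mul_of_memLp hm hφ') (integrable_mul_of_memLp hm hφ)
      (fun x _ => hψ.contDiffAt.differentiableAt (by simp))
      (fun x _ => φ.contDiff.contDiffAt.differentiableAt (by simp))]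
    ring

/-- A function in `W₀^{1,p}(Ω)` determines its weak gradient. -/
theorem eq_zero_of_fn_ae_eq_zero (q : ℝ≥0∞) [Fact (1 ≤ q)] [p.HolderConjugate q] {y : W0 p Ω}
    (h : W0.fn y =ᵐ[volume] 0) : y = 0 := by
  ext o : 2
  rw [Lp.ext_iff]
  refine EventuallyEq.trans ?_ (Lp.coeFn_zero ℝ p volume).symm
  cases o with
  | none => exact h
  | some i =>
    refine ae_eq_zero_of_integral_contDiff_smul_eq_zero
      ((Lp.memLp _).locallyIntegrable Fact.out) fun ψ hψ hψc => ?_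
    simp only [smul_eq_mul]
    refine (integral_grad_mul q y i hψ hψc).trans ?_
    rw [neg_eq_zero]
    refine integral_eq_zero_of_ae ?_
    filter_upwards [h] with x hx
    rw [hx]
    simp

theorem W0_norm_rpow (hp' : p ≠ ⊤) (y : W0 p Ω) :
    ‖y‖ ^ p.toReal = (∫ x in (Ω : Set (Eucl N)), |W0.fn y x| ^ p.toReal) +
      ∑ i, ∫ x in (Ω : Set (Eucl N)), |W0.grad y i x| ^ p.toReal := by
  have h1 : (1 : ℝ≥0∞) ≤ p := Fact.out
  have hpos : 0 < p.toReal := ENNReal.toReal_pos (zero_lt_one.trans_le h1).ne' hp'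
  have hn : ‖y‖ ^ p.toReal = ∑ o, ‖(y : Jet N p) o‖ ^ p.toReal := by
    rw [← Submodule.norm_coe, PiLp.norm_eq_sum hpos, ← Real.rpow_mul
      (Finset.sum_nonneg fun o _ => Real.rpow_nonneg (norm_nonneg _) _),
      one_div_mul_cancel hpos.ne', Real.rpow_one]
  have hz : |(0 : ℝ)| ^ p.toReal = 0 := by rw [abs_zero, Real.zero_rpow hpos.ne']
  have ho : ∀ o, ‖(y : Jet N p) o‖ ^ p.toReal =
      ∫ x in (Ω : Set (Eucl N)), |(y : Jet N p) o x| ^ p.toReal := by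
    intro o
    rw [Lp_norm_rpow_eq_integral hp',
      setIntegral_eq_integral_of_jet (y := y) o (fun x hx => by rw [hx, hz])]
  rw [hn, Fintype.sum_option, ho]
  congr 1
  exact Finset.sum_congr rfl fun i _ => ho (some i)

theorem norm_jet_apply_le (w : Jet N p) (o : Option (Fin N)) : ‖w o‖ ≤ ‖w‖ :=
  PiLp.norm_apply_le w o

/-- Bounded sequences in `W₀^{1,p}(Ω)`, `Ω` bounded and `2 ≤ p < ∞`, have weakly convergent
subsequences. -/
theorem exists_subseq_tendsto_weak_W0 (q : ℝ≥0∞) [Fact (1 ≤ q)] [p.HolderConjugate q]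
    (hp : 2 ≤ p) (hp' : p ≠ ⊤) (hΩ : Bornology.IsBounded (Ω : Set (Eucl N))) {y : ℕ → W0 p Ω}
    {M : ℝ} (h : ∀ k, ‖y k‖ ≤ M) :
    ∃ (φ : ℕ → ℕ) (y₀ : W0 p Ω), StrictMono φ ∧
      ∀ ℓ : StrongDual ℝ (W0 p Ω), Tendsto (fun k => ℓ (y (φ k))) atTop (𝓝 (ℓ y₀)) := by
  have hms : MeasurableSet (Ω : Set (Eucl N)) := Ω.isOpen.measurableSet
  have : IsFiniteMeasure (volume.restrict (Ω : Set (Eucl N))) :=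
    ⟨by simpa using hΩ.measure_lt_top⟩
  let r : ℕ → Option (Fin N) → LSp p Ω := fun k o =>
    ((Lp.memLp ((y k : Jet N p) o)).mono_measure Measure.restrict_le_self).toLp _
  have hr : ∀ k o, ‖r k o‖ ≤ M := by
    intro k o
    refine le_trans ?_ ((norm_jet_apply_le (y k : Jet N p) o).trans (h k))
    rw [Lp.norm_toLp, Lp.norm_def]
    exact ENNReal.toReal_mono (Lp.eLpNorm_ne_top _)
      (eLpNorm_mono_measure _ Measure.restrict_le_self)
  have hE : ∀ k o, lpExtend hms (r k o) = (y k : Jet N p) o := by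
    intro k o
    rw [Lp.ext_iff]
    filter_upwards [coeFn_lpExtend hms (r k o), jet_ae_eq_zero (y k) o,
      (ae_restrict_iff' hms).1 (MemLp.coeFn_toLp
        ((Lp.memLp ((y k : Jet N p) o)).mono_measure
          (Measure.restrict_le_self (s := (Ω : Set (Eucl N))))))] with x h1 h2 h3
    rw [h1]
    by_cases hx : x ∈ (Ω : Set (Eucl N))
    · rw [indicator_of_mem hx]
      exact h3 hx
    · rw [indicator_of_notMem hx, h2 hx]
  obtain ⟨φ, hφ, hP⟩ := exists_common_subseq
    (P := fun o (φ : ℕ → ℕ) => ∃ r₀ : LSp p Ω, ∀ ℓ : StrongDual ℝ (LSp p Ω),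
      Tendsto (fun k => ℓ (r (φ k) o)) atTop (𝓝 (ℓ r₀)))
    (fun o φ ψ hψ ⟨r₀, hr₀⟩ => ⟨r₀, fun ℓ => (hr₀ ℓ).comp hψ.tendsto_atTop⟩)
    (fun o φ _ => by
      obtain ⟨ψ, r₀, hψ, hr₀⟩ := exists_subseq_tendsto_weak_Lp (q := q) hp hp'
        (z := fun k => r (φ k) o) (fun k => hr _ o)
      exact ⟨ψ, hψ, r₀, hr₀⟩)
  choose r₀ hr₀ using hP
  let w : Jet N p := WithLp.toLp p fun o => lpExtend hms (r₀ o)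
  have hL : ∀ L : StrongDual ℝ (Jet N p),
      Tendsto (fun k => L (y (φ k) : Jet N p)) atTop (𝓝 (L w)) := by
    intro L
    have hsum : ∀ v : Jet N p, L v = ∑ o, L (PiLp.single p o (v o)) := by
      intro v
      conv_lhs => rw [jet_eq_sum_single v, map_sum]
    rw [hsum w]
    simp_rw [fun k => hsum (y (φ k) : Jet N p)]
    refine tendsto_finsetSum _ fun o _ => ?_
    let S : Lp ℝ p (volume : Measure (Eucl N)) →L[ℝ] Jet N p :=
      ((PiLp.continuousLinearEquiv p ℝ (fun _ : Option (Fin N) =>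
        Lp ℝ p (volume : Measure (Eucl N)))).symm : _ →L[ℝ] Jet N p).comp
        (ContinuousLinearMap.single ℝ (fun _ : Option (Fin N) =>
          Lp ℝ p (volume : Measure (Eucl N))) o)
    have := hr₀ o (L.comp (S.comp (lpExtend hms)))
    simp only [ContinuousLinearMap.comp_apply, hE] at this
    exact this
  have hw : w ∈ sobolevZero p Ω := by
    by_contra hne
    obtain ⟨f, u, hfu, huw⟩ := geometric_hahn_banach_closed_point (sobolevZero p Ω).convex
      (Submodule.isClosed_topologicalClosure _) hne
    exact absurd (le_of_tendsto' (hL f) fun k => (hfu _ (y (φ k)).2).le) (not_le.2 huw)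
  refine ⟨φ, ⟨w, hw⟩, hφ, fun ℓ => ?_⟩
  obtain ⟨L, hLℓ, -⟩ := exists_extension_norm_eq (sobolevZero p Ω) ℓ
  have := hL L
  simp only [hLℓ] at this
  have h2 : L w = ℓ ⟨w, hw⟩ := hLℓ ⟨w, hw⟩
  rwa [h2] at this

/-- Multiplication by a test function maps `W₀^{1,p}(Ω)` continuously into itself. -/
theorem exists_mul_W0 {ψ : Eucl N → ℝ} (hψ : ContDiff ℝ ∞ ψ) (hψc : HasCompactSupport ψ) :
    ∃ M : W0 p Ω →L[ℝ] W0 p Ω, ∀ y i, W0.grad (M y) i =ᵐ[volume]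
      fun x => ψ x * W0.grad y i x + fderiv ℝ ψ x (EuclideanSpace.single i 1) * W0.fn y x := by
  have hm := memLp_of_test hψ hψc ∞
  have hm' := fun i : Fin N => memLp_fderiv_of_test hψ hψc (EuclideanSpace.single i 1) ∞
  let π : ∀ o : Option (Fin N), Jet N p →L[ℝ] Lp ℝ p (volume : Measure (Eucl N)) := fun o =>
    PiLp.proj p (𝕜 := ℝ) (fun _ : Option (Fin N) => Lp ℝ p (volume : Measure (Eucl N))) o
  let R : ∀ _ : Option (Fin N), Jet N p →L[ℝ] Lp ℝ p (volume : Measure (Eucl N)) := fun o =>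
    match o with
    | none => (lpMul (hm.toLp ψ)).comp (π none)
    | some i => (lpMul (hm.toLp ψ)).comp (π (some i)) + (lpMul ((hm' i).toLp _)).comp (π none)
  let T : Jet N p →L[ℝ] Jet N p :=
    ((PiLp.continuousLinearEquiv p ℝ (fun _ : Option (Fin N) =>
        Lp ℝ p (volume : Measure (Eucl N)))).symm : _ →L[ℝ] Jet N p).comp
      (ContinuousLinearMap.pi R)
  have hT0 : ∀ w : Jet N p, T w none =ᵐ[volume] fun x => ψ x * w none x := fun w =>
    coeFn_lpMul_toLp hm (w none)
  have hT1 : ∀ (w : Jet N p) (i : Fin N), T w (some i) =ᵐ[volume] fun x =>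
      ψ x * w (some i) x + fderiv ℝ ψ x (EuclideanSpace.single i 1) * w none x := by
    intro w i
    have h1 : T w (some i) = lpMul (hm.toLp ψ) (w (some i)) + lpMul ((hm' i).toLp _) (w none) := rfl
    rw [h1]
    filter_upwards [Lp.coeFn_add (lpMul (hm.toLp ψ) (w (some i))) (lpMul ((hm' i).toLp _) (w none)),
      coeFn_lpMul_toLp hm (w (some i)), coeFn_lpMul_toLp (hm' i) (w none)] with x h2 h3 h4
    rw [h2, Pi.add_apply, h3, h4]
  have hmaps : ∀ w ∈ testJets p Ω, T w ∈ testJets p Ω := by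
    rintro w ⟨φ, h0, h1⟩
    have hsub : tsupport (ψ * (φ : Eucl N → ℝ)) ⊆ Ω :=
      (tsupport_mul_subset_right (f := ψ) (g := φ)).trans φ.tsupport_subset
    refine ⟨⟨ψ * φ, hψ.mul φ.contDiff, hψc.mul_right, hsub⟩, ?_, fun i => ?_⟩
    · filter_upwards [hT0 w, h0] with x h2 h3
      rw [h2, h3]
      rfl
    · filter_upwards [hT1 w i, h0, h1 i] with x h2 h3 h4
      rw [h2, h3, h4]
      change _ = fderiv ℝ (ψ * (φ : Eucl N → ℝ)) x (EuclideanSpace.single i 1)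
      rw [fderiv_mul (hψ.contDiffAt.differentiableAt (by simp))
        (φ.contDiff.contDiffAt.differentiableAt (by simp))]
      simp only [add_apply, smul_apply, smul_eq_mul]
      ring
  have hmaps' : ∀ y : W0 p Ω, T (y : Jet N p) ∈ sobolevZero p Ω := fun y =>
    map_mem_closure T.continuous y.2 hmaps
  refine ⟨(T.comp (sobolevZero p Ω).subtypeL).codRestrict (sobolevZero p Ω) hmaps', fun y i => ?_⟩
  exact hT1 (y : Jet N p) i

end Sobolev

section Rellich

open scoped ContDiff

variable {N : ℕ}

theorem enorm_sub_le_lintegral_fderiv {φ : Eucl N → ℝ} (hφ : ContDiff ℝ ∞ φ) (x h : Eucl N) :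
    ‖φ (x + h) - φ x‖ₑ ≤ ∫⁻ t in Ioc (0 : ℝ) 1, ‖fderiv ℝ φ (x + t • h) h‖ₑ := by
  have hd : ∀ t : ℝ, HasDerivAt (fun s : ℝ => φ (x + s • h)) (fderiv ℝ φ (x + t • h) h) t := by
    intro t
    have h1 : HasFDerivAt φ (fderiv ℝ φ (x + t • h)) (x + t • h) :=
      (hφ.contDiffAt.differentiableAt (by simp)).hasFDerivAt
    have h2 : HasDerivAt (fun s : ℝ => x + s • h) h t := by
      simpa using ((hasDerivAt_id t).smul_const h).const_add x
    exact h1.comp_hasDerivAt t h2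
  have hc : Continuous fun t : ℝ => fderiv ℝ φ (x + t • h) h := by
    have := (fderiv_apply_contDiff hφ h).continuous
    exact this.comp (by fun_prop)
  have hftc := intervalIntegral.integral_eq_sub_of_hasDerivAt (a := 0) (b := 1)
    (fun t _ => hd t) (hc.intervalIntegrable 0 1)
  simp only [one_smul, zero_smul, add_zero] at hftc
  rw [← hftc, intervalIntegral.integral_of_le zero_le_one]
  exact enorm_integral_le_lintegral_enorm _

/-- The translation estimate `‖φ(· + h) - φ‖_{L^1} ≤ |h| ‖∇φ‖_{L^1}`. -/
theorem lintegral_translate_sub_le {φ : Eucl N → ℝ} (hφ : ContDiff ℝ ∞ φ) (h : Eucl N) :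
    ∫⁻ x, ‖φ (x + h) - φ x‖ₑ ≤ ‖h‖ₑ * ∫⁻ x, ‖fderiv ℝ φ x‖ₑ := by
  have hc : Continuous fun x => fderiv ℝ φ x h := (fderiv_apply_contDiff hφ h).continuous
  calc ∫⁻ x, ‖φ (x + h) - φ x‖ₑ
      ≤ ∫⁻ x, ∫⁻ t in Ioc (0 : ℝ) 1, ‖fderiv ℝ φ (x + t • h) h‖ₑ :=
        lintegral_mono fun x => enorm_sub_le_lintegral_fderiv hφ x h
    _ = ∫⁻ t in Ioc (0 : ℝ) 1, ∫⁻ x, ‖fderiv ℝ φ (x + t • h) h‖ₑ := by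
        refine lintegral_lintegral_swap ?_
        have : Continuous fun z : Eucl N × ℝ => ‖fderiv ℝ φ (z.1 + z.2 • h) h‖ₑ :=
          (hc.comp (by fun_prop : Continuous fun z : Eucl N × ℝ => z.1 + z.2 • h)).enorm
        exact this.measurable.aemeasurable
    _ = ∫⁻ t in Ioc (0 : ℝ) 1, ∫⁻ x, ‖fderiv ℝ φ x h‖ₑ := by
        refine lintegral_congr fun t => ?_
        exact lintegral_add_right_eq_self (fun x => ‖fderiv ℝ φ x h‖ₑ) (t • h)
    _ = ∫⁻ x, ‖fderiv ℝ φ x h‖ₑ := by simp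
    _ ≤ ∫⁻ x, ‖h‖ₑ * ‖fderiv ℝ φ x‖ₑ := by
        refine lintegral_mono fun x => ?_
        rw [mul_comm]
        exact (fderiv ℝ φ x).le_opENorm h
    _ = ‖h‖ₑ * ∫⁻ x, ‖fderiv ℝ φ x‖ₑ := by
        refine lintegral_const_mul _ ?_
        exact (hφ.continuous_fderiv (by simp)).enorm.measurable

/-- Averages of `φ` with weight `ρ`. -/
noncomputable def avg (ρ φ : Eucl N → ℝ) (x : Eucl N) : ℝ := ∫ h, ρ h * φ (x + h)

theorem stronglyMeasurable_avg {ρ φ : Eucl N → ℝ} (hρ : Continuous ρ) (hφ : Continuous φ) :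
    StronglyMeasurable (avg ρ φ) := by
  have : Continuous (Function.uncurry fun (x h : Eucl N) => ρ h * φ (x + h)) := by
    simp only [Function.uncurry_def]
    fun_prop
  exact this.stronglyMeasurable.integral_prod_right

theorem avg_eq (ρ φ : Eucl N → ℝ) (x : Eucl N) : avg ρ φ x = ∫ s, ρ (s - x) * φ s := by
  rw [avg, ← integral_add_left_eq_self (fun s => ρ (s - x) * φ s) x]
  simp

theorem lintegral_sub_avg_le {ρ φ : Eucl N → ℝ} (hρ : Continuous ρ) (hρc : HasCompactSupport ρ)
    (hρ0 : ∀ x, 0 ≤ ρ x) (hρ1 : ∫ x, ρ x = 1) {ε : ℝ} (hε : ∀ x, ρ x ≠ 0 → ‖x‖ ≤ ε)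
    (hφ : ContDiff ℝ ∞ φ) :
    ∫⁻ x, ‖φ x - avg ρ φ x‖ₑ ≤ ENNReal.ofReal ε * ∫⁻ x, ‖fderiv ℝ φ x‖ₑ := by
  have hφc := hφ.continuous
  have hpt : ∀ x, ‖φ x - avg ρ φ x‖ₑ ≤ ∫⁻ h, ‖ρ h‖ₑ * ‖φ (x + h) - φ x‖ₑ := by
    intro x
    have h1 : Integrable fun h => ρ h * φ (x + h) := by
      refine Continuous.integrable_of_hasCompactSupport (by fun_prop) ?_
      exact hρc.mul_right
    have h2 : Integrable fun h => ρ h * φ x :=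
      (hρ.integrable_of_hasCompactSupport hρc).mul_const _
    have h3 : φ x - avg ρ φ x = ∫ h, (ρ h * φ x - ρ h * φ (x + h)) := by
      rw [integral_sub h2 h1, integral_mul_const, hρ1, one_mul, avg]
    rw [h3]
    refine (enorm_integral_le_lintegral_enorm _).trans (le_of_eq (lintegral_congr fun h => ?_))
    rw [← mul_sub, enorm_mul, ← enorm_neg (φ x - _), neg_sub]
  have hρe : ∫⁻ h, ‖ρ h‖ₑ = 1 := by
    rw [← ofReal_integral_norm_eq_lintegral_enorm (hρ.integrable_of_hasCompactSupport hρc)]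
    simp_rw [fun h => Real.norm_of_nonneg (hρ0 h), hρ1, ENNReal.ofReal_one]
  calc ∫⁻ x, ‖φ x - avg ρ φ x‖ₑ ≤ ∫⁻ x, ∫⁻ h, ‖ρ h‖ₑ * ‖φ (x + h) - φ x‖ₑ :=
        lintegral_mono hpt
    _ = ∫⁻ h, ∫⁻ x, ‖ρ h‖ₑ * ‖φ (x + h) - φ x‖ₑ := by
        refine lintegral_lintegral_swap ?_
        have : Measurable fun z : Eucl N × Eucl N => ‖ρ z.2‖ₑ * ‖φ (z.1 + z.2) - φ z.1‖ₑ := by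
          have h1 : Continuous fun z : Eucl N × Eucl N => ρ z.2 := by fun_prop
          have h2 : Continuous fun z : Eucl N × Eucl N => φ (z.1 + z.2) - φ z.1 := by fun_prop
          exact h1.enorm.measurable.mul h2.enorm.measurable
        exact this.aemeasurable
    _ = ∫⁻ h, ‖ρ h‖ₑ * ∫⁻ x, ‖φ (x + h) - φ x‖ₑ := by
        refine lintegral_congr fun h => lintegral_const_mul _ ?_
        exact (by fun_prop : Continuous fun x : Eucl N => φ (x + h) - φ x).enorm.measurable
    _ ≤ ∫⁻ h, ‖ρ h‖ₑ * (ENNReal.ofReal ε * ∫⁻ x, ‖fderiv ℝ φ x‖ₑ) := by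
        refine lintegral_mono fun h => ?_
        by_cases hh : ρ h = 0
        · simp [hh]
        · gcongr
          refine (lintegral_translate_sub_le hφ h).trans ?_
          gcongr
          rw [← ofReal_norm]
          exact ENNReal.ofReal_le_ofReal (hε h hh)
    _ = ENNReal.ofReal ε * ∫⁻ x, ‖fderiv ℝ φ x‖ₑ := by
        rw [lintegral_mul_const _ hρ.enorm.measurable, hρe, one_mul]

theorem norm_clm_le_sum (L : Eucl N →L[ℝ] ℝ) :
    ‖L‖ ≤ ∑ i, ‖L (EuclideanSpace.single i 1)‖ := by
  refine L.opNorm_le_bound (Finset.sum_nonneg fun i _ => norm_nonneg _) fun v => ?_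
  have hv : v = ∑ i, v i • EuclideanSpace.single i (1 : ℝ) := by
    ext j
    simp [WithLp.ofLp_sum, Pi.single_apply]
  conv_lhs => rw [hv, map_sum]
  refine (norm_sum_le _ _).trans ?_
  rw [Finset.sum_mul]
  refine Finset.sum_le_sum fun i _ => ?_
  rw [map_smul, norm_smul, mul_comm]
  gcongr
  exact PiLp.norm_apply_le v i

variable {p : ℝ≥0∞} [Fact (1 ≤ p)] {Ω : Opens (Eucl N)}

theorem exists_integral_abs_le (q : ℝ≥0∞) [Fact (1 ≤ q)] [p.HolderConjugate q]
    (hΩ : Bornology.IsBounded (Ω : Set (Eucl N))) :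
    ∃ C : ℝ, 0 ≤ C ∧ ∀ (y : W0 p Ω) (o : Option (Fin N)),
      Integrable ((y : Jet N p) o) volume ∧ ∫ x, |(y : Jet N p) o x| ≤ C * ‖y‖ := by
  have hχ : MemLp ((Ω : Set (Eucl N)).indicator fun _ => (1 : ℝ)) q volume :=
    memLp_indicator_const q Ω.isOpen.measurableSet 1 (Or.inr hΩ.measure_lt_top.ne)
  refine ⟨‖hχ.toLp _‖, norm_nonneg _, fun y o => ?_⟩
  have hae : ∀ v : Lp ℝ p (volume : Measure (Eucl N)),
      (∀ᵐ x, x ∉ (Ω : Set (Eucl N)) → v x = 0) →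
      (fun x => (hχ.toLp _ : Eucl N → ℝ) x * v x) =ᵐ[volume] v := by
    intro v hv
    filter_upwards [hχ.coeFn_toLp, hv] with x h1 h2
    rw [h1]
    by_cases hx : x ∈ (Ω : Set (Eucl N))
    · simp [hx]
    · simp [hx, h2 hx]
  refine ⟨(integrable_mul_of_memLp (Lp.memLp (hχ.toLp _)) (Lp.memLp _)).congr
    (hae _ (jet_ae_eq_zero y o)), ?_⟩
  have habs : ∀ᵐ x, x ∉ (Ω : Set (Eucl N)) → (|(y : Jet N p) o| : Lp ℝ p volume) x = 0 := by
    filter_upwards [Lp.coeFn_abs ((y : Jet N p) o), jet_ae_eq_zero y o] with x h1 h2 hx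
    rw [h1, h2 hx, abs_zero]
  have h1 := abs_integral_mul_le (hχ.toLp _) |(y : Jet N p) o|
  rw [integral_congr_ae (hae _ habs), integral_congr_ae (Lp.coeFn_abs ((y : Jet N p) o)),
    norm_abs_eq_norm] at h1
  refine ((le_abs_self _).trans h1).trans ?_
  gcongr
  exact norm_jet_apply_le (y : Jet N p) o

end Rellich

section Rellich

open scoped ContDiff

variable {N : ℕ} {p : ℝ≥0∞} [Fact (1 ≤ p)] {Ω : Opens (Eucl N)}

/-- The continuous functional `y ↦ ∫ ψ ∂_o y` on `W₀^{1,p}(Ω)`. -/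
theorem exists_dual_W0_eq_integral (q : ℝ≥0∞) [Fact (1 ≤ q)] [p.HolderConjugate q]
    {ψ : Eucl N → ℝ} (hψ : MemLp ψ q volume) (o : Option (Fin N)) :
    ∃ ℓ : StrongDual ℝ (W0 p Ω), ∀ y : W0 p Ω, ℓ y = ∫ x, ψ x * (y : Jet N p) o x := by
  refine ⟨((lpDual volume q p (hψ.toLp ψ)).comp (PiLp.proj p (𝕜 := ℝ)
    (fun _ : Option (Fin N) => Lp ℝ p (volume : Measure (Eucl N))) o)).comp
      (sobolevZero p Ω).subtypeL, fun y => ?_⟩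
  refine Eq.trans (lpDual_apply (hψ.toLp ψ) ((y : Jet N p) o)) (integral_congr_ae ?_)
  filter_upwards [hψ.coeFn_toLp] with x hx
  rw [hx]

theorem lintegral_fderiv_le {C M : ℝ} {u : W0 p Ω} {φ : Eucl N → ℝ} (hφ : ContDiff ℝ ∞ φ)
    (h1 : ∀ i : Fin N, W0.grad u i =ᵐ[volume] fun x => fderiv ℝ φ x (EuclideanSpace.single i 1))
    (hint : ∀ o, Integrable ((u : Jet N p) o) volume)
    (hC : ∀ o, ∫ x, |(u : Jet N p) o x| ≤ C * M) :
    ∫⁻ x, ‖fderiv ℝ φ x‖ₑ ≤ ENNReal.ofReal (N * (C * M)) := by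
  calc ∫⁻ x, ‖fderiv ℝ φ x‖ₑ
      ≤ ∫⁻ x, ∑ i, ‖fderiv ℝ φ x (EuclideanSpace.single i 1)‖ₑ := by
        refine lintegral_mono fun x => ?_
        simp only [← ofReal_norm]
        rw [← ENNReal.ofReal_sum_of_nonneg fun i _ => norm_nonneg _]
        exact ENNReal.ofReal_le_ofReal (norm_clm_le_sum _)
    _ = ∑ i, ∫⁻ x, ‖fderiv ℝ φ x (EuclideanSpace.single i 1)‖ₑ :=
        lintegral_finsetSum _ fun i _ =>
          (fderiv_apply_contDiff hφ _).continuous.enorm.measurable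
    _ ≤ ∑ _i : Fin N, ENNReal.ofReal (C * M) := by
        refine Finset.sum_le_sum fun i _ => ?_
        have he : ∫⁻ x, ‖fderiv ℝ φ x (EuclideanSpace.single i 1)‖ₑ =
            ∫⁻ x, ‖(u : Jet N p) (some i) x‖ₑ := by
          refine lintegral_congr_ae ?_
          filter_upwards [h1 i] with x hx
          rw [← hx]
          rfl
        rw [he, ← ofReal_integral_norm_eq_lintegral_enorm (hint (some i))]
        exact ENNReal.ofReal_le_ofReal (hC (some i))
    _ = ENNReal.ofReal (N * (C * M)) := by
        rw [Finset.sum_const, Finset.card_univ, Fintype.card_fin, nsmul_eq_mul,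
          ENNReal.ofReal_mul (Nat.cast_nonneg N), ENNReal.ofReal_natCast]

/-- The compactness of the embedding of `W₀^{1,p}(Ω)` into `L^1`, for test functions. -/
theorem tendsto_integral_abs_of_testJets (q : ℝ≥0∞) [Fact (1 ≤ q)] [p.HolderConjugate q]
    (hΩ : Bornology.IsBounded (Ω : Set (Eucl N))) {u : ℕ → W0 p Ω} {M : ℝ}
    (hu : ∀ k, (u k : Jet N p) ∈ testJets p Ω) (hM : ∀ k, ‖u k‖ ≤ M)
    (hw : ∀ ℓ : StrongDual ℝ (W0 p Ω), Tendsto (fun k => ℓ (u k)) atTop (𝓝 0)) :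
    Tendsto (fun k => ∫ x, |W0.fn (u k) x|) atTop (𝓝 0) := by
  obtain ⟨C, hC0, hC⟩ := exists_integral_abs_le (p := p) q hΩ
  choose φ hφ0 hφ1 using hu
  have hM0 : 0 ≤ M := (norm_nonneg _).trans (hM 0)
  have hCM : ∀ k o, ∫ x, |(u k : Jet N p) o x| ≤ C * M := fun k o =>
    ((hC (u k) o).2).trans (by gcongr; exact hM k)
  have hφint : ∀ k, Integrable (φ k : Eucl N → ℝ) volume := fun k =>
    (φ k).continuous.integrable_of_hasCompactSupport (φ k).hasCompactSupport
  have hφle : ∀ k, ∫ x, |φ k x| ≤ C * M := by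
    intro k
    refine le_of_eq_of_le (integral_congr_ae ?_) (hCM k none)
    filter_upwards [hφ0 k] with x hx
    rw [hx]
  have heq : ∀ k, ∫ x, |W0.fn (u k) x| = ∫ x in (Ω : Set (Eucl N)), |φ k x| := by
    intro k
    rw [setIntegral_eq_integral_of_forall_compl_eq_zero]
    · refine integral_congr_ae ?_
      filter_upwards [hφ0 k] with x hx
      rw [← hx]
      rfl
    · intro x hx
      rw [image_eq_zero_of_notMem_tsupport fun h => hx ((φ k).tsupport_subset h), abs_zero]
  have hfin : volume (Ω : Set (Eucl N)) < ⊤ := hΩ.measure_lt_top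
  have : IsFiniteMeasure (volume.restrict (Ω : Set (Eucl N))) := ⟨by simpa using hfin⟩
  rw [Metric.tendsto_atTop]
  intro δ hδ
  set ε : ℝ := δ / (2 * (N * (C * M) + 1)) with hε
  have hden : 0 < 2 * (N * (C * M) + 1) := by positivity
  have hεpos : 0 < ε := by positivity
  let b : ContDiffBump (0 : Eucl N) := ⟨ε / 2, ε, by positivity, by linarith⟩
  set ρ : Eucl N → ℝ := b.normed volume with hρ
  have hρc : Continuous ρ := b.continuous_normed
  have hρs : HasCompactSupport ρ := b.hasCompactSupport_normed
  obtain ⟨K, hK⟩ := hρc.bounded_above_of_compact_support hρs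
  have hK0 : 0 ≤ K := (norm_nonneg _).trans (hK 0)
  have hsupp : ∀ x, ρ x ≠ 0 → ‖x‖ ≤ ε := by
    intro x hx
    have : x ∈ Function.support ρ := hx
    rw [hρ, b.support_normed_eq, Metric.mem_ball, dist_zero_right] at this
    exact this.le
  have hAb : ∀ k x, |avg ρ (φ k) x| ≤ K * (C * M) := by
    intro k x
    rw [avg_eq]
    refine (abs_integral_le_integral_abs).trans ?_
    refine (integral_mono_of_nonneg (ae_of_all _ fun s => abs_nonneg _)
      ((hφint k).abs.const_mul K) (ae_of_all _ fun s => ?_)).trans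
        (le_of_eq_of_le (integral_const_mul K _) (mul_le_mul_of_nonneg_left (hφle k) hK0))
    simp only [abs_mul]
    gcongr
    exact hK _
  have hfirst : ∀ k, ∫ x in (Ω : Set (Eucl N)), |φ k x - avg ρ (φ k) x| ≤ δ / 2 := by
    intro k
    have hm : StronglyMeasurable fun x => φ k x - avg ρ (φ k) x :=
      (φ k).continuous.stronglyMeasurable.sub (stronglyMeasurable_avg hρc (φ k).continuous)
    have h1 := lintegral_sub_avg_le hρc hρs b.nonneg_normed b.integral_normed hsupp (φ k).contDiff
    have h2 := lintegral_fderiv_le (φ k).contDiff (hφ1 k) (fun o => (hC (u k) o).1) (hCM k)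
    have h3 : ∫⁻ x in (Ω : Set (Eucl N)), ‖φ k x - avg ρ (φ k) x‖ₑ ≤ ENNReal.ofReal (δ / 2) := by
      refine (setLIntegral_le_lintegral _ _).trans (h1.trans ((mul_le_mul_right h2 _).trans ?_))
      rw [← ENNReal.ofReal_mul hεpos.le]
      refine ENNReal.ofReal_le_ofReal ?_
      rw [hε, div_mul_eq_mul_div, div_le_div_iff₀ hden two_pos]
      nlinarith
    refine le_of_eq_of_le (integral_norm_eq_lintegral_enorm hm.aestronglyMeasurable) ?_
    exact ENNReal.toReal_le_of_le_ofReal (by positivity) h3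
  have hsecond : Tendsto (fun k => ∫ x in (Ω : Set (Eucl N)), |avg ρ (φ k) x|) atTop (𝓝 0) := by
    have h0 : (0 : ℝ) = ∫ x in (Ω : Set (Eucl N)), (0 : ℝ) := by simp
    rw [h0]
    refine tendsto_integral_of_dominated_convergence (fun _ => K * (C * M)) (fun k => ?_)
      (integrable_const _) (fun k => ae_of_all _ fun x => ?_) (ae_of_all _ fun x => ?_)
    · exact (stronglyMeasurable_avg hρc (φ k).continuous).norm.aestronglyMeasurable
    · rw [Real.norm_eq_abs, abs_abs]
      exact hAb k x
    · have hmem : MemLp (fun s => ρ (s - x)) q volume := by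
        refine Continuous.memLp_of_hasCompactSupport (by fun_prop) ?_
        exact hρs.comp_homeomorph (Homeomorph.subRight x)
      obtain ⟨ℓ, hℓ⟩ := exists_dual_W0_eq_integral (Ω := Ω) (p := p) q hmem none
      have h1 : ∀ k, avg ρ (φ k) x = ℓ (u k) := by
        intro k
        rw [avg_eq, hℓ]
        refine integral_congr_ae ?_
        filter_upwards [hφ0 k] with s hs
        rw [hs]
      simp_rw [h1]
      simpa using (hw ℓ).abs
  obtain ⟨n, hn⟩ := (Metric.tendsto_atTop.1 hsecond) (δ / 2) (by positivity)
  refine ⟨n, fun k hk => ?_⟩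
  have h1 := hn k hk
  rw [Real.dist_eq, sub_zero] at h1 ⊢
  have h2 : ∫ x in (Ω : Set (Eucl N)), |φ k x| ≤
      (∫ x in (Ω : Set (Eucl N)), |φ k x - avg ρ (φ k) x|) +
        ∫ x in (Ω : Set (Eucl N)), |avg ρ (φ k) x| := by
    have hi : Integrable (avg ρ (φ k)) (volume.restrict (Ω : Set (Eucl N))) := by
      refine Integrable.of_bound
        (stronglyMeasurable_avg hρc (φ k).continuous).aestronglyMeasurable (K * (C * M))
        (ae_of_all _ (hAb k))
    have hi' : Integrable (φ k : Eucl N → ℝ) (volume.restrict (Ω : Set (Eucl N))) :=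
      (hφint k).integrableOn
    refine le_of_le_of_eq ?_ (integral_add (hi'.sub hi).abs hi.abs)
    refine integral_mono hi'.abs ((hi'.sub hi).abs.add hi.abs) fun x => ?_
    have := abs_add_le (φ k x - avg ρ (φ k) x) (avg ρ (φ k) x)
    simpa using this
  rw [heq k, abs_of_nonneg (integral_nonneg fun x => abs_nonneg _)]
  have h3 := le_abs_self (∫ x in (Ω : Set (Eucl N)), |avg ρ (φ k) x|)
  linarith [hfirst k]

/-- The Rellich-Kondrachov theorem: weak convergence in `W₀^{1,p}(Ω)` implies convergence
in `L^1`. -/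
theorem tendsto_integral_abs_sub_of_weak (q : ℝ≥0∞) [Fact (1 ≤ q)] [p.HolderConjugate q]
    (hΩ : Bornology.IsBounded (Ω : Set (Eucl N))) {y : ℕ → W0 p Ω} {y₀ : W0 p Ω} {M : ℝ}
    (hM : ∀ k, ‖y k‖ ≤ M)
    (hw : ∀ ℓ : StrongDual ℝ (W0 p Ω), Tendsto (fun k => ℓ (y k)) atTop (𝓝 (ℓ y₀))) :
    Tendsto (fun k => ∫ x, |W0.fn (y k) x - W0.fn y₀ x|) atTop (𝓝 0) := by
  obtain ⟨C, hC0, hC⟩ := exists_integral_abs_le (p := p) q hΩ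
  have hex : ∀ k : ℕ, ∃ w ∈ testJets p Ω,
      ‖((y k - y₀ : W0 p Ω) : Jet N p) - w‖ < 1 / ((k : ℝ) + 1) := by
    intro k
    obtain ⟨w, hw, hd⟩ := Metric.mem_closure_iff.1 (y k - y₀).2 (1 / ((k : ℝ) + 1)) (by positivity)
    exact ⟨w, hw, by rwa [← dist_eq_norm]⟩
  choose w hw' hd using hex
  let u : ℕ → W0 p Ω := fun k => ⟨w k, subset_closure (hw' k)⟩
  have hd' : ∀ k, ‖(y k - y₀) - u k‖ ≤ 1 / ((k : ℝ) + 1) := fun k => (hd k).le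
  have hlim0 : Tendsto (fun k : ℕ => 1 / ((k : ℝ) + 1)) atTop (𝓝 0) :=
    tendsto_one_div_add_atTop_nhds_zero_nat
  have hsm : Tendsto (fun k => (y k - y₀) - u k) atTop (𝓝 0) :=
    squeeze_zero_norm hd' hlim0
  have huw : ∀ ℓ : StrongDual ℝ (W0 p Ω), Tendsto (fun k => ℓ (u k)) atTop (𝓝 0) := by
    intro ℓ
    have h1 := ((hw ℓ).sub_const (ℓ y₀)).sub ((ℓ.continuous.tendsto 0).comp hsm)
    rw [map_zero, sub_self, sub_zero] at h1
    refine h1.congr fun k => ?_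
    simp only [Function.comp, map_sub]
    ring
  have huM : ∀ k, ‖u k‖ ≤ M + ‖y₀‖ + 1 := by
    intro k
    have h1 : u k = (y k - y₀) - ((y k - y₀) - u k) := by abel
    have h2 : 1 / ((k : ℝ) + 1) ≤ 1 := by
      rw [div_le_one (by positivity)]
      linarith [(Nat.cast_nonneg k : (0 : ℝ) ≤ k)]
    rw [h1]
    refine (norm_sub_le _ _).trans ?_
    linarith [norm_sub_le (y k) y₀, hM k, hd' k]
  have hu := tendsto_integral_abs_of_testJets q hΩ hw' huM huw
  refine squeeze_zero (fun k => integral_nonneg fun x => abs_nonneg _) (fun k => ?_)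
    (g := fun k => (∫ x, |W0.fn (u k) x|) + C * (1 / ((k : ℝ) + 1)))
    (by simpa using hu.add (hlim0.const_mul C))
  have h1 := hC ((y k - y₀) - u k) none
  have h2 := (hC (u k) none).1
  have h3 : ∫ x, |W0.fn (y k) x - W0.fn y₀ x| ≤ (∫ x, |W0.fn (u k) x|) +
      ∫ x, |(((y k - y₀) - u k : W0 p Ω) : Jet N p) none x| := by
    refine le_of_le_of_eq ?_ (integral_add h2.abs h1.1.abs)
    refine integral_mono_of_nonneg (ae_of_all _ fun x => abs_nonneg _) (h2.abs.add h1.1.abs) ?_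
    have e1 : (((y k - y₀) - u k : W0 p Ω) : Jet N p) none =
      ((y k : Jet N p) none - (y₀ : Jet N p) none) - (u k : Jet N p) none := rfl
    filter_upwards [Lp.coeFn_sub ((y k : Jet N p) none - (y₀ : Jet N p) none)
        ((u k : Jet N p) none),
      Lp.coeFn_sub ((y k : Jet N p) none) ((y₀ : Jet N p) none)] with x h4 h5
    rw [e1, h4, Pi.sub_apply, h5, Pi.sub_apply]
    have := abs_add_le (W0.fn (u k) x) (W0.fn (y k) x - W0.fn y₀ x - W0.fn (u k) x)
    rw [add_sub_cancel] at this
    exact this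
  refine h3.trans (add_le_add le_rfl (h1.2.trans ?_))
  gcongr
  exact hd' k

end Rellich

theorem tendsto_of_dense_of_lipschitz {E : Type*} [NormedAddCommGroup E] {S : Set E}
    (hS : Dense S) {T : ℕ → E → ℝ} {T₀ : E → ℝ} {K : ℝ}
    (hT : ∀ k u v, |T k u - T k v| ≤ K * ‖u - v‖) (hT₀ : ∀ u v, |T₀ u - T₀ v| ≤ K * ‖u - v‖)
    (h : ∀ u ∈ S, Tendsto (fun k => T k u) atTop (𝓝 (T₀ u))) (u : E) :
    Tendsto (fun k => T k u) atTop (𝓝 (T₀ u)) := by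
  rw [Metric.tendsto_atTop]
  intro ε hε
  obtain ⟨v, hv, huv⟩ := Metric.dense_iff.1 hS u (ε / (3 * (|K| + 1))) (by positivity)
  rw [Metric.mem_ball, dist_comm, dist_eq_norm, lt_div_iff₀ (by positivity)] at hv
  obtain ⟨n, hn⟩ := Metric.tendsto_atTop.1 (h v huv) (ε / 3) (by positivity)
  refine ⟨n, fun k hk => ?_⟩
  have h1 := hn k hk
  have h2 := hT k u v
  have h3 := hT₀ u v
  have h4 : K * ‖u - v‖ ≤ |K| * ‖u - v‖ := by
    gcongr
    exact le_abs_self K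
  have h5 : |K| * ‖u - v‖ < ε / 3 := by
    have := norm_nonneg (u - v)
    nlinarith
  rw [Real.dist_eq] at h1 ⊢
  rw [abs_le] at h2 h3
  rw [abs_lt] at h1 ⊢
  constructor <;> linarith [h1.1, h1.2, h2.1, h2.2, h3.1, h3.2]

theorem tendsto_dual_apply {E : Type*} [NormedAddCommGroup E] [NormedSpace ℝ E]
    {ℓ : ℕ → StrongDual ℝ E} {ℓ₀ : StrongDual ℝ E} (hℓ : Tendsto ℓ atTop (𝓝 ℓ₀)) {x : ℕ → E}
    {x₀ : E} {M : ℝ} (hM : ∀ k, ‖x k‖ ≤ M) (hx : Tendsto (fun k => ℓ₀ (x k)) atTop (𝓝 (ℓ₀ x₀))) :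
    Tendsto (fun k => ℓ k (x k)) atTop (𝓝 (ℓ₀ x₀)) := by
  have h : Tendsto (fun k => (ℓ k - ℓ₀) (x k)) atTop (𝓝 0) := by
    have hn := (tendsto_iff_norm_sub_tendsto_zero.1 hℓ).mul_const M
    rw [zero_mul] at hn
    refine squeeze_zero_norm (fun k => ?_) hn
    refine ((ℓ k - ℓ₀).le_opNorm _).trans ?_
    gcongr
    exact hM k
  have h' := h.add hx
  rw [zero_add] at h'
  refine h'.congr fun k => ?_
  simp

section WeakStar

variable {N : ℕ} {D : Opens (Eucl N)}

/-- Weak-* convergence in `L^∞(D)`. -/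
def TendstoWeakStar (a : ℕ → LSp ∞ D) (a₀ : LSp ∞ D) : Prop :=
  ∀ v : LSp 1 D, Tendsto (fun k => ∫ x in (D : Set (Eucl N)), a k x * v x) atTop
    (𝓝 (∫ x in (D : Set (Eucl N)), a₀ x * v x))

theorem TendstoWeakStar.tendsto_integral {a : ℕ → LSp ∞ D} {a₀ : LSp ∞ D}
    (h : TendstoWeakStar a a₀) {v : Eucl N → ℝ}
    (hv : Integrable v (volume.restrict (D : Set (Eucl N)))) :
    Tendsto (fun k => ∫ x in (D : Set (Eucl N)), a k x * v x) atTop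
      (𝓝 (∫ x in (D : Set (Eucl N)), a₀ x * v x)) := by
  have hv1 : MemLp v 1 (volume.restrict (D : Set (Eucl N))) := memLp_one_iff_integrable.2 hv
  have h1 := h (hv1.toLp v)
  have h2 : ∀ b : LSp ∞ D, ∫ x in (D : Set (Eucl N)), b x * (hv1.toLp v : Eucl N → ℝ) x =
      ∫ x in (D : Set (Eucl N)), b x * v x := by
    intro b
    refine integral_congr_ae ?_
    filter_upwards [hv1.coeFn_toLp] with x hx
    rw [hx]
  simpa only [h2] using h1

/-- A weak-* limit of combinations bounded below is bounded below. -/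
theorem ae_le_sum_of_tendstoWeakStar [IsFiniteMeasure (volume.restrict (D : Set (Eucl N)))]
    {ι : Type*} [Fintype ι] {a : ℕ → ι → LSp ∞ D}
    {a₀ : ι → LSp ∞ D} (h : ∀ i, TendstoWeakStar (fun k => a k i) (a₀ i)) (c : ι → ℝ)
    {b : Eucl N → ℝ} (hb : Integrable b (volume.restrict (D : Set (Eucl N))))
    (hle : ∀ k, ∀ᵐ x ∂(volume.restrict (D : Set (Eucl N))), b x ≤ ∑ i, a k i x * c i) :
    ∀ᵐ x ∂(volume.restrict (D : Set (Eucl N))), b x ≤ ∑ i, a₀ i x * c i := by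
  have hint : ∀ (u : LSp ∞ D) (r : ℝ),
      Integrable (fun x => u x * r) (volume.restrict (D : Set (Eucl N))) := fun u r =>
    ((Lp.memLp u).integrable le_top).mul_const r
  refine ae_le_of_forall_setIntegral_le hb (integrable_finsetSum _ fun i _ => hint _ _)
    fun s hs _ => ?_
  have hlim : Tendsto (fun k => ∫ x in s, ∑ i, a k i x * c i ∂(volume.restrict (D : Set (Eucl N))))
      atTop (𝓝 (∫ x in s, ∑ i, a₀ i x * c i ∂(volume.restrict (D : Set (Eucl N))))) := by
    have h1 : ∀ u : ι → LSp ∞ D,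
        ∫ x in s, ∑ i, u i x * c i ∂(volume.restrict (D : Set (Eucl N))) =
        ∑ i, ∫ x in (D : Set (Eucl N)), u i x * s.indicator (fun _ => c i) x := by
      intro u
      rw [integral_finsetSum _ fun i _ => (hint _ _).integrableOn]
      refine Finset.sum_congr rfl fun i _ => ?_
      rw [← integral_indicator hs]
      refine integral_congr_ae (ae_of_all _ fun x => ?_)
      by_cases hx : x ∈ s <;> simp [hx]
    simp only [h1]
    refine tendsto_finsetSum _ fun i _ => (h i).tendsto_integral ?_
    exact (integrable_const (c i)).indicator hs
  refine ge_of_tendsto' hlim fun k => ?_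
  exact setIntegral_mono_ae hb.integrableOn
    (integrable_finsetSum _ fun i _ => hint _ _).integrableOn (hle k)

end WeakStar

section DivCurl

open scoped ContDiff

variable {N : ℕ} {p : ℝ≥0∞} [Fact (1 ≤ p)] {D : Opens (Eucl N)}

theorem memLp_top_control (a : LSp ⊤ D) : MemLp a ⊤ (volume.restrict (D : Set (Eucl N))) :=
  Lp.memLp a

theorem memLp_jet (y : W0 p D) (o : Option (Fin N)) (s : Set (Eucl N)) :
    MemLp ((y : Jet N p) o) p (volume.restrict s) :=
  (Lp.memLp _).mono_measure Measure.restrict_le_self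

theorem abs_setIntegral_mul_mul_le (q : ℝ≥0∞) [Fact (1 ≤ q)] [p.HolderConjugate q] {a : Eucl N → ℝ}
    {β : ℝ} (hβ : ∀ᵐ x ∂(volume.restrict (D : Set (Eucl N))), |a x| ≤ β) (hβ0 : 0 ≤ β)
    (g : Lp ℝ p (volume : Measure (Eucl N))) (r : Lp ℝ q (volume : Measure (Eucl N))) :
    |∫ x in (D : Set (Eucl N)), a x * g x * r x| ≤ β * ‖g‖ * ‖r‖ := by
  have hint : Integrable (fun x => |r x| * |g x|) (volume : Measure (Eucl N)) :=
    integrable_mul_of_memLp (Lp.memLp r).abs (Lp.memLp g).abs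
  calc |∫ x in (D : Set (Eucl N)), a x * g x * r x|
      ≤ ∫ x in (D : Set (Eucl N)), β * (|r x| * |g x|) := by
        rw [← Real.norm_eq_abs]
        refine norm_integral_le_of_norm_le (hint.const_mul β).integrableOn ?_
        filter_upwards [hβ] with x hx
        rw [Real.norm_eq_abs, abs_mul, abs_mul, mul_assoc, mul_comm |g x|]
        gcongr
    _ ≤ ∫ x, β * (|r x| * |g x|) :=
        setIntegral_le_integral (hint.const_mul β) (ae_of_all _ fun x => by positivity)
    _ = β * ∫ x, (|r| : Lp ℝ q volume) x * (|g| : Lp ℝ p volume) x := by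
        rw [integral_const_mul]
        congr 1
        refine integral_congr_ae ?_
        filter_upwards [Lp.coeFn_abs r, Lp.coeFn_abs g] with x h1 h2
        rw [h1, h2]
    _ ≤ β * (‖r‖ * ‖g‖) := by
        have := (le_abs_self _).trans (abs_integral_mul_le (|r| : Lp ℝ q volume) |g|)
        rw [norm_abs_eq_norm, norm_abs_eq_norm] at this
        gcongr
    _ = β * ‖g‖ * ‖r‖ := by ring

variable {a : ℕ → Fin N → LSp ⊤ D} {a₀ : Fin N → LSp ⊤ D} {ℓ : ℕ → WNeg p D} {ℓ₀ : WNeg p D}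

theorem integrable_control_mul (q : ℝ≥0∞) [Fact (1 ≤ q)] [p.HolderConjugate q] (b : LSp ⊤ D)
    (y : W0 p D) (o : Option (Fin N)) {ψ : Eucl N → ℝ} (hψ : MemLp ψ q volume) :
    Integrable (fun x => b x * (y : Jet N p) o x * ψ x)
      (volume.restrict (D : Set (Eucl N))) := by
  have := integrable_mul_mul_of_memLp (p := p) (q := q) (memLp_top_control b)
    (hψ.mono_measure Measure.restrict_le_self) (memLp_jet y o (D : Set (Eucl N)))
  refine this.congr (ae_of_all _ fun x => ?_)
  ring

theorem IsDivergence.of_tendsto (q : ℝ≥0∞) [Fact (1 ≤ q)] [p.HolderConjugate q]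
    (hD : Bornology.IsBounded (D : Set (Eucl N)))
    (ha : ∀ j, TendstoWeakStar (fun k => a k j) (a₀ j)) (hℓ : Tendsto ℓ atTop (𝓝 ℓ₀))
    (hdiv : ∀ k, IsDivergence (a k) (ℓ k)) : IsDivergence a₀ ℓ₀ := by
  obtain ⟨C, -, hC⟩ := exists_integral_abs_le (p := p) q hD
  intro φ
  have hi : ∀ j, Integrable (W0.grad φ j) (volume.restrict (D : Set (Eucl N))) := fun j =>
    (hC φ (some j)).1.integrableOn
  have hi' : ∀ (b : LSp ⊤ D) j, Integrable (fun x => b x * W0.grad φ j x)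
      (volume.restrict (D : Set (Eucl N))) := fun b j =>
    (memLp_one_iff_integrable.1 ((memLp_one_iff_integrable.2 (hi j)).mul' (memLp_top_control b)))
  have h1 : Tendsto (fun k => ℓ k φ) atTop (𝓝 (ℓ₀ φ)) :=
    ((ContinuousLinearMap.apply ℝ ℝ φ).continuous.tendsto ℓ₀).comp hℓ
  refine tendsto_nhds_unique h1 ?_
  simp only [fun k => hdiv k φ]
  refine Tendsto.neg ?_
  simp only [fun b : Fin N → LSp ⊤ D => integral_finsetSum Finset.univ fun j _ => hi' (b j) j]
  exact tendsto_finsetSum _ fun j _ => (ha j).tendsto_integral (hi j)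

/-- The div-curl lemma, for smooth test functions. -/
theorem tendsto_integral_divCurl_of_test (q : ℝ≥0∞) [Fact (1 ≤ q)] [p.HolderConjugate q]
    (hD : Bornology.IsBounded (D : Set (Eucl N))) {β : ℝ} (hβ0 : 0 ≤ β)
    (hβ : ∀ k j, ∀ᵐ x ∂(volume.restrict (D : Set (Eucl N))), |a k j x| ≤ β)
    (ha : ∀ j, TendstoWeakStar (fun k => a k j) (a₀ j)) (hℓ : Tendsto ℓ atTop (𝓝 ℓ₀))
    (hdiv : ∀ k, IsDivergence (a k) (ℓ k)) {y : ℕ → W0 p D} {y₀ : W0 p D} {M : ℝ}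
    (hM : ∀ k, ‖y k‖ ≤ M)
    (hw : ∀ ℓ : StrongDual ℝ (W0 p D), Tendsto (fun k => ℓ (y k)) atTop (𝓝 (ℓ y₀)))
    {ψ : Eucl N → ℝ} (hψ : ContDiff ℝ ∞ ψ) (hψc : HasCompactSupport ψ) :
    Tendsto (fun k => ∑ j, ∫ x in (D : Set (Eucl N)), a k j x * W0.grad (y k) j x * ψ x) atTop
      (𝓝 (∑ j, ∫ x in (D : Set (Eucl N)), a₀ j x * W0.grad y₀ j x * ψ x)) := by
  obtain ⟨T, hT⟩ := exists_mul_W0 (p := p) (Ω := D) hψ hψc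
  have hψq := memLp_of_test hψ hψc q
  have hψ' := fun j : Fin N => memLp_fderiv_of_test hψ hψc (EuclideanSpace.single j 1) q
  have key : ∀ (b : Fin N → LSp ⊤ D) (m : WNeg p D) (v : W0 p D), IsDivergence b m →
      ∑ j, ∫ x in (D : Set (Eucl N)), b j x * W0.grad v j x * ψ x = -m (T v) -
        ∑ j, ∫ x in (D : Set (Eucl N)),
          b j x * W0.fn v x * fderiv ℝ ψ x (EuclideanSpace.single j 1) := by
    intro b m v hb
    have h1 : ∀ j, Integrable (fun x => b j x * W0.grad v j x * ψ x)
        (volume.restrict (D : Set (Eucl N))) := fun j =>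
      integrable_control_mul q (b j) v (some j) hψq
    have h2 : ∀ j, Integrable (fun x => b j x * W0.fn v x *
        fderiv ℝ ψ x (EuclideanSpace.single j 1)) (volume.restrict (D : Set (Eucl N))) := fun j =>
      integrable_control_mul q (b j) v none (hψ' j)
    rw [hb (T v), neg_neg, eq_sub_iff_add_eq, ← integral_finsetSum _ fun j _ => h1 j,
      ← integral_finsetSum _ fun j _ => h2 j, ← integral_add
        (integrable_finsetSum _ fun j _ => h1 j) (integrable_finsetSum _ fun j _ => h2 j)]
    refine integral_congr_ae ?_
    have hall : ∀ᵐ x ∂(volume.restrict (D : Set (Eucl N))), ∀ j, W0.grad (T v) j x =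
        ψ x * W0.grad v j x + fderiv ℝ ψ x (EuclideanSpace.single j 1) * W0.fn v x :=
      ae_all_iff.2 fun j => ae_restrict_of_ae (hT v j)
    filter_upwards [hall] with x hx
    rw [← Finset.sum_add_distrib]
    refine Finset.sum_congr rfl fun j _ => ?_
    rw [hx j]
    ring
  have hlim1 : Tendsto (fun k => ℓ k (T (y k))) atTop (𝓝 (ℓ₀ (T y₀))) := by
    refine tendsto_dual_apply (M := ‖T‖ * M) hℓ (fun k => ?_) (hw (ℓ₀.comp T))
    refine (T.le_opNorm _).trans ?_
    gcongr
    exact hM k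
  have hrel := tendsto_integral_abs_sub_of_weak q hD hM hw
  obtain ⟨C, -, hC⟩ := exists_integral_abs_le (p := p) q hD
  have hlim2 : ∀ j, Tendsto (fun k => ∫ x in (D : Set (Eucl N)),
      a k j x * W0.fn (y k) x * fderiv ℝ ψ x (EuclideanSpace.single j 1)) atTop
      (𝓝 (∫ x in (D : Set (Eucl N)),
        a₀ j x * W0.fn y₀ x * fderiv ℝ ψ x (EuclideanSpace.single j 1))) := by
    intro j
    obtain ⟨K, hK⟩ := (fderiv_apply_contDiff hψ (EuclideanSpace.single j 1)
      ).continuous.bounded_above_of_compact_support (fderiv_apply_hasCompactSupport hψc _)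
    have hK0 : 0 ≤ K := (norm_nonneg _).trans (hK 0)
    have hv : Integrable (fun x => W0.fn y₀ x * fderiv ℝ ψ x (EuclideanSpace.single j 1))
        (volume.restrict (D : Set (Eucl N))) := by
      have := integrable_mul_of_memLp (p := p) (q := q)
        ((hψ' j).mono_measure Measure.restrict_le_self) (memLp_jet y₀ none (D : Set (Eucl N)))
      refine this.congr (ae_of_all _ fun x => ?_)
      exact mul_comm _ _
    have h1 := (ha j).tendsto_integral hv
    have h2 : Tendsto (fun k => ∫ x in (D : Set (Eucl N)), a k j x *
        (W0.fn (y k) x - W0.fn y₀ x) * fderiv ℝ ψ x (EuclideanSpace.single j 1)) atTop (𝓝 0) := by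
      have hn : Tendsto (fun k => β * K * ∫ x, |W0.fn (y k) x - W0.fn y₀ x|) atTop (𝓝 0) := by
        have := hrel.const_mul (β * K)
        rwa [mul_zero] at this
      refine squeeze_zero_norm (fun k => ?_) hn
      have hi : Integrable (fun x => |W0.fn (y k) x - W0.fn y₀ x|) volume :=
        ((hC (y k) none).1.sub (hC y₀ none).1).abs
      rw [← integral_const_mul]
      refine (norm_integral_le_of_norm_le (hi.const_mul (β * K)).integrableOn ?_).trans
        (setIntegral_le_integral (hi.const_mul (β * K)) (ae_of_all _ fun x => by positivity))
      filter_upwards [hβ k j] with x hx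
      rw [norm_mul, norm_mul, Real.norm_eq_abs (a k j x),
        Real.norm_eq_abs (W0.fn (y k) x - W0.fn y₀ x)]
      calc |a k j x| * |W0.fn (y k) x - W0.fn y₀ x| *
            ‖fderiv ℝ ψ x (EuclideanSpace.single j 1)‖
          ≤ β * |W0.fn (y k) x - W0.fn y₀ x| * K := by
            gcongr
            exact hK x
        _ = β * K * |W0.fn (y k) x - W0.fn y₀ x| := by ring
    have h3 := h2.add h1
    rw [zero_add] at h3
    have he : ∫ x in (D : Set (Eucl N)), a₀ j x *
        (W0.fn y₀ x * fderiv ℝ ψ x (EuclideanSpace.single j 1)) = ∫ x in (D : Set (Eucl N)),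
          a₀ j x * W0.fn y₀ x * fderiv ℝ ψ x (EuclideanSpace.single j 1) := by
      simp only [mul_assoc]
    rw [he] at h3
    refine h3.congr fun k => ?_
    have hi1 := integrable_control_mul q (a k j) (y k) none (hψ' j)
    have hi2 := integrable_control_mul q (a k j) y₀ none (hψ' j)
    have hi3 : Integrable (fun x => a k j x * (W0.fn (y k) x - W0.fn y₀ x) *
        fderiv ℝ ψ x (EuclideanSpace.single j 1)) (volume.restrict (D : Set (Eucl N))) := by
      refine (hi1.sub hi2).congr (ae_of_all _ fun x => ?_)
      simp only [Pi.sub_apply, W0.fn]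
      ring
    have hi4 : Integrable (fun x => a k j x * (W0.fn y₀ x *
        fderiv ℝ ψ x (EuclideanSpace.single j 1))) (volume.restrict (D : Set (Eucl N))) := by
      refine hi2.congr (ae_of_all _ fun x => ?_)
      simp only [W0.fn]
      ring
    rw [← integral_add hi3 hi4]
    refine integral_congr_ae (ae_of_all _ fun x => ?_)
    simp only
    ring
  rw [key a₀ ℓ₀ y₀ (IsDivergence.of_tendsto q hD ha hℓ hdiv)]
  simp only [fun k => key (a k) (ℓ k) (y k) (hdiv k)]
  exact hlim1.neg.sub (tendsto_finsetSum _ fun j _ => hlim2 j)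

/-- The div-curl lemma: if `a k` converges weakly-*, with divergences converging in `W^{-1,q}(D)`,
and `y k` converges weakly in `W₀^{1,p}(D)`, then `(a k, ∇(y k))` converges weakly in `L^p`. -/
theorem tendsto_integral_divCurl (q : ℝ≥0∞) [Fact (1 ≤ q)] [p.HolderConjugate q] (hq : q ≠ ⊤)
    (hD : Bornology.IsBounded (D : Set (Eucl N))) {β : ℝ} (hβ0 : 0 ≤ β)
    (hβ : ∀ k j, ∀ᵐ x ∂(volume.restrict (D : Set (Eucl N))), |a k j x| ≤ β)
    (hβ₀ : ∀ j, ∀ᵐ x ∂(volume.restrict (D : Set (Eucl N))), |a₀ j x| ≤ β)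
    (ha : ∀ j, TendstoWeakStar (fun k => a k j) (a₀ j)) (hℓ : Tendsto ℓ atTop (𝓝 ℓ₀))
    (hdiv : ∀ k, IsDivergence (a k) (ℓ k)) {y : ℕ → W0 p D} {y₀ : W0 p D} {M : ℝ}
    (hM : ∀ k, ‖y k‖ ≤ M)
    (hw : ∀ ℓ : StrongDual ℝ (W0 p D), Tendsto (fun k => ℓ (y k)) atTop (𝓝 (ℓ y₀)))
    {ψ : Eucl N → ℝ} (hψ : MemLp ψ q volume) :
    Tendsto (fun k => ∑ j, ∫ x in (D : Set (Eucl N)), a k j x * W0.grad (y k) j x * ψ x) atTop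
      (𝓝 (∑ j, ∫ x in (D : Set (Eucl N)), a₀ j x * W0.grad y₀ j x * ψ x)) := by
  let T : (Fin N → LSp ⊤ D) → W0 p D → Lp ℝ q (volume : Measure (Eucl N)) → ℝ := fun b v r =>
    ∑ j, ∫ x in (D : Set (Eucl N)), b j x * W0.grad v j x * r x
  have hT : ∀ (b : Fin N → LSp ⊤ D) (v : W0 p D) (L : ℝ),
      (∀ j, ∀ᵐ x ∂(volume.restrict (D : Set (Eucl N))), |b j x| ≤ β) → ‖v‖ ≤ L →
      ∀ r r', |T b v r - T b v r'| ≤ N * (β * L) * ‖r - r'‖ := by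
    intro b v L hb hv r r'
    simp only [T]
    rw [← Finset.sum_sub_distrib]
    refine (Finset.abs_sum_le_sum_abs _ _).trans ?_
    have : ∀ j ∈ Finset.univ, |(∫ x in (D : Set (Eucl N)), b j x * W0.grad v j x * r x) -
        ∫ x in (D : Set (Eucl N)), b j x * W0.grad v j x * r' x| ≤ β * L * ‖r - r'‖ := by
      intro j _
      have hi : ∀ r : Lp ℝ q (volume : Measure (Eucl N)), Integrable
          (fun x => b j x * W0.grad v j x * r x) (volume.restrict (D : Set (Eucl N))) := fun r =>
        integrable_control_mul q (b j) v (some j) (Lp.memLp r)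
      rw [← integral_sub (hi r) (hi r')]
      have h1 := abs_setIntegral_mul_mul_le q (hb j) hβ0 ((v : Jet N p) (some j)) (r - r')
      have h2 : ∫ x in (D : Set (Eucl N)),
          b j x * (v : Jet N p) (some j) x * (r - r' : Lp ℝ q _) x =
          ∫ x in (D : Set (Eucl N)),
            (b j x * W0.grad v j x * r x - b j x * W0.grad v j x * r' x) := by
        refine integral_congr_ae ?_
        filter_upwards [ae_restrict_of_ae (Lp.coeFn_sub r r')] with x hx
        rw [hx, Pi.sub_apply, mul_sub]
        rfl
      rw [h2] at h1
      refine h1.trans ?_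
      gcongr
      exact (norm_jet_apply_le _ _).trans hv
    refine (Finset.sum_le_sum this).trans (le_of_eq ?_)
    rw [Finset.sum_const, Finset.card_univ, Fintype.card_fin, nsmul_eq_mul]
    ring
  have hmain := tendsto_of_dense_of_lipschitz
    (Lp.dense_hasCompactSupport_contDiff (F := ℝ) (μ := (volume : Measure (Eucl N))) hq)
    (T := fun k => T (a k) (y k)) (T₀ := T a₀ y₀) (K := N * (β * max M ‖y₀‖))
    (fun k => hT _ _ _ (hβ k) ((hM k).trans (le_max_left _ _)))
    (hT _ _ _ hβ₀ (le_max_right _ _)) ?_ (hψ.toLp ψ)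
  · have he : ∀ b v, T b v (hψ.toLp ψ) =
        ∑ j, ∫ x in (D : Set (Eucl N)), b j x * W0.grad v j x * ψ x := by
      intro b v
      refine Finset.sum_congr rfl fun j _ => integral_congr_ae ?_
      filter_upwards [ae_restrict_of_ae hψ.coeFn_toLp] with x hx
      rw [hx]
    simpa only [he] using hmain
  · rintro r ⟨g, hrg, hgc, hg⟩
    have he : ∀ b v, T b v r = ∑ j, ∫ x in (D : Set (Eucl N)), b j x * W0.grad v j x * g x := by
      intro b v
      refine Finset.sum_congr rfl fun j _ => integral_congr_ae ?_
      filter_upwards [ae_restrict_of_ae hrg] with x hx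
      rw [hx]
    simp only [he]
    exact tendsto_integral_divCurl_of_test q hD hβ0 hβ ha hℓ hdiv hM hw hg hgc

end DivCurl

section Flux

variable {N : ℕ} {p : ℝ≥0∞}

theorem flux_eq_sum_prod (A : Fin N → Fin N → ℝ) (ζ η : Fin N → ℝ) :
    flux p A ζ η = ∑ e : Fin N × Fin N, A e.1 e.2 * (powMap p (ζ e.2) * η e.1) := by
  simp only [flux, Fintype.sum_prod_type, mul_assoc]

theorem flux_sub_flux_eq_sum_prod (A : Fin N → Fin N → ℝ) (ζ ζ' η : Fin N → ℝ) :
    flux p A ζ η - flux p A ζ' η =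
      ∑ e : Fin N × Fin N, A e.1 e.2 * ((powMap p (ζ e.2) - powMap p (ζ' e.2)) * η e.1) := by
  rw [flux_eq_sum_prod, flux_eq_sum_prod, ← Finset.sum_sub_distrib]
  exact Finset.sum_congr rfl fun e _ => by ring

theorem flux_sub (A : Fin N → Fin N → ℝ) (ζ η η' : Fin N → ℝ) :
    flux p A ζ (η - η') = flux p A ζ η - flux p A ζ η' := by
  simp only [flux, Pi.sub_apply, mul_sub, Finset.sum_sub_distrib]

theorem flux_smul (A : Fin N → Fin N → ℝ) (ζ η : Fin N → ℝ) (c : ℝ) :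
    flux p A ζ (c • η) = c * flux p A ζ η := by
  simp only [flux, Pi.smul_apply, smul_eq_mul, Finset.mul_sum]
  exact Finset.sum_congr rfl fun i _ => Finset.sum_congr rfl fun j _ => by ring

theorem continuous_flux (h2 : 2 ≤ p.toReal) (A : Fin N → Fin N → ℝ) {X : Type*}
    [TopologicalSpace X] {f g : X → Fin N → ℝ} (hf : Continuous f) (hg : Continuous g) :
    Continuous fun x => flux p A (f x) (g x) := by
  unfold flux
  refine continuous_finsetSum _ fun i _ => continuous_finsetSum _ fun j _ => ?_
  exact (continuous_const.mul ((continuous_powMap h2).comp ((continuous_apply j).comp hf))).mul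
    ((continuous_apply i).comp hg)

end Flux

section ControlsClosed

variable {N : ℕ} {p : ℝ≥0∞} {D : Opens (Eucl N)}

theorem ae_le_mul_of_tendstoWeakStar [IsFiniteMeasure (volume.restrict (D : Set (Eucl N)))]
    {a : ℕ → LSp ∞ D} {a₀ : LSp ∞ D} (h : TendstoWeakStar a a₀) (c : ℝ)
    {b : Eucl N → ℝ} (hb : Integrable b (volume.restrict (D : Set (Eucl N))))
    (hle : ∀ k, ∀ᵐ x ∂(volume.restrict (D : Set (Eucl N))), b x ≤ a k x * c) :
    ∀ᵐ x ∂(volume.restrict (D : Set (Eucl N))), b x ≤ a₀ x * c := by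
  have := ae_le_sum_of_tendstoWeakStar (ι := Unit) (a := fun k _ => a k) (a₀ := fun _ => a₀)
    (fun _ => h) (fun _ => c) hb (by simpa using hle)
  simpa using this

variable [IsFiniteMeasure (volume.restrict (D : Set (Eucl N)))] {α β : ℝ}
  {U : ℕ → Control D} {U₀ : Control D}

/-- The class `M_p^{α,β}(D)` is sequentially weakly-* closed. -/
theorem IsMClass.of_tendsto (h2 : 2 ≤ p.toReal)
    (hw : ∀ i j, TendstoWeakStar (fun k => U k i j) (U₀ i j))
    (hU : ∀ k, IsMClass p α β (U k)) : IsMClass p α β U₀ where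
  symm := by
    have key : ∀ i j, ∀ᵐ x ∂(volume.restrict (D : Set (Eucl N))), U₀ j i x ≤ U₀ i j x := by
      intro i j
      have := ae_le_sum_of_tendstoWeakStar (ι := Fin 2) (a := fun k => ![U k i j, U k j i])
        (a₀ := ![U₀ i j, U₀ j i]) (fun e => by
          fin_cases e
          · exact hw i j
          · exact hw j i) ![1, -1] (b := fun _ => 0) (integrable_const 0) (fun k => by
          refine ae_of_all _ fun x => ?_
          simp [Fin.sum_univ_two, (hU k).symm i j])
      filter_upwards [this] with x hx
      simp only [Fin.sum_univ_two, Matrix.cons_val_zero, Matrix.cons_val_one, mul_one,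
        mul_neg] at hx
      linarith
    intro i j
    refine Lp.ext ?_
    filter_upwards [key i j, key j i] with x h h'
    exact le_antisymm h' h
  growth := by
    intro i j
    have h1 := ae_le_mul_of_tendstoWeakStar (hw i j) 1 (integrable_const (-β)) (fun k => by
      filter_upwards [(hU k).growth i j] with x hx
      rw [mul_one]
      exact (abs_le.1 hx).1)
    have h3 := ae_le_mul_of_tendstoWeakStar (hw i j) (-1) (integrable_const (-β)) (fun k => by
      filter_upwards [(hU k).growth i j] with x hx
      linarith [(abs_le.1 hx).2])
    filter_upwards [h1, h3] with x hx hx'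
    exact abs_le.2 ⟨by linarith, by linarith⟩
  monotone := by
    have key : ∀ n : ℕ, ∀ᵐ x ∂(volume.restrict (D : Set (Eucl N))),
        0 ≤ flux p (fun i j => U₀ i j x) (denseSeq ((Fin N → ℝ) × (Fin N → ℝ)) n).1
            ((denseSeq ((Fin N → ℝ) × (Fin N → ℝ)) n).1 -
              (denseSeq ((Fin N → ℝ) × (Fin N → ℝ)) n).2) -
          flux p (fun i j => U₀ i j x) (denseSeq ((Fin N → ℝ) × (Fin N → ℝ)) n).2
            ((denseSeq ((Fin N → ℝ) × (Fin N → ℝ)) n).1 -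
              (denseSeq ((Fin N → ℝ) × (Fin N → ℝ)) n).2) := by
      intro n
      generalize denseSeq ((Fin N → ℝ) × (Fin N → ℝ)) n = z
      simp only [flux_sub_flux_eq_sum_prod]
      refine ae_le_sum_of_tendstoWeakStar (a := fun k (e : Fin N × Fin N) => U k e.1 e.2)
        (a₀ := fun e => U₀ e.1 e.2) (fun e => hw e.1 e.2) _ (integrable_const 0) fun k => ?_
      filter_upwards [(hU k).monotone] with x hx
      have := hx z.1 z.2
      rwa [flux_sub_flux_eq_sum_prod] at this
    filter_upwards [ae_all_iff.2 key] with x hx ζ η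
    refine (denseRange_denseSeq ((Fin N → ℝ) × (Fin N → ℝ))).induction_on
      (p := fun z => 0 ≤ flux p (fun i j => U₀ i j x) z.1 (z.1 - z.2) -
        flux p (fun i j => U₀ i j x) z.2 (z.1 - z.2)) (ζ, η) ?_ hx
    exact isClosed_le continuous_const
      ((continuous_flux h2 _ continuous_fst (continuous_fst.sub continuous_snd)).sub
        (continuous_flux h2 _ continuous_snd (continuous_fst.sub continuous_snd)))
  coercive := by
    have key : ∀ n : ℕ, ∀ᵐ x ∂(volume.restrict (D : Set (Eucl N))),
        α * ∑ k, |denseSeq (Fin N → ℝ) n k| ^ p.toReal ≤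
          flux p (fun i j => U₀ i j x) (denseSeq (Fin N → ℝ) n) (denseSeq (Fin N → ℝ) n) := by
      intro n
      generalize denseSeq (Fin N → ℝ) n = ζ
      simp only [flux_eq_sum_prod]
      refine ae_le_sum_of_tendstoWeakStar (a := fun k (e : Fin N × Fin N) => U k e.1 e.2)
        (a₀ := fun e => U₀ e.1 e.2) (fun e => hw e.1 e.2) _ (integrable_const _) fun k => ?_
      filter_upwards [(hU k).coercive] with x hx
      have := hx ζ
      rwa [flux_eq_sum_prod] at this
    filter_upwards [ae_all_iff.2 key] with x hx ζ
    refine (denseRange_denseSeq (Fin N → ℝ)).induction_on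
      (p := fun ζ => α * ∑ k, |ζ k| ^ p.toReal ≤ flux p (fun i j => U₀ i j x) ζ ζ) ζ ?_ hx
    refine isClosed_le (continuous_const.mul (continuous_finsetSum _ fun i _ => ?_))
      (continuous_flux h2 _ continuous_id continuous_id)
    exact (continuous_abs.comp (continuous_apply i)).rpow_const fun _ => Or.inr (by linarith)

theorem mem_boundedControls_of_tendsto (h2 : 2 ≤ p.toReal) {ξ₁ ξ₂ : LSp ∞ D}
    (hw : ∀ i j, TendstoWeakStar (fun k => U k i j) (U₀ i j))
    (hU : ∀ k, U k ∈ boundedControls p α β ξ₁ ξ₂) : U₀ ∈ boundedControls p α β ξ₁ ξ₂ := by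
  refine ⟨IsMClass.of_tendsto h2 hw fun k => (hU k).1, fun i j => ?_⟩
  have hi : ∀ ξ : LSp ∞ D, Integrable ξ (volume.restrict (D : Set (Eucl N))) := fun ξ =>
    (Lp.memLp ξ).integrable le_top
  have h1 := ae_le_mul_of_tendstoWeakStar (hw i j) 1 (hi ξ₁) (fun k => by
    filter_upwards [(hU k).2 i j] with x hx
    linarith [hx.1])
  have h3 := ae_le_mul_of_tendstoWeakStar (hw i j) (-1) (b := fun x => -ξ₂ x) (hi ξ₂).neg
    (fun k => by
      filter_upwards [(hU k).2 i j] with x hx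
      linarith [hx.2])
  filter_upwards [h1, h3] with x hx hx'
  exact ⟨by linarith, by linarith⟩

end ControlsClosed

section Solenoidal

theorem exists_subseq_tendsto_of_isCompact {ι : Type*} [Finite ι] {E : Type*}
    [NormedAddCommGroup E] {Q : ι → Set E} (hQ : ∀ i, IsCompact (Q i)) {x : ℕ → ι → E}
    (hx : ∀ k i, x k i ∈ Q i) :
    ∃ (φ : ℕ → ℕ) (x₀ : ι → E), StrictMono φ ∧ (∀ i, x₀ i ∈ Q i) ∧
      ∀ i, Tendsto (fun k => x (φ k) i) atTop (𝓝 (x₀ i)) := by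
  have := Fintype.ofFinite ι
  obtain ⟨x₀, hx₀, φ, hφ, h⟩ := (isCompact_univ_pi hQ).tendsto_subseq
    (x := x) (fun k i _ => hx k i)
  exact ⟨φ, x₀, hφ, fun i => hx₀ i (mem_univ i), fun i => tendsto_pi_nhds.1 h i⟩

variable {N : ℕ} {p : ℝ≥0∞} [Fact (1 ≤ p)] {D : Opens (Eucl N)} {α β : ℝ}
  {Q : Fin N → Set (WNeg p D)}

/-- Along a subsequence, the divergences of the columns of solenoidal controls converge. -/
theorem exists_subseq_tendsto_divergence (hQ : ∀ i, IsCompact (Q i)) {U : ℕ → Control D}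
    (hU : ∀ k, U k ∈ solenoidalControls p α β Q) :
    ∃ (φ : ℕ → ℕ) (ℓ : ℕ → Fin N → WNeg p D) (ℓ₀ : Fin N → WNeg p D), StrictMono φ ∧
      (∀ i, ℓ₀ i ∈ Q i) ∧ (∀ i, Tendsto (fun k => ℓ k i) atTop (𝓝 (ℓ₀ i))) ∧
      ∀ k i, IsDivergence (fun j => U (φ k) j i) (ℓ k i) := by
  choose m hm hdiv using fun k => (hU k).2
  obtain ⟨φ, ℓ₀, hφ, hmem, hlim⟩ := exists_subseq_tendsto_of_isCompact hQ hm
  exact ⟨φ, fun k => m (φ k), ℓ₀, hφ, hmem, hlim, fun k i => hdiv (φ k) i⟩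

theorem TendstoWeakStar.comp {a : ℕ → LSp ∞ D} {a₀ : LSp ∞ D} (h : TendstoWeakStar a a₀)
    {φ : ℕ → ℕ} (hφ : StrictMono φ) : TendstoWeakStar (fun k => a (φ k)) a₀ :=
  fun v => (h v).comp hφ.tendsto_atTop

/-- The set of admissible controls is sequentially weakly-* closed. -/
theorem mem_admissibleControls_of_tendsto (q : ℝ≥0∞) [Fact (1 ≤ q)] [p.HolderConjugate q]
    (h2 : 2 ≤ p.toReal) (hD : Bornology.IsBounded (D : Set (Eucl N))) {ξ₁ ξ₂ : LSp ∞ D}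
    (hQ : ∀ i, IsCompact (Q i)) {U : ℕ → Control D} {U₀ : Control D}
    (hw : ∀ i j, TendstoWeakStar (fun k => U k i j) (U₀ i j))
    (hU : ∀ k, U k ∈ admissibleControls p α β ξ₁ ξ₂ Q) :
    U₀ ∈ admissibleControls p α β ξ₁ ξ₂ Q := by
  have : IsFiniteMeasure (volume.restrict (D : Set (Eucl N))) :=
    ⟨by simpa using hD.measure_lt_top⟩
  have hb := mem_boundedControls_of_tendsto h2 hw fun k => (hU k).1
  obtain ⟨φ, ℓ, ℓ₀, hφ, hmem, hlim, hdiv⟩ :=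
    exists_subseq_tendsto_divergence hQ fun k => (hU k).2
  refine ⟨hb, hb.1, fun i => ⟨ℓ₀ i, hmem i, ?_⟩⟩
  exact IsDivergence.of_tendsto q hD (fun j => (hw j i).comp hφ) (hlim i) fun k => hdiv k i

end Solenoidal

section StateForm

variable {N : ℕ} {p : ℝ≥0∞} [Fact (1 ≤ p)] {Ω D : Opens (Eucl N)}

theorem jet_sub (y v : W0 p Ω) (o : Option (Fin N)) :
    ((y - v : W0 p Ω) : Jet N p) o =ᵐ[volume] fun x => (y : Jet N p) o x - (v : Jet N p) o x :=
  Lp.coeFn_sub ((y : Jet N p) o) ((v : Jet N p) o)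

theorem jet_smul (c : ℝ) (v : W0 p Ω) (o : Option (Fin N)) :
    ((c • v : W0 p Ω) : Jet N p) o =ᵐ[volume] fun x => c * (v : Jet N p) o x :=
  Lp.coeFn_smul c ((v : Jet N p) o)

theorem grad_sub_ae (y v : W0 p Ω) : ∀ᵐ x, (fun i => W0.grad (y - v) i x) =
    (fun i => W0.grad y i x) - fun i => W0.grad v i x := by
  filter_upwards [ae_all_iff.2 fun i : Fin N => jet_sub y v (some i)] with x hx
  exact funext hx

theorem grad_smul_ae (c : ℝ) (v : W0 p Ω) : ∀ᵐ x, (fun i => W0.grad (c • v) i x) =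
    c • fun i => W0.grad v i x := by
  filter_upwards [ae_all_iff.2 fun i : Fin N => jet_smul c v (some i)] with x hx
  exact funext hx

/-- The left-hand side of the state equation. -/
noncomputable def stateForm (U : Control D) (y v : W0 p Ω) : ℝ :=
  (∫ x in (Ω : Set (Eucl N)), flux p (fun i j => U i j x) (fun j => W0.grad y j x)
      (fun i => W0.grad v i x)) +
    ∫ x in (Ω : Set (Eucl N)), powMap p (W0.fn y x) * W0.fn v x

theorem memLp_top_restrict (h : Ω ≤ D) (a : LSp ∞ D) :
    MemLp a ∞ (volume.restrict (Ω : Set (Eucl N))) :=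
  (Lp.memLp a).mono_measure (Measure.restrict_mono_set volume h)

theorem integrable_flux_entry (q : ℝ≥0∞) [p.HolderConjugate q] (hp : 2 ≤ p) (hp' : p ≠ ∞)
    (h : Ω ≤ D) (U : Control D) (y v : W0 p Ω) (i j : Fin N) :
    Integrable (fun x => U i j x * powMap p (W0.grad y j x) * W0.grad v i x)
      (volume.restrict (Ω : Set (Eucl N))) :=
  integrable_mul_mul_of_memLp (q := q) (memLp_top_restrict h _)
    (memLp_powMap hp hp' (memLp_jet y (some j) _)) (memLp_jet v (some i) _)

theorem integrable_flux (q : ℝ≥0∞) [p.HolderConjugate q] (hp : 2 ≤ p) (hp' : p ≠ ∞) (h : Ω ≤ D)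
    (U : Control D) (y v : W0 p Ω) :
    Integrable (fun x => flux p (fun i j => U i j x) (fun j => W0.grad y j x)
      (fun i => W0.grad v i x)) (volume.restrict (Ω : Set (Eucl N))) :=
  integrable_finsetSum _ fun i _ => integrable_finsetSum _ fun j _ =>
    integrable_flux_entry q hp hp' h U y v i j

theorem integrable_powMap_mul (q : ℝ≥0∞) [p.HolderConjugate q] (hp : 2 ≤ p) (hp' : p ≠ ∞)
    (y v : W0 p Ω) : Integrable (fun x => powMap p (W0.fn y x) * W0.fn v x)
      (volume.restrict (Ω : Set (Eucl N))) :=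
  integrable_mul_of_memLp (q := q) (memLp_powMap hp hp' (memLp_jet y none _)) (memLp_jet v none _)

theorem stateForm_eq_sum (q : ℝ≥0∞) [p.HolderConjugate q] (hp : 2 ≤ p) (hp' : p ≠ ∞) (h : Ω ≤ D)
    (U : Control D) (y v : W0 p Ω) :
    stateForm U y v = (∑ j, ∑ i, ∫ x in (Ω : Set (Eucl N)),
      U i j x * powMap p (W0.grad y j x) * W0.grad v i x) +
      ∫ x in (Ω : Set (Eucl N)), powMap p (W0.fn y x) * W0.fn v x := by
  rw [stateForm, Finset.sum_comm]
  congr 1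
  simp only [flux]
  rw [integral_finsetSum _ fun i _ => integrable_finsetSum _ fun j _ =>
    integrable_flux_entry q hp hp' h U y v i j]
  exact Finset.sum_congr rfl fun i _ =>
    integral_finsetSum _ fun j _ => integrable_flux_entry q hp hp' h U y v i j

theorem stateForm_sub (q : ℝ≥0∞) [p.HolderConjugate q] (hp : 2 ≤ p) (hp' : p ≠ ∞) (h : Ω ≤ D)
    (U : Control D) (y v w : W0 p Ω) :
    stateForm U y (v - w) = stateForm U y v - stateForm U y w := by
  have h1 : ∫ x in (Ω : Set (Eucl N)), flux p (fun i j => U i j x) (fun j => W0.grad y j x)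
      (fun i => W0.grad (v - w) i x) = (∫ x in (Ω : Set (Eucl N)), flux p (fun i j => U i j x)
        (fun j => W0.grad y j x) (fun i => W0.grad v i x)) - ∫ x in (Ω : Set (Eucl N)),
        flux p (fun i j => U i j x) (fun j => W0.grad y j x) (fun i => W0.grad w i x) := by
    rw [← integral_sub (integrable_flux q hp hp' h U y v) (integrable_flux q hp hp' h U y w)]
    refine integral_congr_ae ?_
    filter_upwards [ae_restrict_of_ae (grad_sub_ae v w)] with x hx
    rw [hx, flux_sub]
  have h2 : ∫ x in (Ω : Set (Eucl N)), powMap p (W0.fn y x) * W0.fn (v - w) x =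
      (∫ x in (Ω : Set (Eucl N)), powMap p (W0.fn y x) * W0.fn v x) -
        ∫ x in (Ω : Set (Eucl N)), powMap p (W0.fn y x) * W0.fn w x := by
    rw [← integral_sub (integrable_powMap_mul q hp hp' y v) (integrable_powMap_mul q hp hp' y w)]
    refine integral_congr_ae ?_
    filter_upwards [ae_restrict_of_ae (jet_sub v w none)] with x hx
    have hx' : W0.fn (v - w) x = W0.fn v x - W0.fn w x := hx
    rw [hx', mul_sub]
  rw [stateForm, h1, h2, stateForm, stateForm]
  ring

theorem stateForm_smul (U : Control D) (y v : W0 p Ω) (c : ℝ) :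
    stateForm U y (c • v) = c * stateForm U y v := by
  rw [stateForm, stateForm, mul_add, ← integral_const_mul, ← integral_const_mul]
  congr 1
  · refine integral_congr_ae ?_
    filter_upwards [ae_restrict_of_ae (grad_smul_ae c v)] with x hx
    rw [hx, flux_smul]
  · refine integral_congr_ae ?_
    filter_upwards [ae_restrict_of_ae (jet_smul c v none)] with x hx
    have hx' : W0.fn (c • v) x = c * W0.fn v x := hx
    rw [hx', mul_left_comm]

variable {α β : ℝ} {U : Control D}

/-- Strong monotonicity bound for the state equation. -/
theorem integral_powMap_sub_le_stateForm_sub (q : ℝ≥0∞) [p.HolderConjugate q] (hp : 2 ≤ p)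
    (hp' : p ≠ ∞) (h : Ω ≤ D) (hU : IsMClass p α β U) (y v : W0 p Ω) :
    ∫ x in (Ω : Set (Eucl N)), (powMap p (W0.fn y x) - powMap p (W0.fn v x)) *
        (W0.fn y x - W0.fn v x) ≤
      stateForm U y (y - v) - stateForm U v (y - v) := by
  have h1 : 0 ≤ (∫ x in (Ω : Set (Eucl N)), flux p (fun i j => U i j x) (fun j => W0.grad y j x)
      (fun i => W0.grad (y - v) i x)) - ∫ x in (Ω : Set (Eucl N)), flux p (fun i j => U i j x)
        (fun j => W0.grad v j x) (fun i => W0.grad (y - v) i x) := by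
    rw [← integral_sub (integrable_flux q hp hp' h U y (y - v))
      (integrable_flux q hp hp' h U v (y - v))]
    refine integral_nonneg_of_ae ?_
    filter_upwards [ae_restrict_of_ae (grad_sub_ae y v),
      ae_restrict_of_ae_restrict_of_subset h hU.monotone] with x hx hm
    rw [hx]
    exact hm _ _
  have h2 : ∫ x in (Ω : Set (Eucl N)), (powMap p (W0.fn y x) - powMap p (W0.fn v x)) *
        (W0.fn y x - W0.fn v x) =
      (∫ x in (Ω : Set (Eucl N)), powMap p (W0.fn y x) * W0.fn (y - v) x) -
        ∫ x in (Ω : Set (Eucl N)), powMap p (W0.fn v x) * W0.fn (y - v) x := by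
    rw [← integral_sub (integrable_powMap_mul q hp hp' y (y - v))
      (integrable_powMap_mul q hp hp' v (y - v))]
    refine integral_congr_ae ?_
    filter_upwards [ae_restrict_of_ae (jet_sub y v none)] with x hx
    have hx' : W0.fn (y - v) x = W0.fn y x - W0.fn v x := hx
    rw [hx', sub_mul]
  rw [h2, stateForm, stateForm]
  linarith

theorem stateForm_monotone (q : ℝ≥0∞) [p.HolderConjugate q] (hp : 2 ≤ p) (hp' : p ≠ ∞)
    (h : Ω ≤ D) (hU : IsMClass p α β U) (y v : W0 p Ω) :
    0 ≤ stateForm U y (y - v) - stateForm U v (y - v) :=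
  (integral_nonneg fun _ => powMap_sub_mul_sub_nonneg (two_le_toReal hp hp') _ _).trans
    (integral_powMap_sub_le_stateForm_sub q hp hp' h hU y v)

/-- Uniqueness for the state equation. -/
theorem eq_of_stateForm_eq (q : ℝ≥0∞) [Fact (1 ≤ q)] [p.HolderConjugate q] (hp : 2 ≤ p)
    (hp' : p ≠ ∞) (h : Ω ≤ D) (hU : IsMClass p α β U) {y v : W0 p Ω}
    (heq : ∀ w, stateForm U y w = stateForm U v w) : y = v := by
  have h2 := two_le_toReal hp hp'
  have h1 := integral_powMap_sub_le_stateForm_sub q hp hp' h hU y v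
  rw [heq, sub_self] at h1
  have hi : Integrable (fun x => (powMap p (W0.fn y x) - powMap p (W0.fn v x)) *
      (W0.fn y x - W0.fn v x)) (volume.restrict (Ω : Set (Eucl N))) :=
    integrable_mul_of_memLp (p := p) (q := q)
      ((memLp_powMap hp hp' (memLp_jet y none _)).sub (memLp_powMap hp hp' (memLp_jet v none _)))
      ((memLp_jet y none _).sub (memLp_jet v none _))
  have h0 := (integral_eq_zero_iff_of_nonneg
    (fun _ => powMap_sub_mul_sub_nonneg h2 _ _) hi).1
    (le_antisymm h1 (integral_nonneg fun _ => powMap_sub_mul_sub_nonneg h2 _ _))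
  rw [← sub_eq_zero]
  refine eq_zero_of_fn_ae_eq_zero q ?_
  rw [EventuallyEq, ae_restrict_iff' Ω.isOpen.measurableSet] at h0
  filter_upwards [h0, jet_ae_eq_zero (y - v) none, jet_sub y v none] with x hx hx' hs
  by_cases hxΩ : x ∈ (Ω : Set (Eucl N))
  · have hs' : W0.fn (y - v) x = W0.fn y x - W0.fn v x := hs
    rw [hs', Pi.zero_apply, sub_eq_zero]
    by_contra hne
    exact (powMap_sub_mul_sub_pos h2 hne).ne' (hx hxΩ)
  · exact hx' hxΩ

theorem stateForm_coercive (q : ℝ≥0∞) [p.HolderConjugate q] (hp : 2 ≤ p)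
    (hp' : p ≠ ∞) (h : Ω ≤ D) (hU : IsMClass p α β U) (y : W0 p Ω) :
    min α 1 * ‖y‖ ^ p.toReal ≤ stateForm U y y := by
  have h2 := two_le_toReal hp hp'
  have hi : ∀ i, Integrable (fun x => |W0.grad y i x| ^ p.toReal)
      (volume.restrict (Ω : Set (Eucl N))) := fun i =>
    integrable_abs_rpow hp' (memLp_jet y (some i) _)
  have h0 : ∀ u : Eucl N → ℝ, 0 ≤ ∫ x in (Ω : Set (Eucl N)), |u x| ^ p.toReal := fun u =>
    integral_nonneg fun x => Real.rpow_nonneg (abs_nonneg _) _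
  rw [W0_norm_rpow hp', mul_add, stateForm, add_comm]
  refine add_le_add ?_ ?_
  · calc min α 1 * ∑ i, ∫ x in (Ω : Set (Eucl N)), |W0.grad y i x| ^ p.toReal
        ≤ α * ∑ i, ∫ x in (Ω : Set (Eucl N)), |W0.grad y i x| ^ p.toReal := by
          exact mul_le_mul_of_nonneg_right (min_le_left _ _) (Finset.sum_nonneg fun i _ => h0 _)
      _ = ∫ x in (Ω : Set (Eucl N)), α * ∑ i, |W0.grad y i x| ^ p.toReal := by
          rw [integral_const_mul, integral_finsetSum _ fun i _ => hi i]
      _ ≤ _ := by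
          refine integral_mono_ae ((integrable_finsetSum _ fun i _ => hi i).const_mul α)
            (integrable_flux q hp hp' h U y y) ?_
          filter_upwards [ae_restrict_of_ae_restrict_of_subset h hU.coercive] with x hx
          exact hx _
  · simp only [powMap_mul_self h2]
    calc min α 1 * ∫ x in (Ω : Set (Eucl N)), |W0.fn y x| ^ p.toReal
        ≤ 1 * ∫ x in (Ω : Set (Eucl N)), |W0.fn y x| ^ p.toReal := by
          exact mul_le_mul_of_nonneg_right (min_le_right _ _) (h0 _)
      _ = _ := one_mul _

theorem norm_extendZero (h : Ω ≤ D) (y : W0 p Ω) : ‖extendZero h y‖ = ‖y‖ := rfl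

/-- Extension by zero as a continuous linear map. -/
noncomputable def extendZeroL (h : Ω ≤ D) : W0 p Ω →L[ℝ] W0 p D :=
  (extendZero h).mkContinuous 1 fun y => by rw [norm_extendZero, one_mul]

/-- The a-priori bound for weak solutions. -/
theorem IsWeakSolution.norm_le (q : ℝ≥0∞) [p.HolderConjugate q] (hp : 2 ≤ p)
    (hp' : p ≠ ∞) (h : Ω ≤ D) (hα : 0 < α) (hU : IsMClass p α β U) {f : WNeg p D} {y : W0 p Ω}
    (hy : IsWeakSolution h f U y) : ‖y‖ ≤ max 1 (‖f‖ / min α 1) := by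
  have h2 := two_le_toReal hp hp'
  have hm : 0 < min α 1 := lt_min hα one_pos
  have h1 : min α 1 * ‖y‖ ^ p.toReal ≤ ‖f‖ * ‖y‖ :=
    ((stateForm_coercive q hp hp' h hU y).trans (hy y).le).trans
      ((le_abs_self _).trans (f.le_opNorm _))
  by_contra! hlt
  have hy1 : 1 < ‖y‖ := (le_max_left _ _).trans_lt hlt
  have hy2 : ‖f‖ < ‖y‖ * min α 1 := (div_lt_iff₀ hm).1 ((le_max_right _ _).trans_lt hlt)
  have h3 : ‖y‖ ^ (2 : ℝ) ≤ ‖y‖ ^ p.toReal := Real.rpow_le_rpow_of_exponent_le hy1.le h2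
  rw [Real.rpow_two] at h3
  have h4 : min α 1 * ‖y‖ ^ 2 ≤ ‖f‖ * ‖y‖ := (mul_le_mul_of_nonneg_left h3 hm.le).trans h1
  nlinarith

theorem tendsto_stateForm_add_smul (q : ℝ≥0∞) [p.HolderConjugate q] (hp : 2 ≤ p)
    (hp' : p ≠ ∞) (h : Ω ≤ D) (U : Control D) (y w v : W0 p Ω) :
    Tendsto (fun t : ℝ => stateForm U (y - t • w) v) (𝓝 0) (𝓝 (stateForm U y v)) := by
  have hjet : ∀ (t : ℝ) o, ((y - t • w : W0 p Ω) : Jet N p) o =ᵐ[volume]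
      fun x => (y : Jet N p) o x + t * (-(w : Jet N p) o x) := by
    intro t o
    filter_upwards [jet_sub y (t • w) o, jet_smul t w o] with x h1 h3
    rw [h1, h3]
    ring
  simp only [stateForm_eq_sum q hp hp' h]
  refine Tendsto.add (tendsto_finsetSum _ fun j _ => tendsto_finsetSum _ fun i _ => ?_) ?_
  · refine (tendsto_integral_powMap (q := q) hp hp' (memLp_top_restrict h (U i j))
      (memLp_jet y (some j) _) (memLp_jet w (some j) _).neg (memLp_jet v (some i) _)).congr
      fun t => ?_
    refine integral_congr_ae ?_
    filter_upwards [ae_restrict_of_ae (hjet t (some j))] with x hx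
    rw [W0.grad, hx]
    rfl
  · have := tendsto_integral_powMap (q := q) hp hp'
      (memLp_top_const (μ := volume.restrict (Ω : Set (Eucl N))) (1 : ℝ))
      (memLp_jet y none _) (memLp_jet w none _).neg (memLp_jet v none _)
    simp only [one_mul] at this
    refine this.congr fun t => ?_
    refine integral_congr_ae ?_
    filter_upwards [ae_restrict_of_ae (hjet t none)] with x hx
    rw [W0.fn, hx]
    rfl

end StateForm

section StateLimit

variable {N : ℕ} {p : ℝ≥0∞} [Fact (1 ≤ p)] {Ω D : Opens (Eucl N)}

theorem tendsto_extendZero (h : Ω ≤ D) {y : ℕ → W0 p Ω} {y₀ : W0 p Ω}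
    (hw : ∀ ℓ : StrongDual ℝ (W0 p Ω), Tendsto (fun k => ℓ (y k)) atTop (𝓝 (ℓ y₀)))
    (ℓ : StrongDual ℝ (W0 p D)) :
    Tendsto (fun k => ℓ (extendZero h (y k))) atTop (𝓝 (ℓ (extendZero h y₀))) :=
  hw (ℓ.comp (extendZeroL h))

theorem tendsto_stateForm (q : ℝ≥0∞) [Fact (1 ≤ q)] [p.HolderConjugate q] (hp : 2 ≤ p)
    (hp' : p ≠ ∞) (h : Ω ≤ D) (hD : Bornology.IsBounded (D : Set (Eucl N))) {β : ℝ} (hβ0 : 0 ≤ β)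
    {U : ℕ → Control D} {U₀ : Control D}
    (hβ : ∀ k i j, ∀ᵐ x ∂(volume.restrict (D : Set (Eucl N))), |U k i j x| ≤ β)
    (hβ₀ : ∀ i j, ∀ᵐ x ∂(volume.restrict (D : Set (Eucl N))), |U₀ i j x| ≤ β)
    (hU : ∀ i j, TendstoWeakStar (fun k => U k i j) (U₀ i j))
    {ℓ : ℕ → Fin N → WNeg p D} {ℓ₀ : Fin N → WNeg p D}
    (hℓ : ∀ i, Tendsto (fun k => ℓ k i) atTop (𝓝 (ℓ₀ i)))
    (hdiv : ∀ k i, IsDivergence (fun j => U k j i) (ℓ k i))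
    {y : ℕ → W0 p Ω} {y₀ : W0 p Ω} {M : ℝ} (hM : ∀ k, ‖y k‖ ≤ M)
    (hw : ∀ ℓ : StrongDual ℝ (W0 p Ω), Tendsto (fun k => ℓ (y k)) atTop (𝓝 (ℓ y₀)))
    (v : W0 p Ω) :
    Tendsto (fun k => stateForm (U k) v (y k)) atTop (𝓝 (stateForm U₀ v y₀)) := by
  have hq : q ≠ ∞ := ne_top_of_le_ne_top (by simp) (conjExponent_le_two (p := p) hp)
  have hΩD : ∀ (b : LSp ∞ D) (u : W0 p Ω) (i j : Fin N),
      ∫ x in (Ω : Set (Eucl N)), b x * powMap p (W0.grad v j x) * W0.grad u i x =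
      ∫ x in (D : Set (Eucl N)), b x * W0.grad (extendZero h u) i x * powMap p (W0.grad v j x) := by
    intro b u i j
    rw [setIntegral_eq_of_subset_of_ae_sdiff_eq_zero (D.isOpen.measurableSet.nullMeasurableSet) h]
    · refine integral_congr_ae (ae_of_all _ fun x => ?_)
      exact mul_right_comm _ _ _
    · filter_upwards [jet_ae_eq_zero u (some i)] with x hx hx'
      have hx₀ : W0.grad (extendZero h u) i x = 0 := hx hx'.2
      rw [hx₀, mul_zero, zero_mul]
  simp only [stateForm_eq_sum q hp hp' h]
  refine Tendsto.add (tendsto_finsetSum _ fun j _ => ?_) ?_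
  · simp only [hΩD]
    exact tendsto_integral_divCurl q hq hD hβ0 (fun k i => hβ k i j) (fun i => hβ₀ i j)
      (fun i => hU i j) (hℓ j) (fun k => hdiv k j) (y := fun k => extendZero h (y k)) hM
      (tendsto_extendZero h hw) (memLp_powMap hp hp' (Lp.memLp _))
  · obtain ⟨m, hm⟩ := exists_dual_W0_eq_integral (p := p) (Ω := Ω) q
      (ψ := fun x => powMap p (W0.fn v x)) (memLp_powMap hp hp' (Lp.memLp _)) none
    have hm' : ∀ u : W0 p Ω, ∫ x in (Ω : Set (Eucl N)), powMap p (W0.fn v x) * W0.fn u x = m u := by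
      intro u
      rw [hm]
      exact setIntegral_eq_integral_of_jet (y := u) none (fun x hx => by
        rw [W0.fn, W0.fn, hx, mul_zero])
    simp only [hm']
    exact hw m

/-- Weak limits of solutions of the state equation, along controls whose columns have convergent
divergences, solve the limit equation. -/
theorem IsWeakSolution.of_tendsto (q : ℝ≥0∞) [Fact (1 ≤ q)] [p.HolderConjugate q] (hp : 2 ≤ p)
    (hp' : p ≠ ∞) (h : Ω ≤ D) (hD : Bornology.IsBounded (D : Set (Eucl N))) {α β : ℝ} (hα : 0 < α)
    (hαβ : α ≤ β) {ξ₁ ξ₂ : LSp ∞ D} {Q : Fin N → Set (WNeg p D)} (hQ : ∀ i, IsCompact (Q i))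
    {U : ℕ → Control D} {U₀ : Control D}
    (hmem : ∀ k, U k ∈ admissibleControls p α β ξ₁ ξ₂ Q)
    (hU : ∀ i j, TendstoWeakStar (fun k => U k i j) (U₀ i j))
    {f : WNeg p D} {y : ℕ → W0 p Ω} {y₀ : W0 p Ω} (hy : ∀ k, IsWeakSolution h f (U k) (y k))
    (hw : ∀ ℓ : StrongDual ℝ (W0 p Ω), Tendsto (fun k => ℓ (y k)) atTop (𝓝 (ℓ y₀))) :
    IsWeakSolution h f U₀ y₀ := by
  have hmem₀ := mem_admissibleControls_of_tendsto q (two_le_toReal hp hp') hD hQ hU hmem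
  obtain ⟨φ, ℓ, ℓ₀, hφ, -, hℓ, hdiv⟩ := exists_subseq_tendsto_divergence hQ fun k => (hmem k).2
  have hU' := fun i j => (hU i j).comp hφ
  have hw' : ∀ ℓ : StrongDual ℝ (W0 p Ω),
      Tendsto (fun k => ℓ (y (φ k))) atTop (𝓝 (ℓ y₀)) := fun ℓ => (hw ℓ).comp hφ.tendsto_atTop
  have hlim : ∀ {u : ℕ → W0 p Ω} {u₀ : W0 p Ω} {M : ℝ}, (∀ k, ‖u k‖ ≤ M) →
      (∀ ℓ : StrongDual ℝ (W0 p Ω), Tendsto (fun k => ℓ (u k)) atTop (𝓝 (ℓ u₀))) →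
      ∀ v, Tendsto (fun k => stateForm (U (φ k)) v (u k)) atTop (𝓝 (stateForm U₀ v u₀)) :=
    fun hM hu v => tendsto_stateForm q hp hp' h hD (hα.le.trans hαβ)
      (fun k => (hmem (φ k)).1.1.growth) hmem₀.1.1.growth hU' hℓ hdiv hM hu v
  have minty : ∀ v, 0 ≤ f (extendZero h (y₀ - v)) - stateForm U₀ v (y₀ - v) := by
    intro v
    have h1 : Tendsto (fun k => f (extendZero h (y (φ k))) - f (extendZero h v)
        - (stateForm (U (φ k)) v (y (φ k)) - stateForm (U (φ k)) v v)) atTop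
        (𝓝 (f (extendZero h y₀) - f (extendZero h v)
          - (stateForm U₀ v y₀ - stateForm U₀ v v))) :=
      ((tendsto_extendZero h hw' f).sub_const _).sub
        ((hlim (fun k => (hy (φ k)).norm_le q hp hp' h hα (hmem (φ k)).1.1) hw' v).sub
          (hlim (u := fun _ => v) (fun _ => le_rfl) (fun _ => tendsto_const_nhds) v))
    rw [map_sub, map_sub, stateForm_sub q hp hp' h]
    refine ge_of_tendsto' h1 fun k => ?_
    have h3 := stateForm_monotone q hp hp' h (hmem (φ k)).1.1 (y (φ k)) v
    have h4 : stateForm (U (φ k)) (y (φ k)) (y (φ k) - v) =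
      f (extendZero h (y (φ k) - v)) := hy (φ k) _
    rwa [h4, map_sub, map_sub, stateForm_sub q hp hp' h] at h3
  have hle : ∀ w, stateForm U₀ y₀ w ≤ f (extendZero h w) := by
    intro w
    have h1 := (tendsto_stateForm_add_smul q hp hp' h U₀ y₀ w w).mono_left
      (nhdsWithin_le_nhds (s := Ioi 0))
    refine le_of_tendsto h1 ?_
    filter_upwards [self_mem_nhdsWithin] with t ht
    have h3 := minty (y₀ - t • w)
    rw [sub_sub_cancel, stateForm_smul, map_smul, map_smul, smul_eq_mul, ← mul_sub] at h3
    exact sub_nonneg.1 (nonneg_of_mul_nonneg_right h3 ht)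
  intro w
  refine le_antisymm (hle w) ?_
  have h1 := hle ((-1 : ℝ) • w)
  rw [stateForm_smul, map_smul, map_smul, smul_eq_mul] at h1
  have : f (extendZero h w) ≤ stateForm U₀ y₀ w := by linarith
  exact this

end StateLimit

section CompactSeminorm

theorem exists_linearMap_le_seminorm {E : Type*} [AddCommGroup E] [Module ℝ E]
    (S : Seminorm ℝ E) (c : E) : ∃ g : E →ₗ[ℝ] ℝ, g c = S c ∧ ∀ x, g x ≤ S x := by
  have H : ∀ t : ℝ, t • c = 0 → (RingHom.id ℝ) t • S c = 0 := by
    intro t ht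
    have h1 : |t| * S c = 0 := by
      rw [← Real.norm_eq_abs, ← map_smul_eq_mul, ht, map_zero]
    rcases mul_eq_zero.1 h1 with h | h
    · simp [abs_eq_zero.1 h]
    · simp [h]
  obtain ⟨g, hg, hle⟩ := exists_extension_of_le_sublinear
    (LinearPMap.mkSpanSingleton' c (S c) H) S
    (fun t ht x => by rw [map_smul_eq_mul, Real.norm_eq_abs, abs_of_pos ht])
    (fun x y => map_add_le_add S x y) (by
      rintro ⟨x, hx⟩
      obtain ⟨t, rfl⟩ := Submodule.mem_span_singleton.1 hx
      rw [LinearPMap.mkSpanSingleton'_apply, map_smul_eq_mul, RingHom.id_apply, smul_eq_mul,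
        Real.norm_eq_abs]
      exact mul_le_mul_of_nonneg_right (le_abs_self t) (apply_nonneg S c))
  refine ⟨g, ?_, hle⟩
  exact (hg ⟨c, Submodule.mem_span_singleton_self c⟩).trans
    (LinearPMap.mkSpanSingleton'_apply_self c (S c) H _)

variable {Z : Type*} [NormedAddCommGroup Z] [NormedSpace ℝ Z] {S : Seminorm ℝ Z}

theorem IsCompactSeminorm.exists_le_mul_norm (hS : IsCompactSeminorm S) :
    ∃ K, 0 ≤ K ∧ ∀ z, S z ≤ K * ‖z‖ := by
  obtain ⟨T, hT, h⟩ := hS 1 one_pos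
  obtain ⟨m, hm⟩ := (hT.image S).bddAbove
  have hK : ∀ z, ‖z‖ ≤ 1 → S z ≤ 1 + |m| := by
    intro z hz
    obtain ⟨c, hc, hzc⟩ := h z hz
    have h1 : S z ≤ S (z - c) + S c := by
      have := map_add_le_add S (z - c) c
      rwa [sub_add_cancel] at this
    have h2 : S c ≤ m := hm (mem_image_of_mem S hc)
    linarith [le_abs_self m]
  refine ⟨1 + |m|, by positivity, fun z => ?_⟩
  rcases eq_or_ne z 0 with rfl | hz
  · simp
  · have hz' : 0 < ‖z‖ := norm_pos_iff.2 hz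
    have h1 := hK (‖z‖⁻¹ • z) (by rw [norm_smul, norm_inv, norm_norm, inv_mul_cancel₀ hz'.ne'])
    rwa [map_smul_eq_mul, norm_inv, norm_norm, inv_mul_le_iff₀ hz', mul_comm] at h1

/-- Compact seminorms turn weak convergence of bounded sequences into strong convergence. -/
theorem IsCompactSeminorm.tendsto_zero (hS : IsCompactSeminorm S) {x : ℕ → Z} {M : ℝ}
    (hM : ∀ k, ‖x k‖ ≤ M)
    (hx : ∀ ℓ : StrongDual ℝ Z, Tendsto (fun k => ℓ (x k)) atTop (𝓝 0)) :
    Tendsto (fun k => S (x k)) atTop (𝓝 0) := by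
  obtain ⟨K, hK0, hK⟩ := hS.exists_le_mul_norm
  have hdual : ∀ d : Z, ∃ ℓ : StrongDual ℝ Z, ℓ d = S d ∧ ∀ z, ℓ z ≤ S z := by
    intro d
    obtain ⟨g, hgd, hg⟩ := exists_linearMap_le_seminorm S d
    refine ⟨g.mkContinuous K fun z => ?_, hgd, hg⟩
    rw [Real.norm_eq_abs, abs_le]
    have h1 := hg (-z)
    rw [map_neg, map_neg_eq_map] at h1
    exact ⟨by linarith [hK z], (hg z).trans (hK z)⟩
  choose ℓ hℓd hℓ using hdual
  set L := |M| + 1 with hL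
  have hL0 : 0 < L := by positivity
  rw [Metric.tendsto_atTop]
  intro ε hε
  obtain ⟨T, hT, hTS⟩ := hS (ε / (4 * L)) (by positivity)
  have hev : ∀ᶠ k in atTop, ∀ c ∈ T, ℓ (L • c) (x k) < ε / 4 :=
    (eventually_all_finite hT).2 fun c _ =>
      (hx (ℓ (L • c))).eventually_lt_const (by positivity)
  obtain ⟨n, hn⟩ := eventually_atTop.1 hev
  refine ⟨n, fun k hk => ?_⟩
  rw [Real.dist_eq, sub_zero, abs_of_nonneg (apply_nonneg S _)]
  obtain ⟨c, hc, hxc⟩ := hTS (L⁻¹ • x k) (by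
    rw [norm_smul, norm_inv, Real.norm_eq_abs, abs_of_pos hL0, inv_mul_le_iff₀ hL0, mul_one]
    linarith [hM k, le_abs_self M])
  have h1 : S (x k - L • c) < ε / 4 := by
    have he : x k - L • c = L • (L⁻¹ • x k - c) := by
      rw [smul_sub, smul_smul, mul_inv_cancel₀ hL0.ne', one_smul]
    rw [he, map_smul_eq_mul, Real.norm_eq_abs, abs_of_pos hL0]
    calc L * S (L⁻¹ • x k - c) < L * (ε / (4 * L)) := by gcongr
      _ = ε / 4 := by field_simp
  have h2 : S (x k) ≤ S (x k - L • c) + S (L • c) := by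
    have := map_add_le_add S (x k - L • c) (L • c)
    rwa [sub_add_cancel] at this
  have h3 : ℓ (L • c) (L • c - x k) ≤ S (x k - L • c) := by
    rw [map_sub_rev S]
    exact hℓ _ _
  rw [map_sub, hℓd] at h3
  linarith [hn k hk c hc]

end CompactSeminorm

section Minty

theorem tendsto_modulus_div {c : ℝ → ℝ → ℝ}
    (hc : ContinuousOn (fun s : ℝ × ℝ => c s.1 s.2) (Ici 0 ×ˢ Ici 0)) {R : ℝ} (hR : 0 < R)
    (h : Tendsto (fun t => c R t / t) (𝓝[>] 0) (𝓝 0)) {s : ℝ} (hs : 0 ≤ s) :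
    Tendsto (fun t => c R (t * s) / t) (𝓝[>] 0) (𝓝 0) := by
  rcases hs.eq_or_lt with rfl | hs
  · have h0 : c R 0 = 0 := by
      have h1 : Tendsto (fun t => c R t) (𝓝[>] 0) (𝓝 (c R 0)) := by
        have h2 := hc (R, 0) ⟨hR.le, self_mem_Ici⟩
        refine h2.tendsto.comp (f := fun t : ℝ => (R, t)) (tendsto_nhdsWithin_iff.2 ⟨?_, ?_⟩)
        · exact (Continuous.prodMk_right R).continuousWithinAt
        · filter_upwards [self_mem_nhdsWithin] with t ht
          exact ⟨hR.le, (mem_Ioi.1 ht).le⟩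
      have h3 : Tendsto (fun t => c R t) (𝓝[>] 0) (𝓝 0) := by
        have h4 := h.mul (tendsto_id.mono_left (nhdsWithin_le_nhds (s := Ioi (0 : ℝ)) (a := 0)))
        rw [zero_mul] at h4
        refine h4.congr' ?_
        filter_upwards [self_mem_nhdsWithin] with t ht
        exact div_mul_cancel₀ _ (ne_of_gt ht)
      exact tendsto_nhds_unique h1 h3
    simp [h0]
  · have h1 : Tendsto (fun t : ℝ => t * s) (𝓝[>] 0) (𝓝[>] 0) := by
      refine tendsto_nhdsWithin_iff.2 ⟨?_, ?_⟩
      · have : Tendsto (fun t : ℝ => t * s) (𝓝 0) (𝓝 (0 * s)) :=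
          (continuous_id.mul continuous_const).tendsto 0
        rw [zero_mul] at this
        exact this.mono_left nhdsWithin_le_nhds
      · filter_upwards [self_mem_nhdsWithin] with t ht
        exact mul_pos ht hs
    have h2 := (h.comp h1).mul_const s
    rw [zero_mul] at h2
    refine h2.congr fun t => ?_
    simp only [Function.comp]
    rcases eq_or_ne t 0 with rfl | ht
    · simp
    · field_simp

variable {Z : Type*} [NormedAddCommGroup Z] [NormedSpace ℝ Z] {S : Seminorm ℝ Z}
  {c : ℝ → ℝ → ℝ} {ν : ℕ → StrongDual ℝ Z} {G : ℕ → Z → StrongDual ℝ Z} {z : ℕ → Z} {R₀ : ℝ}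

/-- Values of operators with semi-bounded variation along a bounded sequence are bounded when
their pairings with the sequence are bounded above. -/
theorem exists_norm_le_of_semiboundedVariation [CompleteSpace Z] (hS : IsCompactSeminorm S)
    (hc : ContinuousOn (fun s : ℝ × ℝ => c s.1 s.2) (Ici 0 ×ˢ Ici 0))
    (hz : ∀ k, ‖z k‖ ≤ R₀) {m : ℝ} (hm : ∀ k, ν k (z k) ≤ m) (hG : ∀ v, ∃ K, ∀ k, ‖G k v‖ ≤ K)
    (hvar : ∀ R > 0, ∀ k v, ‖z k‖ ≤ R → ‖v‖ ≤ R →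
      -c R (S (z k - v)) ≤ (ν k - G k v) (z k - v)) :
    ∃ M, ∀ k, ‖ν k‖ ≤ M := by
  obtain ⟨K, hK0, hK⟩ := hS.exists_le_mul_norm
  have key : ∀ v, ∃ L, ∀ k, ν k v ≤ L := by
    intro v
    obtain ⟨A, hA⟩ := hG v
    set R := |R₀| + ‖v‖ + 1 with hRdef
    have hR : 0 < R := by positivity
    have hzR : ∀ k, ‖z k‖ ≤ R := fun k => by
      linarith [hz k, le_abs_self R₀, norm_nonneg v]
    have hvR : ‖v‖ ≤ R := by linarith [abs_nonneg R₀]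
    have hcR : ContinuousOn (fun t => c R t) (Icc 0 (K * (2 * R))) :=
      hc.comp (f := fun t : ℝ => (R, t)) (Continuous.prodMk_right R).continuousOn
        fun t ht => ⟨hR.le, ht.1⟩
    obtain ⟨b, hb⟩ := isCompact_Icc.bddAbove_image hcR
    refine ⟨m + A * (2 * R) + b, fun k => ?_⟩
    have h1 := hvar R hR k v (hzR k) hvR
    have hn : ‖z k - v‖ ≤ 2 * R := (norm_sub_le _ _).trans (by linarith [hzR k])
    have h2 : c R (S (z k - v)) ≤ b := hb ⟨_, ⟨apply_nonneg S _,
      (hK _).trans (mul_le_mul_of_nonneg_left hn hK0)⟩, rfl⟩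
    have h3 : -(G k v (z k - v)) ≤ A * (2 * R) := by
      refine (neg_le_abs _).trans (((G k v).le_opNorm _).trans ?_)
      exact mul_le_mul (hA k) hn (norm_nonneg _) ((norm_nonneg _).trans (hA k))
    rw [sub_apply, map_sub (ν k)] at h1
    linarith [hm k]
  refine banach_steinhaus fun v => ?_
  obtain ⟨L, hL⟩ := key v
  obtain ⟨L', hL'⟩ := key (-v)
  refine ⟨max L L', fun k => ?_⟩
  rw [Real.norm_eq_abs, abs_le]
  have h1 := hL' k
  rw [map_neg] at h1
  exact ⟨by linarith [le_max_right L L'], (hL k).trans (le_max_left _ _)⟩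

/-- Minty's argument for operators with semi-bounded variation. -/
theorem eq_of_semiboundedVariation (hS : IsCompactSeminorm S)
    (hc : ContinuousOn (fun s : ℝ × ℝ => c s.1 s.2) (Ici 0 ×ˢ Ici 0))
    (hc' : ∀ R > 0, Tendsto (fun t => c R t / t) (𝓝[>] 0) (𝓝 0))
    (hz : ∀ k, ‖z k‖ ≤ R₀) {z₀ : Z}
    (hzw : ∀ ℓ : StrongDual ℝ Z, Tendsto (fun k => ℓ (z k)) atTop (𝓝 (ℓ z₀)))
    {ν₀ : StrongDual ℝ Z} (hν : ∀ v, Tendsto (fun k => ν k v) atTop (𝓝 (ν₀ v)))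
    {u : ℕ → ℝ} (hu : ∀ k, ν k (z k) ≤ u k) (hu₀ : Tendsto u atTop (𝓝 (ν₀ z₀)))
    {G₀ : Z → StrongDual ℝ Z} (hG : ∀ v, Tendsto (fun k => G k v) atTop (𝓝 (G₀ v)))
    (hrad : ∀ w, Tendsto (fun t : ℝ => G₀ (z₀ + t • w) w) (𝓝[>] 0) (𝓝 (G₀ z₀ w)))
    (hvar : ∀ R > 0, ∀ k v, ‖z k‖ ≤ R → ‖v‖ ≤ R →
      -c R (S (z k - v)) ≤ (ν k - G k v) (z k - v)) :
    ν₀ = G₀ z₀ := by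
  have hS0 : Tendsto (fun k => S (z k - z₀)) atTop (𝓝 0) := by
    refine hS.tendsto_zero (M := R₀ + ‖z₀‖)
      (fun k => (norm_sub_le _ _).trans (by linarith [hz k])) fun ℓ => ?_
    have := (hzw ℓ).sub_const (ℓ z₀)
    rw [sub_self] at this
    refine this.congr fun k => ?_
    rw [map_sub]
  have hSv : ∀ v, Tendsto (fun k => S (z k - v)) atTop (𝓝 (S (z₀ - v))) := by
    intro v
    rw [tendsto_iff_norm_sub_tendsto_zero]
    refine squeeze_zero (fun k => norm_nonneg _) (fun k => ?_) hS0
    have := abs_sub_map_le_sub S (z k - v) (z₀ - v)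
    rwa [sub_sub_sub_cancel_right] at this
  have hlim : ∀ R > 0, R₀ ≤ R → ∀ v, ‖v‖ ≤ R →
      -c R (S (z₀ - v)) ≤ (ν₀ - G₀ v) (z₀ - v) := by
    intro R hR hR₀ v hv
    have h1 : Tendsto (fun k => -c R (S (z k - v))) atTop (𝓝 (-c R (S (z₀ - v)))) := by
      have h2 := hc (R, S (z₀ - v)) ⟨hR.le, apply_nonneg S _⟩
      refine (h2.tendsto.comp (f := fun k => (R, S (z k - v)))
        (tendsto_nhdsWithin_iff.2 ⟨?_, ?_⟩)).neg
      · exact tendsto_const_nhds.prodMk_nhds (hSv v)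
      · exact Eventually.of_forall fun k => ⟨hR.le, apply_nonneg S _⟩
    have h3 : Tendsto (fun k => G k v (z k - v)) atTop (𝓝 (G₀ v (z₀ - v))) := by
      refine tendsto_dual_apply (M := R₀ + ‖v‖) (hG v)
        (fun k => (norm_sub_le _ _).trans (by linarith [hz k])) ?_
      simp only [map_sub]
      exact (hzw _).sub_const _
    have h4 := (hu₀.sub (hν v)).sub h3
    have h5 := le_of_tendsto_of_tendsto' h1 h4 fun k => by
      have h6 := hvar R hR k v ((hz k).trans hR₀) hv
      rw [sub_apply, map_sub (ν k)] at h6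
      linarith [hu k]
    rwa [sub_apply, map_sub ν₀]
  have hle : ∀ w, ν₀ w ≤ G₀ z₀ w := by
    intro w
    set R := |R₀| + ‖z₀‖ + ‖w‖ + 1 with hRdef
    have hR : 0 < R := by positivity
    have hRR : R₀ ≤ R := by linarith [le_abs_self R₀, norm_nonneg z₀, norm_nonneg w]
    have h1 := (hrad w).add (tendsto_modulus_div hc hR (hc' R hR) (apply_nonneg S w))
    rw [add_zero] at h1
    refine ge_of_tendsto h1 ?_
    filter_upwards [Ioo_mem_nhdsGT (zero_lt_one' ℝ)] with t ht
    have htw : ‖t • w‖ ≤ ‖w‖ := by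
      rw [norm_smul, Real.norm_eq_abs, abs_of_pos ht.1]
      exact mul_le_of_le_one_left (norm_nonneg w) ht.2.le
    have h2 := hlim R hR hRR (z₀ + t • w)
      ((norm_add_le _ _).trans (by linarith [abs_nonneg R₀]))
    rw [sub_add_cancel_left, map_neg_eq_map, map_smul_eq_mul, Real.norm_eq_abs, abs_of_pos ht.1,
      map_neg, map_smul, smul_eq_mul, neg_le_neg_iff, sub_apply] at h2
    have h3 := (le_div_iff₀' ht.1).2 h2
    linarith
  ext w
  refine le_antisymm (hle w) ?_
  have := hle (-w)
  rw [map_neg, map_neg] at this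
  linarith

end Minty

section Hammerstein

open scoped ContDiff

variable {N : ℕ} {p q : ℝ≥0∞} [Fact (1 ≤ p)] [Fact (1 ≤ q)] {Ω D : Opens (Eucl N)}

theorem integrable_mul_test [IsFiniteMeasure (volume.restrict (Ω : Set (Eucl N)))]
    (w : LSp p Ω) {φ : Eucl N → ℝ} (hφ : ContDiff ℝ ∞ φ) (hφc : HasCompactSupport φ) :
    Integrable (fun x => w x * φ x) (volume.restrict (Ω : Set (Eucl N))) := by
  obtain ⟨K, hK⟩ := hφ.continuous.bounded_above_of_compact_support hφc
  exact ((Lp.memLp w).integrable Fact.out).mul_bdd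
    hφ.continuous.aestronglyMeasurable (ae_of_all _ hK)

/-- Functions in `L^p(Ω)` are determined by the distributions they define. -/
theorem Lp_eq_of_integral_test_eq [IsFiniteMeasure (volume.restrict (Ω : Set (Eucl N)))]
    {u v : LSp p Ω} (h : ∀ φ : 𝓓(Ω, ℝ), ∫ x in (Ω : Set (Eucl N)), u x * φ x =
      ∫ x in (Ω : Set (Eucl N)), v x * φ x) : u = v := by
  have hi : ∀ w : LSp p Ω, Integrable w (volume.restrict (Ω : Set (Eucl N))) := fun w =>
    (Lp.memLp w).integrable Fact.out
  have h0 := Ω.isOpen.ae_eq_zero_of_integral_contDiff_smul_eq_zero (μ := volume)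
    (f := fun x => u x - v x) (IntegrableOn.locallyIntegrableOn ((hi u).sub (hi v)))
    (fun φ hφ hφc hφs => ?_)
  · refine Lp.ext ?_
    rw [EventuallyEq, ae_restrict_iff' Ω.isOpen.measurableSet]
    filter_upwards [h0] with x hx hxΩ
    exact sub_eq_zero.1 (hx hxΩ)
  · have hφΩ := h ⟨φ, hφ, hφc, hφs⟩
    change ∫ x in (Ω : Set (Eucl N)), u x * φ x = ∫ x in (Ω : Set (Eucl N)), v x * φ x at hφΩ
    have hm := fun w : LSp p Ω => integrable_mul_test w hφ hφc
    rw [← setIntegral_eq_integral_of_forall_compl_eq_zero (s := (Ω : Set (Eucl N)))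
      (fun x hx => by
        rw [image_eq_zero_of_notMem_tsupport fun hx' => hx (hφs hx'), zero_smul])]
    rw [← sub_eq_zero, ← integral_sub (hm u) (hm v)] at hφΩ
    rw [← hφΩ]
    refine integral_congr_ae (ae_of_all _ fun x => ?_)
    simp only [smul_eq_mul]
    ring

theorem mem_hammersteinSet_iff (hΩ : Bornology.IsBounded (Ω : Set (Eucl N))) (h : Ω ≤ D)
    {B : LSp q Ω →L[ℝ] LSp p Ω} {F : W0 p Ω → LSp p Ω → LSp q Ω} {g : LSp p D} {y : W0 p Ω}
    {z : LSp p Ω} : z ∈ hammersteinSet B F g y ↔ z + B (F y z) = restrictL h g := by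
  have : IsFiniteMeasure (volume.restrict (Ω : Set (Eucl N))) :=
    ⟨by simpa using hΩ.measure_lt_top⟩
  have hg : ∀ φ : 𝓓(Ω, ℝ), ∫ x in (Ω : Set (Eucl N)), restrictL h g x * φ x =
      ∫ x in (Ω : Set (Eucl N)), g x * φ x := by
    intro φ
    refine integral_congr_ae ?_
    filter_upwards [((Lp.memLp g).mono_measure
      (Measure.restrict_mono_set volume h)).coeFn_toLp] with x hx
    rw [restrictL, hx]
  have hs : ∀ φ : 𝓓(Ω, ℝ), ∫ x in (Ω : Set (Eucl N)), (z + B (F y z) : LSp p Ω) x * φ x =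
      (∫ x in (Ω : Set (Eucl N)), z x * φ x) + ∫ x in (Ω : Set (Eucl N)), B (F y z) x * φ x := by
    intro φ
    have hm := fun w : LSp p Ω => integrable_mul_test w φ.contDiff φ.hasCompactSupport
    rw [← integral_add (hm z) (hm _)]
    refine integral_congr_ae ?_
    filter_upwards [Lp.coeFn_add z (B (F y z))] with x hx
    rw [hx, Pi.add_apply, add_mul]
  refine ⟨fun hz => Lp_eq_of_integral_test_eq fun φ => ?_, fun hz φ => ?_⟩
  · rw [hs, hg]
    exact hz φ
  · rw [← hs, hz, hg]

variable [p.HolderConjugate q]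

theorem pairing_eq_lpDual (ν : LSp q Ω) (z : LSp p Ω) :
    pairing ν z = lpDual (volume.restrict (Ω : Set (Eucl N))) q p ν z :=
  (lpDual_apply ν z).symm

variable {B : LSp q Ω →L[ℝ] LSp p Ω} {γ ν : LSp q Ω} {z : LSp p Ω}

theorem pairing_sub_eq (hz : z + B ν = B γ) :
    pairing (ν - γ) z = -pairing (ν - γ) (B (ν - γ)) := by
  have : z = -B (ν - γ) := by rw [map_sub, ← hz]; abel
  rw [pairing_eq_lpDual, pairing_eq_lpDual, ← map_neg, ← this]

theorem pairing_self_nonneg (hB : ∀ ν : LSp q Ω, ν ≠ 0 → 0 < pairing ν (B ν)) (ν : LSp q Ω) :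
    0 ≤ pairing ν (B ν) := by
  rcases eq_or_ne ν 0 with rfl | h
  · rw [pairing_eq_lpDual]
    simp
  · exact (hB ν h).le

/-- The a-priori bound for solutions of the Hammerstein equation. -/
theorem norm_le_of_hammerstein (hB : ∀ ν : LSp q Ω, ν ≠ 0 → 0 < pairing ν (B ν)) {lam : ℝ}
    (hlam : 0 < lam) (hz : z + B ν = B γ) (h : lam < ‖z‖ → 0 ≤ pairing (ν - γ) z) :
    ‖z‖ ≤ lam := by
  by_contra! hlt
  have h1 := h hlt
  rw [pairing_sub_eq hz] at h1
  have h0 : ν - γ = 0 := by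
    by_contra hne
    linarith [hB _ hne]
  rw [sub_eq_zero.1 h0, add_eq_right] at hz
  rw [hz, norm_zero] at hlt
  exact hlam.not_gt hlt

variable {F : W0 p Ω → LSp p Ω → LSp q Ω} {g : LSp p D}

/-- The solution sets of the Hammerstein equation depend weakly upper semicontinuously on the
state. -/
theorem mem_hammersteinSet_of_tendsto (hp : 2 ≤ p) (hp' : p ≠ ⊤)
    (hΩ : Bornology.IsBounded (Ω : Set (Eucl N))) (h : Ω ≤ D)
    (hB : ∀ ν : LSp q Ω, ν ≠ 0 → 0 < pairing ν (B ν)) (hγ : B γ = restrictL h g)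
    (hFvar : HasUSBV F) (hFrad : ∀ y, IsRadiallyContinuous (F y)) (hFcomp : IsCompactInState F)
    {y : ℕ → W0 p Ω} {y₀ : W0 p Ω} {M R₀ : ℝ} (hM : ∀ k, ‖y k‖ ≤ M)
    (hy : ∀ ℓ : StrongDual ℝ (W0 p Ω), Tendsto (fun k => ℓ (y k)) atTop (𝓝 (ℓ y₀)))
    {z : ℕ → LSp p Ω} {z₀ : LSp p Ω} (hR : ∀ k, ‖z k‖ ≤ R₀)
    (hz : ∀ ℓ : StrongDual ℝ (LSp p Ω), Tendsto (fun k => ℓ (z k)) atTop (𝓝 (ℓ z₀)))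
    (hmem : ∀ k, z k ∈ hammersteinSet B F g (y k)) : z₀ ∈ hammersteinSet B F g y₀ := by
  have : IsFiniteMeasure (volume.restrict (Ω : Set (Eucl N))) :=
    ⟨by simpa using hΩ.measure_lt_top⟩
  let P : LSp q Ω →L[ℝ] LSp p Ω →L[ℝ] ℝ := lpDual (volume.restrict (Ω : Set (Eucl N))) q p
  have hP : ∀ (ν : LSp q Ω) (z : LSp p Ω), pairing ν z = P ν z := pairing_eq_lpDual
  have heq : ∀ k, z k + B (F (y k) (z k)) = B γ := fun k => by
    rw [hγ]
    exact (mem_hammersteinSet_iff hΩ h).1 (hmem k)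
  obtain ⟨S, C, hS, hC, hvar⟩ := hFvar (Metric.closedBall 0 (max M ‖y₀‖))
    Metric.isBounded_closedBall
  have hyB : ∀ k, y k ∈ Metric.closedBall (0 : W0 p Ω) (max M ‖y₀‖) := fun k =>
    mem_closedBall_zero_iff.2 ((hM k).trans (le_max_left _ _))
  have hy₀B : y₀ ∈ Metric.closedBall (0 : W0 p Ω) (max M ‖y₀‖) :=
    mem_closedBall_zero_iff.2 (le_max_right _ _)
  have hvar' : ∀ R > 0, ∀ k v, ‖z k‖ ≤ R → ‖v‖ ≤ R → -C y₀ R (S (z k - v)) ≤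
      (P (F (y k) (z k)) - P (F (y k) v)) (z k - v) := by
    intro R hR k v hk hv
    rw [← map_sub, ← hP]
    exact hvar R hR (y k) (hyB k) (z k) v hk hv y₀ hy₀B
  have hFlim : ∀ v, Tendsto (fun k => P (F (y k) v)) atTop (𝓝 (P (F y₀ v))) := fun v =>
    (P.continuous.tendsto _).comp (hFcomp v y y₀ (tendsto_toWeakSpace_iff.2 hy))
  obtain ⟨L, hL⟩ := exists_norm_le_of_semiboundedVariation (ν := fun k => P (F (y k) (z k)))
    (G := fun k v => P (F (y k) v)) (m := ‖P γ‖ * R₀) hS (hC y₀ hy₀B).1 hR (fun k => by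
      have h1 := pairing_sub_eq (heq k)
      have h2 := pairing_self_nonneg hB (F (y k) (z k) - γ)
      rw [hP, map_sub, sub_apply] at h1
      have h3 : P γ (z k) ≤ ‖P γ‖ * R₀ := (le_abs_self _).trans (((P γ).le_opNorm _).trans
        (mul_le_mul_of_nonneg_left (hR k) (norm_nonneg _)))
      linarith) (fun v => by
      obtain ⟨K, hK⟩ := (hFlim v).norm.bddAbove_range
      exact ⟨K, fun k => hK (mem_range_self k)⟩) hvar'
  obtain ⟨φ, ν, hφ, hν⟩ := exists_subseq_tendsto_weak_Lq hp hp' hL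
  have hz' : ∀ ℓ : StrongDual ℝ (LSp p Ω), Tendsto (fun k => ℓ (z (φ k))) atTop (𝓝 (ℓ z₀)) :=
    fun ℓ => (hz ℓ).comp hφ.tendsto_atTop
  have hz₀ : z₀ + B ν = B γ := by
    by_contra hne
    obtain ⟨ℓ, hℓ⟩ := SeparatingDual.exists_separating_of_ne (R := ℝ) hne
    refine hℓ (tendsto_nhds_unique (a := ℓ (z₀ + B ν)) (b := ℓ (B γ))
      (f := fun k => ℓ (z (φ k) + B (F (y (φ k)) (z (φ k))))) (l := atTop) ?_ ?_)
    · simp only [map_add]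
      exact (hz' ℓ).add (hν (ℓ.comp B))
    · simp only [heq]
      exact tendsto_const_nhds
  have hzB : ∀ k, z (φ k) = B γ - B (F (y (φ k)) (z (φ k))) := fun k =>
    eq_sub_of_add_eq (heq (φ k))
  have hPν : ∀ v, Tendsto (fun k => P (F (y (φ k)) (z (φ k))) v) atTop (𝓝 (P ν v)) := fun v =>
    hν (P.flip v)
  have hlim : P ν = P (F y₀ z₀) := by
    refine eq_of_semiboundedVariation (z := fun k => z (φ k))
      (ν := fun k => P (F (y (φ k)) (z (φ k)))) (G := fun k v => P (F (y (φ k)) v))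
      (G₀ := fun v => P (F y₀ v)) (u := fun k => P (F (y (φ k)) (z (φ k))) (B γ) -
        (P (F (y (φ k)) (z (φ k))) (B ν) + P ν (B (F (y (φ k)) (z (φ k)))) - P ν (B ν))) hS
      (hC y₀ hy₀B).1 (hC y₀ hy₀B).2 (fun k => hR (φ k)) hz' hPν (fun k => ?_) ?_
      (fun v => (hFlim v).comp hφ.tendsto_atTop) (fun w => ?_) (fun R hR k => hvar' R hR (φ k))
    · have h1 := pairing_self_nonneg hB (F (y (φ k)) (z (φ k)) - ν)
      rw [hP, map_sub, map_sub, sub_apply, map_sub, map_sub] at h1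
      nth_rewrite 2 [hzB k]
      rw [map_sub]
      linarith
    · have h1 := (hPν (B γ)).sub (((hPν (B ν)).add (hν ((P ν).comp B))).sub_const (P ν (B ν)))
      have h2 : P ν z₀ = P ν (B γ) - (P ν (B ν) + (P ν).comp B ν - P ν (B ν)) := by
        rw [eq_sub_of_add_eq hz₀, map_sub]
        simp
      rw [h2]
      exact h1
    · obtain ⟨ε, hε, hcont⟩ := hFrad y₀ z₀ w
      have h1 := (hcont 0 ⟨le_rfl, hε.le⟩).tendsto.mono_left
        (nhdsWithin_le_of_mem (Icc_mem_nhdsGT hε))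
      simpa only [zero_smul, add_zero, hP] using h1
  have hνF : ν = F y₀ z₀ := by
    by_contra hne
    have h1 := hB _ (sub_ne_zero.2 hne)
    rw [hP, map_sub, hlim, sub_self] at h1
    simp at h1
  rw [mem_hammersteinSet_iff hΩ h, ← hνF, hz₀, hγ]

end Hammerstein

section Tau

variable {N : ℕ} {p : ℝ≥0∞} [Fact (1 ≤ p)] {Ω D : Opens (Eucl N)}

theorem tendsto_tau_iff {t : ℕ → Control D × W0 p Ω × LSp p Ω} {U₀ : Control D} {y₀ : W0 p Ω}
    {z₀ : LSp p Ω} : Tendsto t atTop (@nhds _ (tau p Ω D) (U₀, y₀, z₀)) ↔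
      (∀ i j, TendstoWeakStar (fun k => (t k).1 i j) (U₀ i j)) ∧
      (∀ ℓ : StrongDual ℝ (W0 p Ω), Tendsto (fun k => ℓ (t k).2.1) atTop (𝓝 (ℓ y₀))) ∧
      ∀ ℓ : StrongDual ℝ (LSp p Ω), Tendsto (fun k => ℓ (t k).2.2) atTop (𝓝 (ℓ z₀)) := by
  rw [nhds_induced, tendsto_comap_iff, nhds_prod_eq, nhds_prod_eq, tendsto_prod_iff',
    tendsto_prod_iff']
  refine and_congr ?_ (and_congr tendsto_toWeakSpace_iff tendsto_toWeakSpace_iff)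
  simp only [tendsto_pi_nhds]
  rfl

theorem exists_subseq_tendsto_control (hD : Bornology.IsBounded (D : Set (Eucl N))) {β : ℝ}
    (hβ0 : 0 ≤ β) {U : ℕ → Control D}
    (hβ : ∀ k i j, ∀ᵐ x ∂(volume.restrict (D : Set (Eucl N))), |U k i j x| ≤ β) :
    ∃ (φ : ℕ → ℕ) (U₀ : Control D), StrictMono φ ∧
      ∀ i j, TendstoWeakStar (fun k => U (φ k) i j) (U₀ i j) := by
  have : IsFiniteMeasure (volume.restrict (D : Set (Eucl N))) :=
    ⟨by simpa using hD.measure_lt_top⟩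
  obtain ⟨φ, hφ, h⟩ := exists_common_subseq (ι := Fin N × Fin N)
    (P := fun e φ => ∃ a₀ : LSp ∞ D, TendstoWeakStar (fun k => U (φ k) e.1 e.2) a₀)
    (fun e φ ψ hψ ⟨a₀, h⟩ => ⟨a₀, h.comp hψ⟩) (fun e φ _ => by
      obtain ⟨ψ, a₀, hψ, h⟩ := exists_subseq_tendsto_weakStar
        (a := fun k => U (φ k) e.1 e.2) fun k =>
          Lp.norm_le_of_ae_bound hβ0 (hβ (φ k) e.1 e.2)
      exact ⟨ψ, hψ, a₀, h⟩)
  choose a₀ ha₀ using h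
  exact ⟨φ, fun i j => a₀ (i, j), hφ, fun i j => ha₀ (i, j)⟩

end Tau

end HammersteinControl

theorem mainTheorem2 {N : ℕ} (hN : 1 ≤ N) (p q : ℝ≥0∞) [Fact (1 ≤ p)] [Fact (1 ≤ q)]
    (hp : 2 ≤ p) (hp' : p ≠ ∞) (hpq : p.HolderConjugate q)
    (Ω D : Opens (Eucl N)) (hD : Bornology.IsBounded (D : Set (Eucl N))) (hΩD : Ω ≤ D)
    (α β : ℝ) (hα : 0 < α) (hαβ : α ≤ β)
    (ξ₁ ξ₂ : LSp ∞ D)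
    (hξ : ∀ᵐ x ∂(volume.restrict (D : Set (Eucl N))), 0 ≤ ξ₁ x ∧ ξ₁ x ≤ ξ₂ x)
    (Q : Fin N → Set (WNeg p D))
    (hQ : ∀ i, (Q i).Nonempty ∧ IsCompact (Q i) ∧ Convex ℝ (Q i))
    (f : WNeg p D) (g : LSp p D)
    -- `B` is a linear continuous positive operator
    (B : LSp q Ω →L[ℝ] LSp p Ω) (hBpos : ∀ ν : LSp q Ω, ν ≠ 0 → 0 < pairing ν (B ν))
    -- `Br` is a right inverse of `B` on the range of `B`, and `g` lies in this range
    -- (which is no restriction if `B` has a right inverse on all of `L^p(Ω)`)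
    (Br : LSp p Ω → LSp q Ω) (hBr : ∀ h ∈ Set.range B, B (Br h) = h)
    (hg : restrictL hΩD g ∈ Set.range B)
    (F : W0 p Ω → LSp p Ω → LSp q Ω) (hFvar : HasUSBV F)
    (hFrad : ∀ y, IsRadiallyContinuous (F y))
    (hFcoer : ∀ Y₀ : Set (W0 p Ω), Bornology.IsBounded Y₀ → ∃ lam : ℝ, 0 < lam ∧
      ∀ y ∈ Y₀, ∀ z : LSp p Ω, lam < ‖z‖ → 0 ≤ pairing (F y z - Br (restrictL hΩD g)) z)
    (hFcomp : IsCompactInState F) :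
    -- every `τ`-limit of admissible triplets is admissible, and `y₀` is the unique state of `U₀`
    (∀ (t : ℕ → Control D × W0 p Ω × LSp p Ω) (U₀ : Control D) (y₀ : W0 p Ω) (z₀ : LSp p Ω),
      (∀ k, t k ∈ admissibleTriplets hΩD α β ξ₁ ξ₂ Q B F f g) →
      Tendsto t atTop (@nhds _ (tau p Ω D) (U₀, y₀, z₀)) →
        U₀ ∈ admissibleControls p α β ξ₁ ξ₂ Q ∧
        (IsWeakSolution hΩD f U₀ y₀ ∧ ∀ y, IsWeakSolution hΩD f U₀ y → y = y₀) ∧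
        z₀ ∈ hammersteinSet B F g y₀ ∧
        (U₀, y₀, z₀) ∈ admissibleTriplets hΩD α β ξ₁ ξ₂ Q B F f g) ∧
    @IsSeqClosed _ (tau p Ω D) (admissibleTriplets hΩD α β ξ₁ ξ₂ Q B F f g) ∧
    @IsSeqCompact _ (tau p Ω D) (admissibleTriplets hΩD α β ξ₁ ξ₂ Q B F f g) := by
  have := hpq
  have h2 := two_le_toReal hp hp'
  have hΩ : Bornology.IsBounded (Ω : Set (Eucl N)) := hD.subset hΩD
  have : IsFiniteMeasure (volume.restrict (Ω : Set (Eucl N))) :=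
    ⟨by simpa using hΩ.measure_lt_top⟩
  have hQc : ∀ i, IsCompact (Q i) := fun i => (hQ i).2.1
  have hγ : B (Br (restrictL hΩD g)) = restrictL hΩD g := hBr _ hg
  set M : ℝ := max 1 (‖f‖ / min α 1)
  have hyM : ∀ t ∈ admissibleTriplets hΩD α β ξ₁ ξ₂ Q B F f g, ‖t.2.1‖ ≤ M := fun t ht =>
    ht.2.1.norm_le q hp hp' hΩD hα ht.1.1.1
  obtain ⟨lam, hlam, hcoer⟩ := hFcoer (Metric.closedBall 0 M) Metric.isBounded_closedBall
  have hzlam : ∀ t ∈ admissibleTriplets hΩD α β ξ₁ ξ₂ Q B F f g, ‖t.2.2‖ ≤ lam := by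
    intro t ht
    refine norm_le_of_hammerstein (ν := F t.2.1 t.2.2) hBpos hlam
      (((mem_hammersteinSet_iff hΩ hΩD).1 ht.2.2).trans hγ.symm) fun hlt => ?_
    exact hcoer _ (mem_closedBall_zero_iff.2 (hyM t ht)) _ hlt
  have hclosed : ∀ (t : ℕ → Control D × W0 p Ω × LSp p Ω) (U₀ : Control D) (y₀ : W0 p Ω)
      (z₀ : LSp p Ω), (∀ k, t k ∈ admissibleTriplets hΩD α β ξ₁ ξ₂ Q B F f g) →
      Tendsto t atTop (@nhds _ (tau p Ω D) (U₀, y₀, z₀)) →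
        (U₀, y₀, z₀) ∈ admissibleTriplets hΩD α β ξ₁ ξ₂ Q B F f g := by
    intro t U₀ y₀ z₀ ht hlim
    obtain ⟨hU, hy, hz⟩ := tendsto_tau_iff.1 hlim
    refine ⟨mem_admissibleControls_of_tendsto q h2 hD hQc hU fun k => (ht k).1,
      IsWeakSolution.of_tendsto q hp hp' hΩD hD hα hαβ hQc (fun k => (ht k).1) hU
        (fun k => (ht k).2.1) hy, ?_⟩
    exact mem_hammersteinSet_of_tendsto hp hp' hΩ hΩD hBpos hγ hFvar hFrad hFcomp
      (fun k => hyM _ (ht k)) hy (fun k => hzlam _ (ht k)) hz fun k => (ht k).2.2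
  refine ⟨fun t U₀ y₀ z₀ ht hlim => ?_, fun t a ht hlim => hclosed t a.1 a.2.1 a.2.2 ht hlim,
    fun t ht => ?_⟩
  · have hmem := hclosed t U₀ y₀ z₀ ht hlim
    refine ⟨hmem.1, ⟨hmem.2.1, fun y hy => ?_⟩, hmem.2.2, hmem⟩
    exact eq_of_stateForm_eq q hp hp' hΩD hmem.1.1.1 fun w => (hy w).trans (hmem.2.1 w).symm
  · obtain ⟨φ, U₀, hφ, hU⟩ := exists_subseq_tendsto_control hD (hα.le.trans hαβ)
      (U := fun k => (t k).1) fun k => (ht k).1.1.1.growth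
    obtain ⟨ψ, y₀, hψ, hy⟩ := exists_subseq_tendsto_weak_W0 q hp hp' hΩ
      (y := fun k => (t (φ k)).2.1) fun k => hyM _ (ht (φ k))
    obtain ⟨χ, z₀, hχ, hz⟩ := exists_subseq_tendsto_weak_Lp (q := q) hp hp'
      (z := fun k => (t (φ (ψ k))).2.2) fun k => hzlam _ (ht (φ (ψ k)))
    have hlim : Tendsto (t ∘ φ ∘ ψ ∘ χ) atTop (@nhds _ (tau p Ω D) (U₀, y₀, z₀)) :=
      tendsto_tau_iff.2 ⟨fun i j => (hU i j).comp (hψ.comp hχ),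
        fun ℓ => (hy ℓ).comp hχ.tendsto_atTop, hz⟩
    exact ⟨(U₀, y₀, z₀), hclosed _ U₀ y₀ z₀ (fun k => ht _) hlim, φ ∘ ψ ∘ χ,
      hφ.comp (hψ.comp hχ), hlim⟩
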